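/- Let $n_1,n_2\ge 2$ and $1\le r\le n_1n_2-1$ be integers, let $I=\{0,\dots,n_1-1\}\times\{0,\dots,n_2-1\}$, and for $\mathbf i=(i_1,i_2)\in I$ let $f_{\mathbf i}(x_1,x_2)=\big(\tfrac{x_1+i_1}{n_1},\tfrac{x_2+i_2}{n_2}\big)$ on $X=[0,1]^2$. Let $I^{(1)},I^{(2)},\dots$ be independent random subsets of $I$, each uniformly distributed on the set of all $A\subset I$ with $\#(I\setminus A)=r$. For $j\ge 1$ let $$J_j=\bigcup_{(i_m)\in\prod_{m\ge j}I^{(m)}}\ \bigcap_{m\ge j} f_{i_j}\circ\cdots\circ f_{i_m}(X),\qquad J=J_1 .$$ For $1\le j<k$ let $\mathcal N_{j,k}$ be the simplicial complex with vertex set $I^{(j)}\times\cdots\times I^{(k-1)}$ in which distinct vertices $v_0,\dots,v_q$ span a simplex iff $\bigcap_{p} f_{v_p}(J_k)\ne\emptyset$, where $f_{(i_j,\dots,i_{k-1})}=f_{i_j}\circ\cdots\circ f_{i_{k-1}}$. Let $H_q$ and $H^q$ denote simplicial homology and cohomology with coefficients in $\mathbb Z$, and let $\check H_q(J)=\varprojlim_{\mathfrak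 U}H_q(N(\mathfrak U))$ be the $q$-th Čech homology group of $J$, where $N(\mathfrak U)$ is the nerve of $\mathfrak U$ and $\mathfrak U$ runs over all finite open coverings of $J$ ordered by refinement. In the limits superior below, $\log t=-\infty$ for $t\le 0$. Then almost surely $\check H_q(J)=0$ for every $q\ge 2$, and the following hold. 1. If $r=1$, then almost surely $\check H_0(J)\cong\mathbb Z$. Moreover: (a) if $n_1=n_2=2$, then almost surely $\check H_1(J)=0$; (b) if $(n_1,n_2)\ne(2,2)$, then almost surely $\operatorname{rank}\check H_1(J)=\infty$ and $$\limsup_{k\to\infty}\frac1k\log\big(\operatorname{rank}H_1(\mathcal N_{1,k})\big)=\log(n_1n_2-r).$$ 2. If $2\le r<\min\{n_1,n_2\}$, then almost surely $\operatorname{rank}\check H_0(J)=\infty$, $\operatorname{rank}\check H_1(J)=\infty$ and $$\limsup_{k\to\infty}\frac1k\log\big(\operatorname{rank}H_1(\mathcal N_{1,k})-\operatorname{rank}H_0(\mathcal N_{1,k})\big)=\log(n_1n_2-r).$$ 3. If $n_1\le r<n_2$ (resp. $n_2\le r<n_1$), then almost surely every connected component of $J$ is a horizontal (resp. vertical) line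 segment, possibly degenerate to a single point, and at least one component is such a segment of length $1$. 4. If $r\ge\max\{n_1,n_2\}$, then almost surely $J$ is totally disconnected. Furthermore, almost surely, for all $1\le j<k$ and $q\ge 0$ the group $H_q(\mathcal N_{j,k})$ is free (in particular torsion-free) and isomorphic to $H^q(\mathcal N_{j,k})$, and every $\check H_q(J)$ is torsion-free. -/

import Mathlib

open MeasureTheory ProbabilityTheory Filter

namespace NAFractal

/-! ### Homology and cohomology of simplicial complexes -/

section Homology

variable {V W : Type*}

/-- The oriented simplex `[v₀, …, v_q]`, realised as the alternating sum of all orderings of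
`(v₀, …, v_q)`. Thus `[v ∘ σ] = sign σ • [v]`, and `[v] = 0` if two of the vertices coincide. -/
noncomputable def orientedSimplex {q : ℕ} (v : Fin (q + 1) → V) : (Fin (q + 1) → V) →₀ ℤ :=
  ∑ σ : Equiv.Perm (Fin (q + 1)), (Equiv.Perm.sign σ : ℤ) • Finsupp.single (v ∘ σ) (1 : ℤ)

/-- The vertices `v₀, …, v_q` (possibly with repetitions) span a simplex of `K`. -/
def Spans (K : PreAbstractSimplicialComplex V) {q : ℕ} (v : Fin (q + 1) → V) : Prop :=
  ∃ s ∈ K.faces, (s : Set V) = Set.range v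

/-- The group `C_q(K)` of oriented `q`-chains of `K`, generated by the oriented simplices. -/
noncomputable def chains (K : PreAbstractSimplicialComplex V) (q : ℕ) :
    Submodule ℤ ((Fin (q + 1) → V) →₀ ℤ) :=
  Submodule.span ℤ {c | ∃ v : Fin (q + 1) → V, Spans K v ∧ c = orientedSimplex v}

/-- Deleting the first vertex. On alternating chains this is the usual boundary operator,
see `dropFirst_orientedSimplex`. -/
noncomputable def dropFirst (V : Type*) (q : ℕ) :
    ((Fin (q + 2) → V) →₀ ℤ) →ₗ[ℤ] ((Fin (q + 1) → V) →₀ ℤ) :=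
  Finsupp.lmapDomain ℤ ℤ (fun v i => v i.succ)

/-- `∂ [v₀, …, v_{q+1}] = ∑ₚ (-1)ᵖ [v₀, …, v̂ₚ, …, v_{q+1}]`. -/
theorem dropFirst_orientedSimplex {q : ℕ} (v : Fin (q + 2) → V) :
    dropFirst V q (orientedSimplex v) =
      ∑ p : Fin (q + 2), (-1 : ℤ) ^ (p : ℕ) • orientedSimplex (v ∘ p.succAbove) := by
  classical
  let e : Fin (q + 2) × Equiv.Perm (Fin (q + 1)) → Equiv.Perm (Fin (q + 2)) :=
    fun x => x.1.cycleRange.symm * Equiv.Perm.decomposeFin.symm (0, x.2)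
  have he : Function.Bijective e := by
    rw [Fintype.bijective_iff_injective_and_card]
    constructor
    · rintro ⟨p, τ⟩ ⟨p', τ'⟩ h
      have h0 := congrArg (fun σ : Equiv.Perm (Fin (q + 2)) => σ 0) h
      simp only [e, Equiv.Perm.mul_apply, Equiv.Perm.decomposeFin_symm_apply_zero,
        Fin.cycleRange_symm_zero] at h0
      subst h0
      have h1 := mul_left_cancel h
      have h2 := Equiv.Perm.decomposeFin.symm.injective h1
      simpa using h2
    · simp [Fintype.card_perm, Nat.factorial_succ]
  have hs : ∀ x, (Equiv.Perm.sign (e x) : ℤ) =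
      (-1 : ℤ) ^ (x.1 : ℕ) * (Equiv.Perm.sign x.2 : ℤ) := by
    rintro ⟨p, τ⟩
    have h1 : Equiv.Perm.sign (Equiv.symm p.cycleRange) = (-1) ^ (p : ℕ) := by
      rw [Equiv.Perm.sign_symm, Fin.sign_cycleRange]
    simp [e, Equiv.Perm.sign_mul, h1, Equiv.Perm.decomposeFin.symm_sign]
  have hf : ∀ x : Fin (q + 2) × Equiv.Perm (Fin (q + 1)),
      (fun i : Fin (q + 1) => (v ∘ e x) i.succ) = (v ∘ x.1.succAbove) ∘ x.2 := by
    rintro ⟨p, τ⟩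
    funext i
    simp [e, Equiv.Perm.decomposeFin_symm_apply_succ, Fin.cycleRange_symm_succ]
  simp only [dropFirst, orientedSimplex, map_sum, map_smul, Finsupp.lmapDomain_apply,
    Finsupp.mapDomain_single]
  rw [← (Equiv.ofBijective e he).sum_comp, Fintype.sum_prod_type]
  refine Finset.sum_congr rfl fun p _ => ?_
  rw [Finset.smul_sum]
  refine Finset.sum_congr rfl fun τ _ => ?_
  rw [Equiv.ofBijective_apply, hf, hs, smul_smul]

theorem dropFirst_mem (K : PreAbstractSimplicialComplex V) (q : ℕ) :
    ∀ c ∈ chains K (q + 1), dropFirst V q c ∈ chains K q := by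
  classical
  intro c hc
  refine Submodule.span_induction (p := fun c _ => dropFirst V q c ∈ chains K q)
    ?_ (by simp) (fun x y _ _ hx hy => by rw [map_add]; exact add_mem hx hy)
    (fun a x _ hx => by rw [map_smul]; exact Submodule.smul_mem _ _ hx) hc
  rintro _ ⟨v, ⟨s, hs, hsv⟩, rfl⟩
  rw [dropFirst_orientedSimplex]
  refine Submodule.sum_mem _ fun p _ => Submodule.smul_mem _ _ (Submodule.subset_span
    ⟨_, ⟨Finset.univ.image (v ∘ p.succAbove), ?_,
      by rw [Finset.coe_image, Finset.coe_univ, Set.image_univ]⟩, rfl⟩)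
  refine (K.isRelLowerSet_faces hs).2 ?_ (Finset.univ_nonempty.image _)
  intro x hx
  obtain ⟨i, -, rfl⟩ := Finset.mem_image.1 hx
  rw [← Finset.mem_coe, hsv]
  exact ⟨_, rfl⟩

/-- The boundary operator `∂ : C_{q+1}(K) → C_q(K)`. -/
noncomputable def boundary (K : PreAbstractSimplicialComplex V) (q : ℕ) :
    chains K (q + 1) →ₗ[ℤ] chains K q :=
  (dropFirst V q).restrict (dropFirst_mem K q)

/-- The group of `q`-cycles. -/
noncomputable def cycles (K : PreAbstractSimplicialComplex V) : (q : ℕ) → Submodule ℤ (chains K q)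
  | 0 => ⊤
  | q + 1 => LinearMap.ker (boundary K q)

/-- The group of `q`-boundaries. -/
noncomputable def boundaries (K : PreAbstractSimplicialComplex V) (q : ℕ) :
    Submodule ℤ (chains K q) :=
  LinearMap.range (boundary K q)

/-- The integral homology group `H_q(K)`. -/
def Homology (K : PreAbstractSimplicialComplex V) (q : ℕ) : Type _ :=
  cycles K q ⧸ (boundaries K q).comap (cycles K q).subtype

noncomputable instance (K : PreAbstractSimplicialComplex V) (q : ℕ) : AddCommGroup (Homology K q) :=
  inferInstanceAs (AddCommGroup (cycles K q ⧸ (boundaries K q).comap (cycles K q).subtype))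

noncomputable instance (K : PreAbstractSimplicialComplex V) (q : ℕ) : Module ℤ (Homology K q) :=
  inferInstanceAs (Module ℤ (cycles K q ⧸ (boundaries K q).comap (cycles K q).subtype))

/-- The group of integral `q`-cocycles. -/
noncomputable def cocycles (K : PreAbstractSimplicialComplex V) (q : ℕ) :
    Submodule ℤ (Module.Dual ℤ (chains K q)) :=
  LinearMap.ker (boundary K q).dualMap

/-- The group of integral `q`-coboundaries. -/
noncomputable def coboundaries (K : PreAbstractSimplicialComplex V) :
    (q : ℕ) → Submodule ℤ (Module.Dual ℤ (chains K q))
  | 0 => ⊥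
  | q + 1 => LinearMap.range (boundary K q).dualMap

/-- The integral cohomology group `H^q(K)`. -/
def Cohomology (K : PreAbstractSimplicialComplex V) (q : ℕ) : Type _ :=
  cocycles K q ⧸ (coboundaries K q).comap (cocycles K q).subtype

noncomputable instance (K : PreAbstractSimplicialComplex V) (q : ℕ) : AddCommGroup (Cohomology K q) :=
  inferInstanceAs (AddCommGroup (cocycles K q ⧸ (coboundaries K q).comap (cocycles K q).subtype))

noncomputable instance (K : PreAbstractSimplicialComplex V) (q : ℕ) : Module ℤ (Cohomology K q) :=
  inferInstanceAs (Module ℤ (cocycles K q ⧸ (coboundaries K q).comap (cocycles K q).subtype))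

/-- The vertex map `g` sends simplices of `K` to simplices of `L`. -/
def IsSimplicial (K : PreAbstractSimplicialComplex V) (L : PreAbstractSimplicialComplex W)
    (g : V → W) : Prop :=
  ∀ s ∈ K.faces, ∃ t ∈ L.faces, (t : Set W) = g '' s

variable {K : PreAbstractSimplicialComplex V} {L : PreAbstractSimplicialComplex W} {g : V → W}

theorem lmapDomain_mem (hg : IsSimplicial K L g) (q : ℕ) :
    ∀ c ∈ chains K q, Finsupp.lmapDomain ℤ ℤ (fun v : Fin (q + 1) → V => g ∘ v) c ∈ chains L q := by
  intro c hc
  refine Submodule.span_induction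
    (p := fun c _ => Finsupp.lmapDomain ℤ ℤ (fun v : Fin (q + 1) → V => g ∘ v) c ∈ chains L q)
    ?_ (by simp) (fun x y _ _ hx hy => by rw [map_add]; exact add_mem hx hy)
    (fun a x _ hx => by rw [map_smul]; exact Submodule.smul_mem _ _ hx) hc
  rintro _ ⟨v, ⟨s, hs, hsv⟩, rfl⟩
  obtain ⟨t, ht, hts⟩ := hg s hs
  refine Submodule.subset_span ⟨g ∘ v, ⟨t, ht, by rw [hts, hsv, Set.range_comp]⟩, ?_⟩
  simp [orientedSimplex, Function.comp_assoc]

/-- The chain map induced by a simplicial map. -/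
noncomputable def chainMap (hg : IsSimplicial K L g) (q : ℕ) : chains K q →ₗ[ℤ] chains L q :=
  (Finsupp.lmapDomain ℤ ℤ (fun v : Fin (q + 1) → V => g ∘ v)).restrict (lmapDomain_mem hg q)

theorem boundary_chainMap (hg : IsSimplicial K L g) (q : ℕ) (c : chains K (q + 1)) :
    boundary L q (chainMap hg (q + 1) c) = chainMap hg q (boundary K q c) := by
  apply Subtype.ext
  simp only [boundary, chainMap, dropFirst, LinearMap.coe_restrict_apply,
    Finsupp.lmapDomain_apply, ← Finsupp.mapDomain_comp]
  rfl

theorem chainMap_cycles (hg : IsSimplicial K L g) (q : ℕ) :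
    ∀ c ∈ cycles K q, chainMap hg q c ∈ cycles L q := by
  cases q with
  | zero => intro c _; exact Submodule.mem_top
  | succ q =>
    intro c hc
    change boundary L q (chainMap hg (q + 1) c) = 0
    have hc' : boundary K q c = 0 := hc
    rw [boundary_chainMap, hc', map_zero]

theorem chainMap_boundaries (hg : IsSimplicial K L g) (q : ℕ) :
    (boundaries K q).comap (cycles K q).subtype ≤
      ((boundaries L q).comap (cycles L q).subtype).comap
        ((chainMap hg q).restrict (chainMap_cycles hg q)) := by
  rintro ⟨c, hc⟩ ⟨b, hb⟩
  exact ⟨chainMap hg (q + 1) b, by rw [boundary_chainMap, hb]; rfl⟩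

/-- The homomorphism `H_q(K) → H_q(L)` induced by a simplicial map. -/
noncomputable def homologyMap (hg : IsSimplicial K L g) (q : ℕ) :
    Homology K q →ₗ[ℤ] Homology L q :=
  Submodule.mapQ _ _ ((chainMap hg q).restrict (chainMap_cycles hg q)) (chainMap_boundaries hg q)

end Homology

/-! ### Nerves and Čech homology -/

section Cech

/-- The nerve of a family of sets: its simplices are the finite non-empty sets of indices whose
members have a common point. -/
def nerve {ι Y : Type*} (U : ι → Set Y) : PreAbstractSimplicialComplex ι where
  faces := {s | s.Nonempty ∧ (⋂ i ∈ s, U i).Nonempty}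
  isRelLowerSet_faces := fun _ hs => ⟨hs.1, fun _ hts ht =>
    ⟨ht, hs.2.mono (Set.biInter_subset_biInter_left fun _ hi => hts hi)⟩⟩

/-- A finite open covering of `Y`. -/
structure FiniteOpenCover (Y : Type*) [TopologicalSpace Y] where
  sets : Set (Set Y)
  finite : sets.Finite
  isOpen : ∀ U ∈ sets, IsOpen U
  covers : ⋃₀ sets = Set.univ

variable {Y : Type*} [TopologicalSpace Y]

/-- The nerve of a finite open covering; the vertices are the members of the covering. -/
def FiniteOpenCover.nerve (𝔘 : FiniteOpenCover Y) : PreAbstractSimplicialComplex 𝔘.sets :=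
  NAFractal.nerve (fun U : 𝔘.sets => (U : Set Y))

/-- `π` exhibits `𝔙` as a refinement of `𝔘`: each `V ∈ 𝔙` is contained in `π V ∈ 𝔘`. -/
def IsRefinementMap (𝔙 𝔘 : FiniteOpenCover Y) (π : 𝔙.sets → 𝔘.sets) : Prop :=
  ∀ V : 𝔙.sets, (V : Set Y) ⊆ (π V : Set Y)

theorem IsRefinementMap.isSimplicial {𝔙 𝔘 : FiniteOpenCover Y} {π : 𝔙.sets → 𝔘.sets}
    (h : IsRefinementMap 𝔙 𝔘 π) : IsSimplicial 𝔙.nerve 𝔘.nerve π := by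
  classical
  rintro s ⟨hs, y, hy⟩
  refine ⟨s.image π, ⟨hs.image π, y, ?_⟩, by simp⟩
  simp only [Set.mem_iInter] at hy ⊢
  intro U hU
  obtain ⟨V, hV, rfl⟩ := Finset.mem_image.1 hU
  exact h V (hy V hV)

/-- The Čech homology group `Ȟ_q(Y)`: the inverse limit of `H_q(N(𝔘))` over all finite open
coverings `𝔘` of `Y`, ordered by refinement. (All refinement maps `𝔙 → 𝔘` between two given
coverings are contiguous and induce the same homomorphism on homology.) -/
noncomputable def CechHomology (Y : Type*) [TopologicalSpace Y] (q : ℕ) :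
    Submodule ℤ ((𝔘 : FiniteOpenCover Y) → Homology 𝔘.nerve q) where
  carrier := {x | ∀ (𝔙 𝔘 : FiniteOpenCover Y) (π : 𝔙.sets → 𝔘.sets)
    (h : IsRefinementMap 𝔙 𝔘 π), homologyMap h.isSimplicial q (x 𝔙) = x 𝔘}
  add_mem' := fun {x y} hx hy 𝔙 𝔘 π h => by
    simp only [Pi.add_apply, map_add, hx 𝔙 𝔘 π h, hy 𝔙 𝔘 π h]
  zero_mem' := fun 𝔙 𝔘 π h => by simp only [Pi.zero_apply, map_zero]
  smul_mem' := fun a x hx 𝔙 𝔘 π h => by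
    simp only [Pi.smul_apply, map_smul, hx 𝔙 𝔘 π h]

end Cech

/-! ### Non-autonomous iterated function systems

Levels are counted from `0`: given maps `f a : X → X` for `a` in a total index set `α`, the set
`S j ⊆ α` is the index set `I^{(j+1)}`. -/

section IFS

variable {α E : Type*}

/-- `f_v = f_{v₀} ∘ f_{v₁} ∘ ⋯ ∘ f_{v_{n-1}}`. -/
def wordMap (f : α → E → E) : {n : ℕ} → (Fin n → α) → E → E
  | 0, _ => id
  | _ + 1, v => f (v 0) ∘ wordMap f (fun i => v i.succ)

/-- The limit set `J_{j+1}` of the system `S j, S (j+1), …` of self-maps of `X`: the set of all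
points of `⋂ₙ f_{w₀} ∘ ⋯ ∘ f_{w_{n-1}} (X)`, where `w` runs over `∏ₘ S (j + m)`. -/
def limitSet (f : α → E → E) (X : Set E) (S : ℕ → Set α) (j : ℕ) : Set E :=
  {x | ∃ w : ℕ → α, (∀ m, w m ∈ S (j + m)) ∧
    ∀ n : ℕ, x ∈ wordMap f (fun m : Fin n => w m) '' X}

/-- The product `S j × S (j+1) × ⋯ × S (j+ℓ-1)`. -/
def Word (S : ℕ → Set α) (j ℓ : ℕ) : Type _ :=
  {v : Fin ℓ → α // ∀ m : Fin ℓ, v m ∈ S (j + m)}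

/-- The simplicial complex `𝒩_{j+1, j+ℓ+1}`, the nerve of the covering of `J_{j+1}` by the sets
`f_v (J_{j+ℓ+1})`, `v ∈ S j × ⋯ × S (j+ℓ-1)`; the vertices are the words `v`. -/
def levelNerve (f : α → E → E) (X : Set E) (S : ℕ → Set α) (j ℓ : ℕ) :
    PreAbstractSimplicialComplex (Word S j ℓ) :=
  nerve (fun v : Word S j ℓ => wordMap f v.1 '' limitSet f X S (j + ℓ))

end IFS

/-! ### Fractal rectangles -/

section Rectangle

/-- `f_{(i₁,i₂)}(x₁,x₂) = ((x₁ + i₁)/n₁, (x₂ + i₂)/n₂)`. -/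
noncomputable def rectMap (n₁ n₂ : ℕ) (i : Fin n₁ × Fin n₂) (x : ℝ × ℝ) : ℝ × ℝ :=
  ((x.1 + (i.1 : ℕ)) / n₁, (x.2 + (i.2 : ℕ)) / n₂)

/-- The unit square `[0,1]²`. -/
def unitSquare : Set (ℝ × ℝ) := Set.Icc 0 1 ×ˢ Set.Icc 0 1

/-- The non-autonomous fractal rectangle `J`, where `S j` is the index set `I^{(j+1)}`. -/
def rectLimit (n₁ n₂ : ℕ) (S : ℕ → Set (Fin n₁ × Fin n₂)) : Set (ℝ × ℝ) :=
  limitSet (rectMap n₁ n₂) unitSquare S 0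

/-- The complex `𝒩_{j+1, j+ℓ+1}` of a non-autonomous fractal rectangle. -/
noncomputable def rectNerve (n₁ n₂ : ℕ) (S : ℕ → Set (Fin n₁ × Fin n₂)) (j ℓ : ℕ) :
    PreAbstractSimplicialComplex (Word S j ℓ) :=
  levelNerve (rectMap n₁ n₂) unitSquare S j ℓ

/-- `𝒫_r(I)`: the subsets of `I` whose complement has exactly `r` elements. -/
def subsetsMissing (n₁ n₂ r : ℕ) : Set (Set (Fin n₁ × Fin n₂)) :=
  {A | Aᶜ.ncard = r}

end Rectangle

/-- The exponential growth rate `limsup_k (1/k) log a_k`, with `log t = -∞` for `t ≤ 0`. -/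
noncomputable def growthRate (a : ℕ → ℝ) : EReal :=
  limsup (fun k : ℕ => ((1 / (k : ℝ) : ℝ) : EReal) * ENNReal.log (ENNReal.ofReal (a k))) atTop

end NAFractal

open NAFractal

/-!
Almost every realisation of the random index sets is *generic* (`Generic`, `ae_generic`): by the second
Borel–Cantelli lemma every subset of `I` with `r` missing cells occurs at infinitely many levels. All
assertions are proved for a fixed generic sequence.

**From nerves to Čech homology.** The sets `f_v (J_k)` of a level form a finite closed cover of `J` with
mesh tending to zero. Sufficiently small open thickenings have the same nerve, so that a cofinal sequence
of open coverings has the complexes `𝒩_{1,k}` as nerves, and deletion of the last letter of a word as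
refinement map (`rectTower`, `exists_radii`). Since contiguous maps agree on homology
(`homologyMap_eq_of_subset`), `Ȟ_q(J)` is the inverse limit of the groups `H_q(𝒩_{1,k})`
(`CofinalTower.cechEquiv`).

**The nerves are graphs.** In a generic sequence every cell is missing infinitely often, so that no limit
set contains a corner of the unit square. Hence at most two of the sets `f_v (J_k)` have a common point
(`isGraph_rectNerve`). The homology of a finite graph is free, isomorphic to its cohomology, and vanishes
in degrees at least two, and its ranks satisfy Euler's formula (`IsGraph.finrank_homology`).

**Few missing cells.** For `r < min n₁ n₂` every index set contains a full row and a full column. Therefore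
all neighbouring rectangles are joined by an edge (`isOrientation_rectNerve`), and cycles lift along rows
and columns from one level to the next (`homologyMap_init_one_surjective`). The edges can be counted by
recursion on the level: if the missing cells are placed well, which happens infinitely often, they
outnumber the vertices by a fixed proportion of `(n₁ n₂ - r) ^ k` (`Generic.exists_many_edges`), while
there are never more than twice as many edges as vertices. This yields the growth rates and the infinite
rank of `Ȟ_1(J)`. For `r = 1` the blocks are connected, so that all the graphs are; for `n₁ = n₂ = 2` they
moreover have fewer edges than vertices (`card_edges_two_by_two`), so that they are trees. For `r ≥ 2` new
isolated vertices appear infinitely often (`Generic.exists_isolated`), so that the rank of `Ȟ_0(J)` is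
infinite.

**Many missing cells.** For `r ≥ n₁` the lowest row is missing infinitely often, so that no limit set meets
the lower side of the unit square. Parts of `J` in different rows of the grid of any level are then
disjoint, and connected subsets of `J` are horizontal (`snd_eq_of_isPreconnected`). If also `r < n₂`, every
level has a full row, which gives a segment of length one. The case `r ≥ n₂` is symmetric.
-/

namespace NAFractal

/-! ### Alternating chains and the exterior product with a vertex -/

section Alternating

variable {V W : Type*}

/-- The alternating sum of all orderings of a tuple of arbitrary length `n`; for `n = q + 1` this is
`orientedSimplex`. The empty tuple is included so that a vertex may be split off a `0`-simplex. -/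
noncomputable def altSum {n : ℕ} (v : Fin n → V) : (Fin n → V) →₀ ℤ :=
  ∑ σ : Equiv.Perm (Fin n), (Equiv.Perm.sign σ : ℤ) • Finsupp.single (v ∘ σ) (1 : ℤ)

theorem altSum_comp_perm {n : ℕ} (v : Fin n → V) (τ : Equiv.Perm (Fin n)) :
    altSum (v ∘ τ) = (Equiv.Perm.sign τ : ℤ) • altSum v := by
  simp only [altSum, Finset.smul_sum]
  rw [← Equiv.sum_comp (Equiv.mulLeft τ) (fun σ => ((Equiv.Perm.sign τ : ℤ) • (Equiv.Perm.sign σ : ℤ) •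
    Finsupp.single (v ∘ σ) (1 : ℤ)))]
  refine Finset.sum_congr rfl fun σ _ => ?_
  rw [smul_smul, Equiv.coe_mulLeft, Equiv.Perm.sign_mul, Units.val_mul, ← mul_assoc,
    ← Units.val_mul, Int.units_mul_self, Units.val_one, one_mul]
  rfl

theorem altSum_eq_zero {n : ℕ} {v : Fin n → V} (hv : ¬ Function.Injective v) : altSum v = 0 := by
  simp only [Function.Injective, not_forall] at hv
  obtain ⟨i, j, hij, hne⟩ := hv
  have h1 : v ∘ Equiv.swap i j = v := by
    funext k
    simp only [Function.comp_apply, Equiv.swap_apply_def]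
    split_ifs with h h'
    · rw [h, hij]
    · rw [h', hij]
    · rfl
  have h2 := altSum_comp_perm v (Equiv.swap i j)
  rw [h1, Equiv.Perm.sign_swap hne] at h2
  ext u
  have h3 := DFunLike.congr_fun h2 u
  simp at h3
  simp
  omega

/-- Deleting the first entry of a tuple; for `n = q + 1` this is `dropFirst`. -/
noncomputable def tailMap (V : Type*) (n : ℕ) :
    ((Fin (n + 1) → V) →₀ ℤ) →ₗ[ℤ] ((Fin n → V) →₀ ℤ) :=
  Finsupp.lmapDomain ℤ ℤ (fun v i => v i.succ)

/-- The exterior product with the vertex `y`: the signed sum over all ways to insert `y`. -/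
noncomputable def wedge (y : V) (n : ℕ) :
    ((Fin n → V) →₀ ℤ) →ₗ[ℤ] ((Fin (n + 1) → V) →₀ ℤ) :=
  Finsupp.linearCombination ℤ fun u =>
    ∑ i : Fin (n + 1), (-1 : ℤ) ^ (i : ℕ) • Finsupp.single (i.insertNth y u : Fin (n + 1) → V) (1 : ℤ)

open Classical in
/-- The contraction with the indicator function of the vertex `a`, in the first entry. -/
noncomputable def contract (a : V) (n : ℕ) :
    ((Fin (n + 1) → V) →₀ ℤ) →ₗ[ℤ] ((Fin n → V) →₀ ℤ) :=
  Finsupp.linearCombination ℤ fun u =>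
    if u 0 = a then Finsupp.single (fun i : Fin n => u i.succ) (1 : ℤ) else 0

/-- The tuple version of the chain map induced by a vertex map. -/
noncomputable def tupleMap (g : V → W) (n : ℕ) :
    ((Fin n → V) →₀ ℤ) →ₗ[ℤ] ((Fin n → W) →₀ ℤ) :=
  Finsupp.lmapDomain ℤ ℤ (fun v => g ∘ v)

/-- Combinations of tuples that do not contain the vertex `a`. -/
noncomputable def avoiding (a : V) (n : ℕ) : Submodule ℤ ((Fin n → V) →₀ ℤ) :=
  Submodule.span ℤ {t | ∃ u : Fin n → V, a ∉ Set.range u ∧ t = Finsupp.single u (1 : ℤ)}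

theorem avoiding_induction {a : V} {n : ℕ} {M : Type*} [AddCommGroup M]
    (f g : ((Fin n → V) →₀ ℤ) →ₗ[ℤ] M)
    (h : ∀ u : Fin n → V, a ∉ Set.range u → f (Finsupp.single u 1) = g (Finsupp.single u 1))
    {t : (Fin n → V) →₀ ℤ} (ht : t ∈ avoiding a n) : f t = g t := by
  refine LinearMap.eqOn_span (s := {t | ∃ u : Fin n → V, a ∉ Set.range u ∧
    t = Finsupp.single u (1 : ℤ)}) ?_ ht
  rintro _ ⟨u, hu, rfl⟩
  exact h u hu

theorem altSum_mem_avoiding {a : V} {n : ℕ} {v : Fin n → V} (hv : a ∉ Set.range v) :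
    altSum v ∈ avoiding a n := by
  refine Submodule.sum_mem _ fun σ _ => Submodule.smul_mem _ _ (Submodule.subset_span
    ⟨_, fun h => hv ?_, rfl⟩)
  obtain ⟨i, hi⟩ := h
  exact ⟨_, hi⟩

theorem tailMap_mem_avoiding {a : V} {n : ℕ} {t : (Fin (n + 1) → V) →₀ ℤ}
    (ht : t ∈ avoiding a (n + 1)) : tailMap V n t ∈ avoiding a n := by
  suffices h : avoiding a (n + 1) ≤ (avoiding a n).comap (tailMap V n) from h ht
  refine Submodule.span_le.2 ?_
  rintro _ ⟨u, hu, rfl⟩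
  refine Submodule.subset_span ⟨fun i => u i.succ, fun h => hu ?_, by simp [tailMap]⟩
  obtain ⟨i, hi⟩ := h
  exact ⟨_, hi⟩

theorem wedge_single (y : V) {n : ℕ} (u : Fin n → V) :
    wedge y n (Finsupp.single u 1) = ∑ i : Fin (n + 1), (-1 : ℤ) ^ (i : ℕ) •
      Finsupp.single (i.insertNth y u : Fin (n + 1) → V) (1 : ℤ) := by
  simp [wedge]

theorem tailMap_wedge_zero (y : V) (t : (Fin 0 → V) →₀ ℤ) : tailMap V 0 (wedge y 0 t) = t := by
  suffices h : tailMap V 0 ∘ₗ wedge y 0 = LinearMap.id from LinearMap.congr_fun h t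
  ext u : 2
  simp only [LinearMap.comp_apply, Finsupp.lsingle_apply, wedge_single]
  simp [tailMap]

/-- Deleting the first entry is an antiderivation for `wedge`: the first summand of the wedge has `y` in
front, the others keep `y` when their first entry is deleted. -/
theorem tailMap_wedge (y : V) {n : ℕ} (t : (Fin (n + 1) → V) →₀ ℤ) :
    tailMap V (n + 1) (wedge y (n + 1) t) = t - wedge y n (tailMap V n t) := by
  suffices h : tailMap V (n + 1) ∘ₗ wedge y (n + 1) = LinearMap.id - wedge y n ∘ₗ tailMap V n from
    LinearMap.congr_fun h t
  ext u : 2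
  simp only [LinearMap.comp_apply, Finsupp.lsingle_apply, wedge_single, LinearMap.sub_apply,
    LinearMap.id_apply]
  have h1 : tailMap V n (Finsupp.single u 1) = Finsupp.single (fun i : Fin n => u i.succ) 1 := by
    simp [tailMap]
  rw [h1, wedge_single, map_sum, Fin.sum_univ_succ, sub_eq_add_neg, ← Finset.sum_neg_distrib]
  congr 1
  · simp [tailMap]
  · refine Finset.sum_congr rfl fun i _ => ?_
    rw [map_smul, Fin.val_succ, pow_succ, mul_neg_one, neg_smul]
    congr 2
    simp only [tailMap, Finsupp.lmapDomain_apply, Finsupp.mapDomain_single]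
    congr 1
    funext k
    refine Fin.succAboveCases i ?_ (fun j => ?_) k
    · simp
    · rw [Fin.insertNth_apply_succAbove, ← Fin.succ_succAbove_succ, Fin.insertNth_apply_succAbove]

theorem contract_avoiding {a : V} {n : ℕ} {t : (Fin (n + 1) → V) →₀ ℤ}
    (ht : t ∈ avoiding a (n + 1)) : contract a n t = 0 := by
  refine avoiding_induction (contract a n) 0 (fun u hu => ?_) ht
  have : u 0 ≠ a := fun h => hu ⟨_, h⟩
  simp [contract, this]

theorem contract_wedge_self {a : V} {n : ℕ} {t : (Fin n → V) →₀ ℤ}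
    (ht : t ∈ avoiding a n) : contract a n (wedge a n t) = t := by
  refine avoiding_induction (contract a n ∘ₗ wedge a n) LinearMap.id (fun u hu => ?_) ht
  simp only [LinearMap.comp_apply, wedge_single, LinearMap.id_apply]
  rw [map_sum, Fin.sum_univ_succ, Finset.sum_eq_zero, add_zero]
  · simp [contract]
  · intro i _
    cases n with
    | zero => exact i.elim0
    | succ n =>
      have h0 : (i.succ.insertNth a u : Fin (n + 2) → V) 0 = u 0 := by
        have := Fin.insertNth_apply_succAbove (α := fun _ => V) i.succ a u 0
        rwa [Fin.succ_succAbove_zero] at this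
      have : u 0 ≠ a := fun h => hu ⟨_, h⟩
      simp [contract, h0, this]

theorem tupleMap_wedge (g : V → W) (a : V) {n : ℕ} (t : (Fin n → V) →₀ ℤ) :
    tupleMap g (n + 1) (wedge a n t) = wedge (g a) n (tupleMap g n t) := by
  suffices h : tupleMap g (n + 1) ∘ₗ wedge a n = wedge (g a) n ∘ₗ tupleMap g n from
    LinearMap.congr_fun h t
  ext u : 2
  have h1 : tupleMap g n (Finsupp.single u 1) = Finsupp.single (g ∘ u) 1 := by simp [tupleMap]
  simp only [LinearMap.comp_apply, Finsupp.lsingle_apply, wedge_single, h1, map_sum, map_smul]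
  refine Finset.sum_congr rfl fun i _ => ?_
  congr 1
  simp only [tupleMap, Finsupp.lmapDomain_apply, Finsupp.mapDomain_single]
  congr 1
  funext k
  refine Fin.succAboveCases i ?_ (fun j => ?_) k <;> simp

theorem tupleMap_tailMap (g : V → W) {n : ℕ} (t : (Fin (n + 1) → V) →₀ ℤ) :
    tupleMap g n (tailMap V n t) = tailMap W n (tupleMap g (n + 1) t) := by
  simp only [tupleMap, tailMap, Finsupp.lmapDomain_apply, ← Finsupp.mapDomain_comp]
  rfl

theorem tupleMap_altSum (g : V → W) {n : ℕ} (v : Fin n → V) :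
    tupleMap g n (altSum v) = altSum (g ∘ v) := by
  simp [tupleMap, altSum, Function.comp_assoc]

theorem tupleMap_congr_avoiding {g g' : V → W} {a : V} (h : ∀ u, u ≠ a → g' u = g u) {n : ℕ}
    {t : (Fin n → V) →₀ ℤ} (ht : t ∈ avoiding a n) : tupleMap g' n t = tupleMap g n t := by
  refine avoiding_induction (tupleMap g' n) (tupleMap g n) (fun u hu => ?_) ht
  have : g' ∘ u = g ∘ u := funext fun i => h _ fun hi => hu ⟨i, hi⟩
  simp [tupleMap, this]

/-- Each ordering of `(y, v₁, …, vₙ)` arises from a unique ordering of `(v₁, …, vₙ)` by inserting `y` at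
a unique position. -/
theorem wedge_altSum (y : V) {n : ℕ} (v : Fin n → V) :
    wedge y n (altSum v) = altSum (Fin.cons y v : Fin (n + 1) → V) := by
  classical
  let e : Fin (n + 1) × Equiv.Perm (Fin n) → Equiv.Perm (Fin (n + 1)) :=
    fun x => Equiv.Perm.decomposeFin.symm (0, x.2) * x.1.cycleRange
  have hi : ∀ x, (e x) x.1 = 0 := by
    intro x
    simp [e, Equiv.Perm.mul_apply, Fin.cycleRange_self,
      Equiv.Perm.decomposeFin_symm_apply_zero]
  have he : Function.Bijective e := by
    rw [Fintype.bijective_iff_injective_and_card]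
    constructor
    · rintro ⟨p, τ⟩ ⟨p', τ'⟩ h
      have h0 : p = p' := by
        have h1 := hi (p, τ)
        rw [h] at h1
        exact (e (p', τ')).injective (h1.trans (hi (p', τ')).symm)
      subst h0
      have h2 := Equiv.Perm.decomposeFin.symm.injective (mul_right_cancel h)
      simpa using h2
    · simp [Fintype.card_perm, Nat.factorial_succ]
  have hs : ∀ x, (Equiv.Perm.sign (e x) : ℤ) =
      (-1 : ℤ) ^ (x.1 : ℕ) * (Equiv.Perm.sign x.2 : ℤ) := by
    rintro ⟨p, τ⟩
    simp [e, Equiv.Perm.sign_mul, Fin.sign_cycleRange, Equiv.Perm.decomposeFin.symm_sign, mul_comm]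
  have hf : ∀ x : Fin (n + 1) × Equiv.Perm (Fin n),
      (Fin.cons y v : Fin (n + 1) → V) ∘ e x =
        (x.1.insertNth y (v ∘ x.2) : Fin (n + 1) → V) := by
    rintro ⟨p, τ⟩
    funext k
    refine Fin.succAboveCases p ?_ (fun j => ?_) k
    · have := hi (p, τ)
      simp only at this
      simp [this]
    · simp [e, Fin.cycleRange_succAbove, Equiv.Perm.decomposeFin_symm_apply_succ]
  simp only [altSum, map_sum, map_smul, wedge_single]
  rw [← (Equiv.ofBijective e he).sum_comp, Fintype.sum_prod_type, Finset.sum_comm]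
  refine Finset.sum_congr rfl fun τ _ => ?_
  rw [Finset.smul_sum]
  refine Finset.sum_congr rfl fun p _ => ?_
  rw [Equiv.ofBijective_apply, hf, hs, smul_smul, mul_comm]

theorem altSum_eq_smul_cons {n : ℕ} (v : Fin (n + 1) → V) (p : Fin (n + 1)) :
    altSum v = (-1 : ℤ) ^ (p : ℕ) •
      altSum (Fin.cons (v p) (v ∘ p.succAbove) : Fin (n + 1) → V) := by
  have h : (Fin.cons (v p) (v ∘ p.succAbove) : Fin (n + 1) → V) = v ∘ Equiv.symm p.cycleRange := by
    funext k
    refine Fin.cases ?_ (fun j => ?_) k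
    · simp [Fin.cycleRange_symm_zero]
    · simp [Fin.cycleRange_symm_succ]
  rw [h, altSum_comp_perm, Equiv.Perm.sign_symm, Fin.sign_cycleRange, smul_smul]
  simp [← mul_pow]

end Alternating
end NAFractal

namespace NAFractal

/-! ### Functoriality of homology and refinements of families of sets -/

section Functoriality

variable {V W X : Type*} {K : PreAbstractSimplicialComplex V} {L : PreAbstractSimplicialComplex W}
  {M : PreAbstractSimplicialComplex X}

/-- The homology class of a cycle. -/
noncomputable def homologyClass (K : PreAbstractSimplicialComplex V) (q : ℕ) :
    cycles K q →ₗ[ℤ] Homology K q :=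
  ((boundaries K q).comap (cycles K q).subtype).mkQ

theorem homologyClass_surjective (K : PreAbstractSimplicialComplex V) (q : ℕ) :
    Function.Surjective (homologyClass K q) :=
  Submodule.mkQ_surjective _

theorem homologyClass_eq_iff {q : ℕ} {x y : cycles K q} :
    homologyClass K q x = homologyClass K q y ↔ (x : chains K q) - y ∈ boundaries K q :=
  Submodule.Quotient.eq _

theorem homologyClass_eq_zero_iff {q : ℕ} {x : cycles K q} :
    homologyClass K q x = 0 ↔ (x : chains K q) ∈ boundaries K q :=
  Submodule.Quotient.mk_eq_zero _

theorem homologyMap_homologyClass {g : V → W} (hg : IsSimplicial K L g) (q : ℕ) (x : cycles K q) :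
    homologyMap hg q (homologyClass K q x) =
      homologyClass L q ⟨chainMap hg q x, chainMap_cycles hg q x x.2⟩ :=
  rfl

theorem chainMap_coe {g : V → W} (hg : IsSimplicial K L g) (q : ℕ) (c : chains K q) :
    (chainMap hg q c : (Fin (q + 1) → W) →₀ ℤ) = tupleMap g (q + 1) c :=
  rfl

theorem boundary_coe (q : ℕ) (c : chains K (q + 1)) :
    (boundary K q c : (Fin (q + 1) → V) →₀ ℤ) = tailMap V (q + 1) c :=
  rfl

theorem IsSimplicial.comp {g : V → W} {h : W → X} (hh : IsSimplicial L M h)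
    (hg : IsSimplicial K L g) : IsSimplicial K M (h ∘ g) := by
  intro s hs
  obtain ⟨t, ht, hts⟩ := hg s hs
  obtain ⟨u, hu, hut⟩ := hh t ht
  exact ⟨u, hu, by rw [hut, hts, Set.image_comp]⟩

theorem homologyMap_comp {g : V → W} {h : W → X} (hh : IsSimplicial L M h)
    (hg : IsSimplicial K L g) (q : ℕ) (x : Homology K q) :
    homologyMap hh q (homologyMap hg q x) = homologyMap (hh.comp hg) q x := by
  obtain ⟨x, rfl⟩ := homologyClass_surjective K q x
  simp only [homologyMap_homologyClass]
  congr 1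
  apply Subtype.ext
  apply Subtype.ext
  simp only [chainMap_coe, tupleMap, Finsupp.lmapDomain_apply, ← Finsupp.mapDomain_comp]
  rfl

theorem isSimplicial_id (K : PreAbstractSimplicialComplex V) : IsSimplicial K K id :=
  fun s hs => ⟨s, hs, by simp⟩

theorem homologyMap_id (h : IsSimplicial K K id) (q : ℕ) (x : Homology K q) :
    homologyMap h q x = x := by
  obtain ⟨x, rfl⟩ := homologyClass_surjective K q x
  rw [homologyMap_homologyClass]
  congr 1
  apply Subtype.ext
  apply Subtype.ext
  simp only [chainMap_coe, tupleMap, Finsupp.lmapDomain_apply]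
  exact Finsupp.mapDomain_id

theorem homologyMap_congr {g g' : V → W} (hg : IsSimplicial K L g) (hg' : IsSimplicial K L g')
    (h : g = g') (q : ℕ) (x : Homology K q) : homologyMap hg q x = homologyMap hg' q x := by
  subst h
  rfl

/-- To prove a statement about chains it suffices to treat, for a given vertex `a`, the oriented
simplices that avoid `a` and those that have `a` as first vertex and nowhere else. -/
theorem chains_induction (K : PreAbstractSimplicialComplex V) (a : V) {q : ℕ}
    {p : ((Fin (q + 1) → V) →₀ ℤ) → Prop} (zero : p 0) (add : ∀ c d, p c → p d → p (c + d))
    (smul : ∀ (m : ℤ) c, p c → p (m • c))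
    (avoid : ∀ v : Fin (q + 1) → V, Spans K v → a ∉ Set.range v → p (altSum v))
    (cons : ∀ v : Fin q → V, Spans K (Fin.cons a v : Fin (q + 1) → V) → a ∉ Set.range v →
      p (altSum (Fin.cons a v : Fin (q + 1) → V)))
    {c : (Fin (q + 1) → V) →₀ ℤ} (hc : c ∈ chains K q) : p c := by
  refine Submodule.span_induction (p := fun c _ => p c) ?_ zero (fun c d _ _ => add c d)
    (fun m c _ => smul m c) hc
  rintro _ ⟨v, hv, rfl⟩
  by_cases hinj : Function.Injective v
  · by_cases ha : a ∈ Set.range v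
    · obtain ⟨i, rfl⟩ := ha
      have h := altSum_eq_smul_cons v i
      change p (altSum v)
      rw [h]
      refine smul _ _ (cons _ ?_ ?_)
      · obtain ⟨s, hs, hsv⟩ := hv
        refine ⟨s, hs, ?_⟩
        rw [hsv, Fin.range_cons, Set.range_comp, Fin.range_succAbove, ← Set.image_insert_eq,
          Set.insert_eq, Set.union_compl_self, Set.image_univ]
      · rintro ⟨j, hj⟩
        exact Fin.succAbove_ne i j (hinj hj)
    · exact avoid v hv ha
  · have : orientedSimplex v = 0 := altSum_eq_zero hinj
    rw [this]
    exact zero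

/-- Two simplicial maps that differ in one vertex only, and are contiguous, induce the same map on
homology. The chain homotopy sends `[a, v₁, …]` to `[g a, g' a, g v₁, …]`. -/
theorem homologyMap_eq_of_ne_vertex {g g' : V → W} (hg : IsSimplicial K L g)
    (hg' : IsSimplicial K L g') (a : V) (h : ∀ u, u ≠ a → g' u = g u)
    (hc : ∀ s ∈ K.faces, a ∈ s → ∃ t ∈ L.faces, (t : Set W) = insert (g' a) (g '' s)) (q : ℕ)
    (x : Homology K q) : homologyMap hg q x = homologyMap hg' q x := by
  let D : (n : ℕ) → ((Fin (n + 1) → V) →₀ ℤ) →ₗ[ℤ] ((Fin (n + 2) → W) →₀ ℤ) := fun n =>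
    wedge (g a) (n + 1) ∘ₗ wedge (g' a) n ∘ₗ tupleMap g n ∘ₗ contract a n
  have hD : ∀ {n : ℕ} (c : (Fin (n + 1) → V) →₀ ℤ), D n c =
      wedge (g a) (n + 1) (wedge (g' a) n (tupleMap g n (contract a n c))) := fun _ => rfl
  have D_avoid : ∀ {n : ℕ} {t : (Fin (n + 1) → V) →₀ ℤ}, t ∈ avoiding a (n + 1) → D n t = 0 := by
    intro n t ht
    simp [hD, contract_avoiding ht]
  have D_wedge : ∀ {n : ℕ} {t : (Fin n → V) →₀ ℤ}, t ∈ avoiding a n →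
      D n (wedge a n t) = wedge (g a) (n + 1) (wedge (g' a) n (tupleMap g n t)) := by
    intro n t ht
    rw [hD, contract_wedge_self ht]
  have D_mem : ∀ {n : ℕ} {c : (Fin (n + 1) → V) →₀ ℤ}, c ∈ chains K n →
      D n c ∈ chains L (n + 1) := by
    intro n c hcK
    refine chains_induction K a (p := fun c => D n c ∈ chains L (n + 1)) (by simp) ?_ ?_ ?_ ?_ hcK
    · intro c d h1 h2
      rw [map_add]
      exact add_mem h1 h2
    · intro m c h1
      rw [map_smul]
      exact Submodule.smul_mem _ _ h1
    · intro v _ hv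
      rw [D_avoid (altSum_mem_avoiding hv)]
      exact zero_mem _
    · rintro v ⟨s, hs, hsv⟩ hv
      rw [← wedge_altSum, D_wedge (altSum_mem_avoiding hv), tupleMap_altSum, wedge_altSum,
        wedge_altSum]
      have has : a ∈ s := by
        rw [← Finset.mem_coe, hsv]
        exact ⟨0, rfl⟩
      obtain ⟨t, ht, hts⟩ := hc s hs has
      refine Submodule.subset_span ⟨_, ⟨t, ht, ?_⟩, rfl⟩
      rw [hts, hsv, Fin.range_cons, Fin.range_cons, Fin.range_cons, Set.image_insert_eq,
        Set.range_comp, Set.insert_comm]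
  obtain ⟨x, rfl⟩ := homologyClass_surjective K q x
  rw [homologyMap_homologyClass, homologyMap_homologyClass, eq_comm, homologyClass_eq_iff]
  cases q with
  | zero =>
    refine ⟨⟨D 0 x, D_mem x.1.2⟩, Subtype.ext ?_⟩
    rw [boundary_coe]
    push_cast
    rw [chainMap_coe, chainMap_coe]
    refine chains_induction K a (p := fun c => tailMap W 1 (D 0 c) =
      tupleMap g' 1 c - tupleMap g 1 c) (by simp) ?_ ?_ ?_ ?_ x.1.2
    · intro c d h1 h2
      simp only [map_add, h1, h2]
      abel
    · intro m c h1
      simp only [map_smul, h1, smul_sub]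
    · intro v _ hv
      have := altSum_mem_avoiding hv
      rw [D_avoid this, tupleMap_congr_avoiding h this, map_zero, sub_self]
    · intro v _ hv
      have := altSum_mem_avoiding hv
      rw [← wedge_altSum, D_wedge this, tailMap_wedge, tailMap_wedge_zero, tupleMap_wedge,
        tupleMap_wedge, tupleMap_congr_avoiding h this]
  | succ q =>
    have hx : tailMap V (q + 1) x = 0 := by
      have := x.2
      change boundary K q x = 0 at this
      rw [← boundary_coe, this]
      rfl
    refine ⟨⟨D (q + 1) x, D_mem x.1.2⟩, Subtype.ext ?_⟩
    rw [boundary_coe]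
    push_cast
    rw [chainMap_coe, chainMap_coe]
    suffices hh : tailMap W (q + 2) (D (q + 1) x) + D q (tailMap V (q + 1) x) =
        tupleMap g' (q + 2) x - tupleMap g (q + 2) x by
      rwa [hx, map_zero, add_zero] at hh
    refine chains_induction K a (p := fun c => tailMap W (q + 2) (D (q + 1) c) +
      D q (tailMap V (q + 1) c) = tupleMap g' (q + 2) c - tupleMap g (q + 2) c) (by simp)
      ?_ ?_ ?_ ?_ x.1.2
    · intro c d h1 h2
      have : ∀ a b c d e f k l : (Fin (q + 2) → W) →₀ ℤ, a + b = c - d → e + f = k - l →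
          a + e + (b + f) = c + k - (d + l) := by
        intro a b c d e f k l h1 h2
        rw [add_add_add_comm, h1, h2]
        abel
      simp only [map_add]
      exact this _ _ _ _ _ _ _ _ h1 h2
    · intro m c h1
      simp only [map_smul, ← smul_sub, ← smul_add, h1]
    · intro v _ hv
      have := altSum_mem_avoiding hv
      rw [D_avoid this, D_avoid (tailMap_mem_avoiding this), tupleMap_congr_avoiding h this,
        map_zero, sub_self, add_zero]
    · intro v _ hv
      have := altSum_mem_avoiding hv
      rw [← wedge_altSum, D_wedge this, tailMap_wedge, tailMap_wedge, tupleMap_wedge,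
        tupleMap_wedge, tupleMap_congr_avoiding h this, tailMap_wedge, map_sub, map_sub,
        D_avoid this, D_wedge (tailMap_mem_avoiding this), tupleMap_tailMap]
      abel

end Functoriality

section Refinement

variable {ι κ Y : Type*} {U : ι → Set Y} {W : κ → Set Y}

/-- A refinement map of families of sets is simplicial on the nerves. -/
theorem isSimplicial_of_subset {g : ι → κ} (h : ∀ i, U i ⊆ W (g i)) :
    IsSimplicial (nerve U) (nerve W) g := by
  classical
  rintro s ⟨hs, y, hy⟩
  refine ⟨s.image g, ⟨hs.image g, y, ?_⟩, by simp⟩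
  simp only [Set.mem_iInter] at hy ⊢
  intro k hk
  obtain ⟨i, hi, rfl⟩ := Finset.mem_image.1 hk
  exact h i (hy i hi)

/-- Any two refinement maps between the same families induce the same map on homology: they are
connected by a sequence of refinement maps that differ in one vertex at a time. -/
theorem homologyMap_eq_of_subset [Finite ι] {g g' : ι → κ} (hg : ∀ i, U i ⊆ W (g i))
    (hg' : ∀ i, U i ⊆ W (g' i)) (hs : IsSimplicial (nerve U) (nerve W) g)
    (hs' : IsSimplicial (nerve U) (nerve W) g') (q : ℕ) (x : Homology (nerve U) q) :
    homologyMap hs q x = homologyMap hs' q x := by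
  classical
  cases nonempty_fintype ι
  have hm : ∀ (s : Finset ι) i, U i ⊆ W (if i ∈ s then g' i else g i) := by
    intro s i
    split_ifs
    exacts [hg' i, hg i]
  have key : ∀ s : Finset ι, homologyMap hs q x =
      homologyMap (isSimplicial_of_subset (hm s)) q x := by
    intro s
    induction s using Finset.induction_on with
    | empty => exact homologyMap_congr _ _ (by simp) q x
    | insert a s ha ih =>
      rw [ih]
      refine homologyMap_eq_of_ne_vertex _ _ a ?_ ?_ q x
      · intro u hu
        simp [hu]
      · rintro t ⟨ht, y, hy⟩ hat
        refine ⟨insert (g' a) (t.image fun i => if i ∈ s then g' i else g i),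
          ⟨Finset.insert_nonempty _ _, y, ?_⟩, by simp⟩
        simp only [Set.mem_iInter] at hy ⊢
        intro k hk
        rcases Finset.mem_insert.1 hk with rfl | hk
        · exact hg' a (hy a hat)
        · obtain ⟨i, hi, rfl⟩ := Finset.mem_image.1 hk
          exact hm s i (hy i hi)
  rw [key Finset.univ]
  exact homologyMap_congr _ _ (by simp) q x

end Refinement
end NAFractal

namespace NAFractal

/-! ### Čech homology from a cofinal sequence of coverings -/

section Tower

/-- A sequence of finite open coverings of `Y`, indexed by the vertex sets `V n` and connected by
refinement maps, that is cofinal among all finite open coverings. -/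
structure CofinalTower (Y : Type*) [TopologicalSpace Y] where
  V : ℕ → Type
  finite : ∀ n, Finite (V n)
  U : ∀ n, V n → Set Y
  isOpen : ∀ n v, IsOpen (U n v)
  covers : ∀ n, ⋃ v, U n v = Set.univ
  p : ∀ n, V (n + 1) → V n
  subset : ∀ n v, U (n + 1) v ⊆ U n (p n v)
  cofinal : ∀ 𝔘 : FiniteOpenCover Y, ∃ n, ∃ g : V n → 𝔘.sets, ∀ v, U n v ⊆ (g v : Set Y)

/-- In an inverse sequence with surjective transition maps every element of every level extends to
an element of the inverse limit. -/
theorem exists_compatible_sequence (n : ℕ) : ∀ {H : ℕ → Type*} (f : (k : ℕ) → H (k + 1) → H k)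
    (_ : ∀ k, Function.Surjective (f k)) (a : H n), ∃ y : (k : ℕ) → H k,
      (∀ k, f k (y (k + 1)) = y k) ∧ y n = a := by
  induction n with
  | zero =>
    intro H f hf a
    choose s hs using hf
    exact ⟨fun k => Nat.rec a (fun k b => s k b) k, fun k => hs k _, rfl⟩
  | succ n ih =>
    intro H f hf a
    obtain ⟨y, hy, hya⟩ := ih (H := fun k => H (k + 1)) (fun k => f (k + 1)) (fun k => hf _) a
    refine ⟨fun k => match k with
      | 0 => f 0 (y 0)
      | k + 1 => y k, fun k => ?_, hya⟩
    cases k with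
    | zero => rfl
    | succ k => exact hy k

namespace CofinalTower

variable {Y : Type} [TopologicalSpace Y] (T : CofinalTower Y)

instance (n : ℕ) : Finite (T.V n) := T.finite n

theorem isSimplicial_p (n : ℕ) : IsSimplicial (nerve (T.U (n + 1))) (nerve (T.U n)) (T.p n) :=
  isSimplicial_of_subset (T.subset n)

/-- The inverse limit of the homology groups of the nerves along the tower. -/
noncomputable def lim (q : ℕ) : Submodule ℤ ((n : ℕ) → Homology (nerve (T.U n)) q) where
  carrier := {y | ∀ n, homologyMap (T.isSimplicial_p n) q (y (n + 1)) = y n}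
  add_mem' := fun {x y} hx hy n => by simp only [Pi.add_apply, map_add, hx n, hy n]
  zero_mem' := fun n => by simp only [Pi.zero_apply, map_zero]
  smul_mem' := fun a x hx n => by simp only [Pi.smul_apply, map_smul, hx n]

/-- The covering of level `n`, as a set of open sets. -/
def cover (n : ℕ) : FiniteOpenCover Y where
  sets := Set.range (T.U n)
  finite := Set.finite_range _
  isOpen := by
    rintro _ ⟨v, rfl⟩
    exact T.isOpen n v
  covers := by rw [Set.sUnion_range, T.covers]

instance (𝔘 : FiniteOpenCover Y) : Finite 𝔘.sets := 𝔘.finite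

/-- The member of the level covering with a given index. -/
def toCover (n : ℕ) (v : T.V n) : (T.cover n).sets := ⟨T.U n v, v, rfl⟩

/-- An index of a given member of the level covering. -/
noncomputable def ofCover (n : ℕ) (s : (T.cover n).sets) : T.V n := s.2.choose

theorem U_ofCover (n : ℕ) (s : (T.cover n).sets) : T.U n (T.ofCover n s) = s := s.2.choose_spec

theorem ofCover_subset (n : ℕ) (s : (T.cover n).sets) :
    (s : Set Y) ⊆ T.U n (T.ofCover n s) := (T.U_ofCover n s).superset

theorem isSimplicial_ofCover (n : ℕ) :
    IsSimplicial (T.cover n).nerve (nerve (T.U n)) (T.ofCover n) :=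
  isSimplicial_of_subset (U := fun s : (T.cover n).sets => (s : Set Y)) (T.ofCover_subset n)

theorem isSimplicial_cover {n : ℕ} {𝔘 : FiniteOpenCover Y} {g : T.V n → 𝔘.sets}
    (hg : ∀ v, T.U n v ⊆ (g v : Set Y)) : IsSimplicial (nerve (T.U n)) 𝔘.nerve g :=
  isSimplicial_of_subset (W := fun s : 𝔘.sets => (s : Set Y)) hg

/-- The values of an element of the limit at two levels are related by a refinement map, a composition
of transition maps of the tower. -/
theorem exists_refinement {m n : ℕ} (h : m ≤ n) (q : ℕ) :
    ∃ g : T.V n → T.V m, ∃ hg : ∀ v, T.U n v ⊆ T.U m (g v), ∀ y ∈ T.lim q,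
      homologyMap (isSimplicial_of_subset hg) q (y n) = y m := by
  induction n, h using Nat.le_induction with
  | base => exact ⟨id, fun v => subset_rfl, fun y _ => homologyMap_id _ q _⟩
  | succ n hmn ih =>
    obtain ⟨g, hg, hy⟩ := ih
    refine ⟨g ∘ T.p n, fun v => (T.subset n v).trans (hg _), fun y hyl => ?_⟩
    rw [← hy y hyl, ← hyl n, homologyMap_comp]

/-- The evaluation of an element of the Čech homology on the tower. -/
noncomputable def ofCech (q : ℕ) : CechHomology Y q →ₗ[ℤ] T.lim q :=
  LinearMap.codRestrict (T.lim q)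
    (LinearMap.pi fun n => homologyMap (T.isSimplicial_ofCover n) q ∘ₗ
      LinearMap.proj (T.cover n) ∘ₗ (CechHomology Y q).subtype) (by
    rintro ⟨x, hx⟩ n
    have hπ : IsRefinementMap (T.cover (n + 1)) (T.cover n)
        (fun s => T.toCover n (T.p n (T.ofCover (n + 1) s))) := fun s =>
      (T.ofCover_subset _ s).trans (T.subset n _)
    simp only [LinearMap.pi_apply, LinearMap.comp_apply, LinearMap.proj_apply,
      Submodule.subtype_apply]
    rw [← hx _ _ _ hπ, homologyMap_comp, homologyMap_comp]
    refine homologyMap_eq_of_subset (U := fun s : (T.cover (n + 1)).sets => (s : Set Y))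
      (fun s => ?_) (fun s => ?_) _ _ q _
    · exact (T.ofCover_subset _ s).trans (T.subset n _)
    · exact (hπ s).trans (T.ofCover_subset _ _))

theorem ofCech_apply (q : ℕ) (x : CechHomology Y q) (n : ℕ) :
    (T.ofCech q x).1 n =
      homologyMap (T.isSimplicial_ofCover n) q (x.1 (T.cover n)) :=
  rfl

theorem ofCech_injective (q : ℕ) : Function.Injective (T.ofCech q) := by
  rw [injective_iff_map_eq_zero]
  intro x hx
  have h0 : ∀ n, x.1 (T.cover n) = 0 := by
    intro n
    have h1 := congrFun (congrArg Subtype.val hx) n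
    rw [ofCech_apply] at h1
    have h2 := congrArg (homologyMap (T.isSimplicial_cover (𝔘 := T.cover n) (g := T.toCover n)
      fun v => subset_rfl) q) h1
    rw [homologyMap_comp] at h2
    rw [homologyMap_congr _ (isSimplicial_id _) (funext fun s => Subtype.ext (T.U_ofCover n s)),
      homologyMap_id] at h2
    rw [h2]
    exact map_zero _
  apply Subtype.ext
  funext 𝔘
  obtain ⟨n, g, hg⟩ := T.cofinal 𝔘
  have hπ : IsRefinementMap (T.cover n) 𝔘 (g ∘ T.ofCover n) := fun s =>
    (T.ofCover_subset n s).trans (hg _)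
  rw [← x.2 _ _ _ hπ, h0, map_zero]
  rfl

theorem ofCech_surjective (q : ℕ) : Function.Surjective (T.ofCech q) := by
  rintro ⟨y, hy⟩
  choose N g hg using T.cofinal
  -- The value at `𝔘` is pushed forward from a level that refines `𝔘`; by `hx` any other level and any
  -- other refinement map give the same value.
  let x : (𝔘 : FiniteOpenCover Y) → Homology 𝔘.nerve q := fun 𝔘 =>
    homologyMap (T.isSimplicial_cover (hg 𝔘)) q (y (N 𝔘))
  have hx : ∀ (𝔘 : FiniteOpenCover Y) (n : ℕ) (k : T.V n → 𝔘.sets)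
      (hk : ∀ v, T.U n v ⊆ (k v : Set Y)),
      homologyMap (T.isSimplicial_cover hk) q (y n) = x 𝔘 := by
    intro 𝔘 n k hk
    obtain ⟨a, ha, hya⟩ := T.exists_refinement (le_max_left n (N 𝔘)) q
    obtain ⟨b, hb, hyb⟩ := T.exists_refinement (le_max_right n (N 𝔘)) q
    simp only [x]
    rw [← hya y hy, ← hyb y hy, homologyMap_comp, homologyMap_comp]
    exact homologyMap_eq_of_subset (W := fun s : 𝔘.sets => (s : Set Y))
      (fun v => (ha v).trans (hk _)) (fun v => (hb v).trans (hg 𝔘 _)) _ _ q _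
  refine ⟨⟨x, fun 𝔙 𝔘 π hπ => ?_⟩, ?_⟩
  · rw [← hx 𝔘 (N 𝔙) (π ∘ g 𝔙) (fun v => (hg 𝔙 v).trans (hπ _))]
    exact homologyMap_comp _ _ q _
  · apply Subtype.ext
    funext n
    rw [ofCech_apply]
    change homologyMap _ q (x (T.cover n)) = y n
    rw [← hx (T.cover n) n (T.toCover n) (fun v => subset_rfl), homologyMap_comp]
    conv_rhs => rw [← homologyMap_id (isSimplicial_id _) q (y n)]
    exact homologyMap_eq_of_subset (fun v => T.ofCover_subset n (T.toCover n v))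
      (fun v => subset_rfl) _ _ q _

/-- The Čech homology is the inverse limit along a cofinal tower. -/
noncomputable def cechEquiv (q : ℕ) : CechHomology Y q ≃ₗ[ℤ] T.lim q :=
  LinearEquiv.ofBijective (T.ofCech q) ⟨T.ofCech_injective q, T.ofCech_surjective q⟩

-- The nerves of the open coverings only occur through complexes `K n` that are known to agree with them.
variable {K : (n : ℕ) → PreAbstractSimplicialComplex (T.V n)} (hK : ∀ n, nerve (T.U n) = K n)
include hK

theorem cech_isTorsionFree {q : ℕ} (h : ∀ n, Module.IsTorsionFree ℤ (Homology (K n) q)) :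
    Module.IsTorsionFree ℤ (CechHomology Y q) := by
  obtain rfl : (fun n => nerve (T.U n)) = K := funext hK
  have : Module.IsTorsionFree ℤ (T.lim q) :=
    Function.Injective.moduleIsTorsionFree (fun x : T.lim q => x.1) Subtype.val_injective
      (fun _ _ => rfl)
  exact (T.ofCech_injective q).moduleIsTorsionFree (T.ofCech q) (map_smul _)

theorem cech_subsingleton {q : ℕ} (h : ∀ n, Subsingleton (Homology (K n) q)) :
    Subsingleton (CechHomology Y q) := by
  obtain rfl : (fun n => nerve (T.U n)) = K := funext hK
  exact (T.ofCech_injective q).subsingleton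

theorem cech_equiv_of_bijective {q : ℕ}
    (h : ∀ n (hs : IsSimplicial (K (n + 1)) (K n) (T.p n)),
      Function.Bijective (homologyMap hs q)) :
    Nonempty (CechHomology Y q ≃ₗ[ℤ] Homology (K 0) q) := by
  obtain rfl : (fun n => nerve (T.U n)) = K := funext hK
  let e : (n : ℕ) → Homology (nerve (T.U (n + 1))) q ≃ₗ[ℤ] Homology (nerve (T.U n)) q := fun n =>
    LinearEquiv.ofBijective _ (h n (T.isSimplicial_p n))
  let f : T.lim q →ₗ[ℤ] Homology (nerve (T.U 0)) q := LinearMap.proj 0 ∘ₗ (T.lim q).subtype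
  refine ⟨(T.cechEquiv q).trans (LinearEquiv.ofBijective f ⟨?_, ?_⟩)⟩
  · rw [injective_iff_map_eq_zero]
    rintro ⟨y, hy⟩ h0
    apply Subtype.ext
    funext n
    induction n with
    | zero => exact h0
    | succ n ih =>
      apply (h n (T.isSimplicial_p n)).1
      exact ((hy n).trans ih).trans (map_zero _).symm
  · intro a
    exact ⟨⟨fun n => Nat.rec a (fun n b => (e n).symm b) n, fun n => (e n).apply_symm_apply _⟩, rfl⟩

/-- If the transition maps are surjective, the Čech homology surjects onto the homology of each
level, so that its rank is infinite as soon as the ranks of the levels are unbounded. -/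
theorem aleph0_le_rank_cech {q : ℕ}
    (h : ∀ n (hs : IsSimplicial (K (n + 1)) (K n) (T.p n)),
      Function.Surjective (homologyMap hs q))
    (hfin : ∀ n, Module.Finite ℤ (Homology (K n) q))
    (hfree : ∀ n, Module.Free ℤ (Homology (K n) q))
    (hr : ∀ m, ∃ n, m ≤ Module.finrank ℤ (Homology (K n) q)) :
    Cardinal.aleph0 ≤ Module.rank ℤ (CechHomology Y q) := by
  obtain rfl : (fun n => nerve (T.U n)) = K := funext hK
  refine Cardinal.aleph0_le.2 fun m => ?_
  obtain ⟨n, hn⟩ := hr m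
  have := hfin n
  have := hfree n
  let f : T.lim q →ₗ[ℤ] Homology (nerve (T.U n)) q := LinearMap.proj n ∘ₗ (T.lim q).subtype
  have hf : Function.Surjective f := by
    intro a
    obtain ⟨y, hy, hya⟩ := exists_compatible_sequence n
      (H := fun k => Homology (nerve (T.U k)) q) (fun k => homologyMap (T.isSimplicial_p k) q)
      (fun k => h k _) a
    exact ⟨⟨y, hy⟩, hya⟩
  calc (m : Cardinal) ≤ (Module.finrank ℤ (Homology (nerve (T.U n)) q) : ℕ) := by exact_mod_cast hn
    _ = Module.rank ℤ (Homology (nerve (T.U n)) q) := Module.finrank_eq_rank ℤ _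
    _ ≤ Module.rank ℤ (T.lim q) := LinearMap.rank_le_of_surjective f hf
    _ = _ := (T.cechEquiv q).rank_eq.symm

end CofinalTower
end Tower
end NAFractal

namespace NAFractal

/-! ### Linear algebra over a principal ideal domain -/

section LinearAlgebra

variable {R A B : Type*} [CommRing R] [AddCommGroup A] [AddCommGroup B] [Module R A] [Module R B]

/-- A submodule with projective quotient is a direct summand. -/
theorem exists_retraction (N : Submodule R A) [Module.Projective R (A ⧸ N)] :
    ∃ ρ : A →ₗ[R] N, ∀ n : N, ρ n = n := by
  obtain ⟨s, hs⟩ := Module.projective_lifting_property N.mkQ LinearMap.id N.mkQ_surjective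
  have h : ∀ a, a - s (N.mkQ a) ∈ N := by
    intro a
    rw [← Submodule.Quotient.mk_eq_zero, ← Submodule.mkQ_apply, map_sub]
    have := LinearMap.congr_fun hs (N.mkQ a)
    simp only [LinearMap.comp_apply, LinearMap.id_apply] at this
    rw [this, sub_self]
  refine ⟨LinearMap.codRestrict N (LinearMap.id - s ∘ₗ N.mkQ) h, fun n => Subtype.ext ?_⟩
  have : N.mkQ (n : A) = 0 := by simp
  simp only [LinearMap.codRestrict_apply, LinearMap.sub_apply, LinearMap.id_apply,
    LinearMap.comp_apply, this, map_zero, sub_zero]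

theorem nonempty_equiv_dual (R A : Type*) [CommRing R] [AddCommGroup A] [Module R A]
    [Module.Free R A] [Module.Finite R A] : Nonempty (Module.Dual R A ≃ₗ[R] A) :=
  ⟨(Module.Free.chooseBasis R A).toDualEquiv.symm⟩

/-- The kernel of the transpose is isomorphic to the cokernel, if the latter is free. -/
theorem nonempty_ker_dualMap_equiv [Module.Finite R B] (d : A →ₗ[R] B)
    [Module.Free R (B ⧸ LinearMap.range d)] :
    Nonempty (LinearMap.ker d.dualMap ≃ₗ[R] (B ⧸ LinearMap.range d)) := by
  obtain ⟨e⟩ := nonempty_equiv_dual R (B ⧸ LinearMap.range d)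
  exact ⟨(LinearEquiv.ofEq _ _ (LinearMap.ker_dualMap_eq_dualAnnihilator_range d)).trans
    ((Submodule.dualQuotEquivDualAnnihilator _).symm.trans e)⟩

/-- The cokernel of the transpose is isomorphic to the kernel, if the cokernel is free. -/
theorem nonempty_coker_dualMap_equiv [IsDomain R] [IsPrincipalIdealRing R] [Module.Free R A]
    [Module.Finite R A] [Module.Free R B] (d : A →ₗ[R] B)
    [Module.Free R (B ⧸ LinearMap.range d)] :
    Nonempty ((Module.Dual R A ⧸ LinearMap.range d.dualMap) ≃ₗ[R] LinearMap.ker d) := by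
  have h1 : Module.Free R (A ⧸ LinearMap.ker d) :=
    Module.Free.of_equiv d.quotKerEquivRange.symm
  obtain ⟨ρ, hρ⟩ := exists_retraction (LinearMap.ker d)
  obtain ⟨τ, hτ⟩ := exists_retraction (LinearMap.range d)
  let f : Module.Dual R A →ₗ[R] Module.Dual R (LinearMap.ker d) := (LinearMap.ker d).subtype.dualMap
  have hf : Function.Surjective f := by
    intro φ
    refine ⟨φ ∘ₗ ρ, LinearMap.ext fun x => ?_⟩
    simp [f, LinearMap.dualMap_apply, hρ]
  have hk : LinearMap.range d.dualMap = LinearMap.ker f := by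
    apply le_antisymm
    · rintro _ ⟨ψ, rfl⟩
      refine LinearMap.mem_ker.2 (LinearMap.ext fun x => ?_)
      simp [f, LinearMap.dualMap_apply]
    · intro φ hφ
      have h0 : LinearMap.ker d ≤ LinearMap.ker φ := fun x hx =>
        LinearMap.congr_fun (LinearMap.mem_ker.1 hφ) ⟨x, hx⟩
      let ψ : LinearMap.range d →ₗ[R] R :=
        (LinearMap.ker d).liftQ φ h0 ∘ₗ d.quotKerEquivRange.symm.toLinearMap
      refine ⟨ψ ∘ₗ τ, LinearMap.ext fun x => ?_⟩
      have h2 : τ (d x) = ⟨d x, x, rfl⟩ := hτ ⟨d x, x, rfl⟩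
      have h3 : d.quotKerEquivRange.symm ⟨d x, x, rfl⟩ = (LinearMap.ker d).mkQ x :=
        d.quotKerEquivRange_symm_apply_image x _
      simp [ψ, LinearMap.dualMap_apply, h2, h3]
  obtain ⟨e⟩ := nonempty_equiv_dual R (LinearMap.ker d)
  exact ⟨((Submodule.quotEquivOfEq _ _ hk).trans (f.quotKerEquivOfSurjective hf)).trans e⟩

end LinearAlgebra

/-! ### Homology of graphs -/

section Graph

variable {V : Type*} {K : PreAbstractSimplicialComplex V}

/-- A one-dimensional complex all of whose vertices are faces. -/
structure IsGraph (K : PreAbstractSimplicialComplex V) : Prop where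
  vertex : ∀ v, {v} ∈ K.faces
  card_le : ∀ s ∈ K.faces, s.card ≤ 2

instance [Finite V] (q : ℕ) : Module.Finite ℤ (chains K q) := inferInstance
instance [Finite V] (q : ℕ) : Module.Free ℤ (chains K q) := inferInstance

instance [Finite V] (q : ℕ) : Module.Finite ℤ (Homology K q) :=
  Module.Finite.of_surjective _ (homologyClass_surjective K q)

theorem altSum_fin_one (v : Fin 1 → V) : altSum v = Finsupp.single v 1 := by
  simp [altSum]

theorem altSum_fin_two (v : Fin 2 → V) :
    altSum v = Finsupp.single v 1 - Finsupp.single ![v 1, v 0] 1 := by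
  have h : Finset.univ = ({1, Equiv.swap 0 1} : Finset (Equiv.Perm (Fin 2))) := by decide
  have h2 : v ∘ (Equiv.swap 0 1 : Equiv.Perm (Fin 2)) = ![v 1, v 0] := by
    funext i
    fin_cases i <;> rfl
  rw [altSum, h, Finset.sum_pair (by decide), h2, Equiv.Perm.sign_swap (by decide)]
  simp [sub_eq_add_neg]

theorem IsGraph.chains_zero (hK : IsGraph K) : chains K 0 = ⊤ := by
  refine eq_top_iff.2 fun c _ => ?_
  induction c using Finsupp.induction_linear with
  | zero => exact zero_mem _
  | add f g hf hg => exact add_mem (hf trivial) (hg trivial)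
  | single u m =>
    rw [← Finsupp.smul_single_one]
    refine Submodule.smul_mem _ _ (Submodule.subset_span
      ⟨u, ⟨{u 0}, hK.vertex _, ?_⟩, (altSum_fin_one u).symm⟩)
    ext x
    simp [Fin.exists_fin_one, eq_comm]

theorem IsGraph.subsingleton_chains (hK : IsGraph K) (q : ℕ) :
    Subsingleton (chains K (q + 2)) := by
  rw [Submodule.subsingleton_iff_eq_bot, eq_bot_iff]
  refine Submodule.span_le.2 ?_
  rintro _ ⟨v, ⟨s, hs, hsv⟩, rfl⟩
  refine altSum_eq_zero fun hinj => ?_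
  have h1 := hK.card_le s hs
  have h2 : s.card = q + 2 + 1 := by
    rw [← Set.ncard_coe_finset, hsv, ← Set.image_univ, Set.ncard_image_of_injective _ hinj,
      Set.ncard_univ, Nat.card_fin]
  omega

theorem IsGraph.subsingleton_homology (hK : IsGraph K) {q : ℕ} (hq : 2 ≤ q) :
    Subsingleton (Homology K q) := by
  obtain ⟨q, rfl⟩ := Nat.exists_eq_add_of_le' hq
  have := hK.subsingleton_chains q
  exact (homologyClass_surjective K (q + 2)).subsingleton

theorem IsGraph.subsingleton_cohomology (hK : IsGraph K) {q : ℕ} (hq : 2 ≤ q) :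
    Subsingleton (Cohomology K q) := by
  obtain ⟨q, rfl⟩ := Nat.exists_eq_add_of_le' hq
  have := hK.subsingleton_chains q
  have : Subsingleton (cocycles K (q + 2)) := by
    refine ⟨fun a b => Subtype.ext (LinearMap.ext fun x => ?_)⟩
    rw [Subsingleton.elim x 0, map_zero, map_zero]
  exact (Submodule.mkQ_surjective
    ((coboundaries K (q + 2)).comap (cocycles K (q + 2)).subtype)).subsingleton

/-- The first homology of a graph is its group of cycles. -/
theorem IsGraph.homology_one_equiv (hK : IsGraph K) :
    Nonempty (Homology K 1 ≃ₗ[ℤ] LinearMap.ker (boundary K 0)) := by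
  have := hK.subsingleton_chains 0
  have h : (boundaries K 1).comap (cycles K 1).subtype = ⊥ := by
    rw [eq_bot_iff]
    rintro ⟨x, hx⟩ ⟨y, hy⟩
    rw [Subsingleton.elim y 0, map_zero] at hy
    exact Subtype.ext hy.symm
  exact ⟨Submodule.quotEquivOfEqBot _ h⟩

theorem homology_zero_equiv (K : PreAbstractSimplicialComplex V) :
    Nonempty (Homology K 0 ≃ₗ[ℤ] (chains K 0 ⧸ LinearMap.range (boundary K 0))) :=
  ⟨Submodule.Quotient.equiv _ _ (Submodule.topEquiv : (⊤ : Submodule ℤ (chains K 0)) ≃ₗ[ℤ] _) (by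
    ext x
    simp only [Submodule.mem_map, Submodule.mem_comap]
    constructor
    · rintro ⟨y, hy, rfl⟩
      exact hy
    · intro hx
      exact ⟨⟨x, trivial⟩, hx, rfl⟩)⟩

theorem IsGraph.cohomology_one_equiv (hK : IsGraph K) :
    Nonempty (Cohomology K 1 ≃ₗ[ℤ]
      (Module.Dual ℤ (chains K 1) ⧸ LinearMap.range (boundary K 0).dualMap)) := by
  have := hK.subsingleton_chains 0
  have h : cocycles K 1 = ⊤ := by
    rw [eq_top_iff]
    intro φ _
    refine LinearMap.mem_ker.2 (LinearMap.ext fun x => ?_)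
    rw [Subsingleton.elim x 0, map_zero, map_zero]
  refine ⟨Submodule.Quotient.equiv _ _ ((LinearEquiv.ofEq _ _ h).trans Submodule.topEquiv) ?_⟩
  ext x
  simp only [Submodule.mem_map, Submodule.mem_comap]
  constructor
  · rintro ⟨y, hy, rfl⟩
    exact hy
  · intro hx
    exact ⟨⟨x, h ▸ trivial⟩, hx, rfl⟩

theorem cohomology_zero_equiv (K : PreAbstractSimplicialComplex V) :
    Nonempty (Cohomology K 0 ≃ₗ[ℤ] LinearMap.ker (boundary K 0).dualMap) := by
  have h : (coboundaries K 0).comap (cocycles K 0).subtype = ⊥ := by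
    rw [eq_bot_iff]
    intro x hx
    exact Subtype.ext hx
  exact ⟨Submodule.quotEquivOfEqBot _ h⟩

/-- A vertex as a `0`-chain. -/
noncomputable def IsGraph.point (hK : IsGraph K) (v : V) : chains K 0 :=
  ⟨Finsupp.single (fun _ => v) 1, by rw [hK.chains_zero]; trivial⟩

theorem IsGraph.span_point (hK : IsGraph K) : Submodule.span ℤ (Set.range hK.point) = ⊤ := by
  refine eq_top_iff.2 ?_
  rintro ⟨c, hc⟩ -
  induction c using Finsupp.induction_linear with
  | zero => exact zero_mem _
  | add f g hf hg =>
    have h : ∀ x, x ∈ chains K 0 := fun x => by rw [hK.chains_zero]; trivial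
    exact add_mem (hf (h f)) (hg (h g))
  | single u m =>
    have : (⟨Finsupp.single u m, hc⟩ : chains K 0) = m • hK.point (u 0) := by
      apply Subtype.ext
      have hu : u = fun _ => u 0 := funext fun i => by rw [Fin.fin_one_eq_zero i]
      simp [IsGraph.point, ← hu]
    rw [this]
    exact Submodule.smul_mem _ _ (Submodule.subset_span ⟨_, rfl⟩)

/-- The oriented edge from `a` to `b`. -/
noncomputable def orientedEdge {a b : V} (h : ∃ s ∈ K.faces, (s : Set V) = {a, b}) : chains K 1 :=
  ⟨altSum ![a, b], Submodule.subset_span ⟨![a, b], by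
    obtain ⟨s, hs, hsv⟩ := h
    exact ⟨s, hs, by rw [hsv]; simp [Matrix.range_cons, Set.pair_comm]⟩, rfl⟩⟩

theorem IsGraph.boundary_orientedEdge (hK : IsGraph K) {a b : V}
    (h : ∃ s ∈ K.faces, (s : Set V) = {a, b}) :
    boundary K 0 (orientedEdge h) = hK.point b - hK.point a := by
  apply Subtype.ext
  rw [boundary_coe]
  simp only [orientedEdge, altSum_fin_two, map_sub, AddSubgroupClass.coe_sub, IsGraph.point,
    tailMap, Finsupp.lmapDomain_apply, Finsupp.mapDomain_single]
  congr 2 <;> · funext i; rw [Fin.fin_one_eq_zero i]; rfl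

theorem span_orientedEdge (K : PreAbstractSimplicialComplex V) :
    Submodule.span ℤ {c | ∃ (a b : V) (h : ∃ s ∈ K.faces, (s : Set V) = {a, b}),
      c = orientedEdge h} = ⊤ := by
  refine eq_top_iff.2 ?_
  rintro ⟨c, hc⟩ -
  refine Submodule.span_induction (p := fun c (hc : c ∈ chains K 1) => (⟨c, hc⟩ : chains K 1) ∈
    Submodule.span ℤ {c | ∃ (a b : V) (h : ∃ s ∈ K.faces, (s : Set V) = {a, b}),
      c = orientedEdge h}) ?_ (zero_mem _) (fun x y _ _ hx hy => add_mem hx hy)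
    (fun m x _ hx => Submodule.smul_mem _ m hx) hc
  rintro _ ⟨v, ⟨s, hs, hsv⟩, rfl⟩
  have hv : v = ![v 0, v 1] := by
    funext i
    fin_cases i <;> rfl
  refine Submodule.subset_span ⟨v 0, v 1, ⟨s, hs, ?_⟩, ?_⟩
  · rw [hsv, hv]
    simp [Matrix.range_cons, Set.pair_comm]
  · apply Subtype.ext
    change altSum v = altSum ![v 0, v 1]
    rw [← hv]

variable [Finite V]

/-- The zeroth homology of a graph embeds into the free abelian group on its components: a `0`-chain is
a boundary as soon as its coefficients sum to zero over each component. -/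
theorem IsGraph.free_homology_zero (hK : IsGraph K) : Module.Free ℤ (Homology K 0) := by
  -- Two vertices belong to the same component if their difference is a boundary.
  let r : Setoid V :=
    { r := fun a b => hK.point a - hK.point b ∈ LinearMap.range (boundary K 0)
      iseqv := ⟨fun a => by simp, fun {a b} h => by rw [← neg_sub]; exact neg_mem h,
        fun {a b c} h h' => by rw [← sub_add_sub_cancel _ (hK.point b)]; exact add_mem h h'⟩ }
  let F : chains K 0 →ₗ[ℤ] (Quotient r →₀ ℤ) :=
    Finsupp.lmapDomain ℤ ℤ (fun u : Fin 1 → V => (Quotient.mk r (u 0))) ∘ₗ (chains K 0).subtype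
  have hF : ∀ a, F (hK.point a) = Finsupp.single (Quotient.mk r a) 1 := by
    intro a
    simp [F, IsGraph.point]
  -- `F` sums the coefficients over each component; `G` is a section of `F` up to boundaries.
  let G : (Quotient r →₀ ℤ) →ₗ[ℤ] chains K 0 :=
    Finsupp.linearCombination ℤ fun x => hK.point (Quotient.out x)
  have hG : ∀ z, z - G (F z) ∈ LinearMap.range (boundary K 0) := by
    intro z
    have hz : z ∈ Submodule.span ℤ (Set.range hK.point) := hK.span_point ▸ trivial
    refine Submodule.span_induction (p := fun z _ => z - G (F z) ∈ LinearMap.range (boundary K 0))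
      ?_ (by simp) ?_ ?_ hz
    · rintro _ ⟨a, rfl⟩
      rw [hF]
      simp only [G, Finsupp.linearCombination_single, one_smul]
      exact r.symm (Quotient.mk_out (s := r) a)
    · intro x y _ _ hx hy
      rw [map_add, map_add, add_sub_add_comm]
      exact add_mem hx hy
    · intro m x _ hx
      rw [map_smul, map_smul, ← smul_sub]
      exact Submodule.smul_mem _ _ hx
  have hle : LinearMap.range (boundary K 0) ≤ LinearMap.ker F := by
    rw [LinearMap.range_eq_map, ← span_orientedEdge, Submodule.map_span_le]
    rintro _ ⟨a, b, h, rfl⟩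
    have : (Quotient.mk r a) = Quotient.mk r b :=
      Quotient.sound (r.symm ⟨_, hK.boundary_orientedEdge h⟩)
    rw [LinearMap.mem_ker, hK.boundary_orientedEdge, map_sub, hF, hF, this, sub_self]
  let f := (LinearMap.range (boundary K 0)).liftQ F hle
  have hf : Function.Injective f := by
    rw [injective_iff_map_eq_zero]
    intro x
    obtain ⟨z, rfl⟩ := Submodule.mkQ_surjective _ x
    intro hz
    have hz' : F z = 0 := hz
    have := hG z
    rw [hz', map_zero, sub_zero] at this
    exact (Submodule.Quotient.mk_eq_zero _).2 this
  obtain ⟨e⟩ := homology_zero_equiv K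
  have : Module.IsTorsionFree ℤ (Homology K 0) :=
    (hf.comp e.injective).moduleIsTorsionFree (f ∘ e) (by simp)
  infer_instance

theorem IsGraph.free_homology (hK : IsGraph K) (q : ℕ) : Module.Free ℤ (Homology K q) := by
  rcases q with _ | _ | q
  · exact hK.free_homology_zero
  · obtain ⟨e⟩ := hK.homology_one_equiv
    exact Module.Free.of_equiv e.symm
  · have := hK.subsingleton_homology (q := q + 2) (by omega)
    exact Module.Free.of_subsingleton _ _

/-- The homology of a graph is isomorphic to its cohomology. -/
theorem IsGraph.homology_equiv_cohomology (hK : IsGraph K) (q : ℕ) :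
    Nonempty (Homology K q ≃ₗ[ℤ] Cohomology K q) := by
  rcases q with _ | _ | q
  · obtain ⟨e⟩ := homology_zero_equiv K
    obtain ⟨e'⟩ := cohomology_zero_equiv K
    have := hK.free_homology_zero
    have := Module.Free.of_equiv e
    obtain ⟨e''⟩ := nonempty_ker_dualMap_equiv (boundary K 0)
    exact ⟨e.trans (e''.symm.trans e'.symm)⟩
  · obtain ⟨e0⟩ := homology_zero_equiv K
    obtain ⟨e⟩ := hK.homology_one_equiv
    obtain ⟨e'⟩ := hK.cohomology_one_equiv
    have := hK.free_homology_zero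
    have := Module.Free.of_equiv e0
    obtain ⟨e''⟩ := nonempty_coker_dualMap_equiv (boundary K 0)
    exact ⟨e.trans (e''.symm.trans e'.symm)⟩
  · have := hK.subsingleton_homology (q := q + 2) (by omega)
    have := hK.subsingleton_cohomology (q := q + 2) (by omega)
    exact ⟨LinearEquiv.ofBijective 0 ⟨fun _ _ _ => Subsingleton.elim _ _,
      fun x => ⟨0, Subsingleton.elim _ _⟩⟩⟩

theorem IsGraph.finrank_chains_zero (hK : IsGraph K) :
    Module.finrank ℤ (chains K 0) = Nat.card V := by
  cases nonempty_fintype V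
  rw [hK.chains_zero, finrank_top]
  simp

/-- `D` contains each edge of the graph `K` in exactly one of its two orientations. -/
structure IsOrientation (K : PreAbstractSimplicialComplex V) (D : Set (V × V)) : Prop where
  ne : ∀ a b, (a, b) ∈ D → a ≠ b
  asymm : ∀ a b, (a, b) ∈ D → (b, a) ∉ D
  edge_iff : ∀ a b, a ≠ b → ((∃ s ∈ K.faces, (s : Set V) = {a, b}) ↔ (a, b) ∈ D ∨ (b, a) ∈ D)

theorem IsOrientation.finrank_chains_one {D : Set (V × V)} (hD : IsOrientation K D) :
    Module.finrank ℤ (chains K 1) = Nat.card D := by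
  cases nonempty_fintype D
  let x : D → ((Fin 2 → V) →₀ ℤ) := fun e => altSum ![e.1.1, e.1.2]
  have hli : LinearIndependent ℤ x := by
    rw [Fintype.linearIndependent_iff]
    intro g hg e
    have h1 := DFunLike.congr_fun hg ![e.1.1, e.1.2]
    rw [Finsupp.finsetSum_apply, Finset.sum_eq_single e] at h1
    · have hne : ![e.1.2, e.1.1] ≠ ![e.1.1, e.1.2] := fun h =>
        hD.ne _ _ e.2 (congrFun h 1)
      simpa [x, altSum_fin_two, Finsupp.single_apply, hne] using h1
    · intro e' _ hne
      have h2 : ![e'.1.1, e'.1.2] ≠ ![e.1.1, e.1.2] := fun h =>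
        hne (Subtype.ext (Prod.ext (congrFun h 0) (congrFun h 1)))
      have h3 : ![e'.1.2, e'.1.1] ≠ ![e.1.1, e.1.2] := by
        intro h
        have h4 : (e.1.2, e.1.1) = e'.1 := Prod.ext (congrFun h 1).symm (congrFun h 0).symm
        exact hD.asymm _ _ e.2 (h4 ▸ e'.2)
      simp [x, altSum_fin_two, h2, h3]
    · simp
  have hspan : chains K 1 = Submodule.span ℤ (Set.range x) := by
    apply le_antisymm
    · refine Submodule.span_le.2 ?_
      rintro _ ⟨v, ⟨s, hs, hsv⟩, rfl⟩
      have hv : v = ![v 0, v 1] := by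
        funext i
        fin_cases i <;> rfl
      change altSum v ∈ _
      by_cases h01 : v 0 = v 1
      · rw [altSum_eq_zero fun h => absurd (h h01) (by decide)]
        exact zero_mem _
      · have h2 : (s : Set V) = {v 0, v 1} := by
          rw [hsv, hv]
          simp [Matrix.range_cons, Set.pair_comm]
        rcases (hD.edge_iff _ _ h01).1 ⟨s, hs, h2⟩ with h | h
        · refine Submodule.subset_span ⟨⟨_, h⟩, ?_⟩
          exact congrArg altSum hv.symm
        · have h3 : altSum v = - x ⟨_, h⟩ := by
            conv_lhs => rw [hv]
            simp [x, altSum_fin_two]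
          rw [h3]
          exact neg_mem (Submodule.subset_span ⟨_, rfl⟩)
    · refine Submodule.span_le.2 ?_
      rintro _ ⟨e, rfl⟩
      exact (orientedEdge ((hD.edge_iff _ _ (hD.ne _ _ e.2)).2 (Or.inl e.2))).2
  rw [hspan, finrank_span_eq_card hli, Nat.card_eq_fintype_card]

/-- The Euler characteristic of a graph. -/
theorem IsGraph.finrank_homology (hK : IsGraph K) {D : Set (V × V)} (hD : IsOrientation K D) :
    Module.finrank ℤ (Homology K 1) + Nat.card V =
      Module.finrank ℤ (Homology K 0) + Nat.card D := by
  obtain ⟨e0⟩ := homology_zero_equiv K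
  obtain ⟨e1⟩ := hK.homology_one_equiv
  have h1 := Submodule.finrank_quotient_add_finrank (LinearMap.ker (boundary K 0))
  rw [(boundary K 0).quotKerEquivRange.finrank_eq] at h1
  have h2 := Submodule.finrank_quotient_add_finrank (LinearMap.range (boundary K 0))
  rw [hK.finrank_chains_zero, ← e0.finrank_eq] at h2
  rw [hD.finrank_chains_one, ← e1.finrank_eq] at h1
  omega

theorem IsGraph.finrank_homology_one_le (hK : IsGraph K) {D : Set (V × V)}
    (hD : IsOrientation K D) : Module.finrank ℤ (Homology K 1) ≤ Nat.card D := by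
  obtain ⟨e1⟩ := hK.homology_one_equiv
  rw [e1.finrank_eq, ← hD.finrank_chains_one]
  exact Submodule.finrank_le _

end Graph
end NAFractal

namespace NAFractal

/-! ### Digits, words and positions in the grid -/

section Digits

/-- The position in `{0, …, n ^ ℓ - 1}` of the `n`-adic interval with the given digits. -/
def gridPos (n : ℕ) : {ℓ : ℕ} → (Fin ℓ → Fin n) → ℕ
  | 0, _ => 0
  | _ + 1, v => n * gridPos n (fun i => v i.castSucc) + v (Fin.last _)

theorem gridPos_succ {n ℓ : ℕ} (v : Fin (ℓ + 1) → Fin n) :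
    gridPos n v = n * gridPos n (fun i => v i.castSucc) + v (Fin.last _) := rfl

theorem gridPos_injective (n : ℕ) : ∀ {ℓ : ℕ}, Function.Injective (gridPos n (ℓ := ℓ))
  | 0 => fun _ _ _ => Subsingleton.elim _ _
  | ℓ + 1 => by
    intro v w h
    rw [gridPos_succ, gridPos_succ] at h
    have hv := (v (Fin.last ℓ)).2
    have hw := (w (Fin.last ℓ)).2
    have h0 : 0 < n := by omega
    have h1 : (v (Fin.last ℓ) : ℕ) = w (Fin.last ℓ) := by
      have := congrArg (· % n) h
      simpa [Nat.mul_add_mod, Nat.mod_eq_of_lt hv, Nat.mod_eq_of_lt hw] using this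
    have h2 : gridPos n (fun i => v i.castSucc) = gridPos n (fun i => w i.castSucc) := by
      rw [h1] at h
      exact Nat.eq_of_mul_eq_mul_left h0 (Nat.add_right_cancel h)
    have h3 := gridPos_injective n h2
    funext i
    refine Fin.lastCases (Fin.ext h1) (fun j => congrFun h3 j) i

theorem sum_ofDigitsTerm {n : ℕ} (hn : n ≠ 0) (a : ℕ → Fin n) (ℓ : ℕ) :
    ∑ i ∈ Finset.range ℓ, Real.ofDigitsTerm a i =
      (gridPos n (fun i : Fin ℓ => a i) : ℝ) / (n : ℝ) ^ ℓ := by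
  have hn' : (n : ℝ) ≠ 0 := by exact_mod_cast hn
  induction ℓ with
  | zero => simp [gridPos]
  | succ ℓ ih =>
    rw [Finset.sum_range_succ, ih, gridPos_succ]
    simp only [Real.ofDigitsTerm, Fin.val_castSucc, Fin.val_last]
    push_cast
    field_simp
    ring

theorem ofDigits_eq_gridPos {n : ℕ} (hn : n ≠ 0) (a : ℕ → Fin n) (ℓ : ℕ) :
    Real.ofDigits a = (Real.ofDigits (fun i => a (ℓ + i)) +
      gridPos n (fun i : Fin ℓ => a i)) / (n : ℝ) ^ ℓ := by
  rw [Real.ofDigits_eq_sum_add_ofDigits a ℓ, sum_ofDigitsTerm hn]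
  simp only [add_comm ℓ]
  ring

theorem ofDigits_eq_zero_iff {n : ℕ} (a : ℕ → Fin n) :
    Real.ofDigits a = 0 ↔ ∀ i, (a i : ℕ) = 0 := by
  have h := fun i => (a i).pos
  have h0 : (n : ℝ) ≠ 0 := by
    have := h 0
    positivity
  have h1 : HasSum (Real.ofDigitsTerm a) 0 ↔ Real.ofDigitsTerm a = 0 :=
    hasSum_zero_iff_of_nonneg fun _ => Real.ofDigitsTerm_nonneg
  rw [Real.ofDigits, ← Real.summable_ofDigitsTerm.hasSum_iff, h1, funext_iff]
  simp [Real.ofDigitsTerm, h0]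

theorem ofDigits_eq_one_iff {n : ℕ} (hn : 2 ≤ n) (a : ℕ → Fin n) :
    Real.ofDigits a = 1 ↔ ∀ i, (a i : ℕ) = n - 1 := by
  constructor
  · intro h i
    by_contra hi
    have h1 := ofDigits_eq_gridPos (by omega) a (i + 1)
    have h2 := Real.ofDigits_le_one (fun k => a (i + 1 + k))
    have key : ∀ ℓ (v : Fin ℓ → Fin n), gridPos n v + 1 ≤ n ^ ℓ := by
      intro ℓ
      induction ℓ with
      | zero => intro v; simp [gridPos]
      | succ ℓ ih =>
        intro v
        have h3 := ih (fun i => v i.castSucc)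
        have h4 := (v (Fin.last ℓ)).2
        rw [gridPos_succ, pow_succ]
        nlinarith
    have h5 := key i (fun k : Fin i => a k)
    have h6 : gridPos n (fun k : Fin (i + 1) => a k) + 2 ≤ n ^ (i + 1) := by
      rw [gridPos_succ, pow_succ]
      have := (a i).2
      simp only [Fin.val_castSucc, Fin.val_last]
      have h7 : (a i : ℕ) + 2 ≤ n := by omega
      nlinarith
    have h8 : (gridPos n (fun k : Fin (i + 1) => a k) : ℝ) + 2 ≤ (n : ℝ) ^ (i + 1) := by
      exact_mod_cast h6
    have h9 : (0 : ℝ) < (n : ℝ) ^ (i + 1) := by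
      have : 0 < n := by omega
      positivity
    rw [h, eq_div_iff h9.ne'] at h1
    linarith
  · intro h
    have : a = fun _ => (⟨n - 1, by omega⟩ : Fin n) := funext fun i => Fin.ext (h i)
    rw [this]
    exact Real.ofDigits_const_last_eq_one' (by omega)

/-- Two intervals of the grid of mesh `1 / N` meet only if they agree or are adjacent, and in the latter
case only in their common end point. -/
theorem eq_or_adjacent_of_div_eq {x y N : ℝ} {a b : ℕ} (hN : N ≠ 0) (hx : x ∈ Set.Icc (0 : ℝ) 1)
    (hy : y ∈ Set.Icc (0 : ℝ) 1) (h : (x + a) / N = (y + b) / N) :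
    (a = b ∧ x = y) ∨ (b = a + 1 ∧ x = 1 ∧ y = 0) ∨ (a = b + 1 ∧ x = 0 ∧ y = 1) := by
  rw [div_left_inj' hN] at h
  obtain ⟨hx0, hx1⟩ := hx
  obtain ⟨hy0, hy1⟩ := hy
  rcases lt_trichotomy a b with hab | hab | hab
  · have h1 : (a : ℝ) + 1 ≤ b := by exact_mod_cast hab
    have h2 : (b : ℝ) = (a + 1 : ℕ) := by push_cast; linarith
    exact Or.inr (Or.inl ⟨by exact_mod_cast h2, by linarith, by linarith⟩)
  · subst hab
    exact Or.inl ⟨rfl, by linarith⟩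
  · have h1 : (b : ℝ) + 1 ≤ a := by exact_mod_cast hab
    have h2 : (a : ℝ) = (b + 1 : ℕ) := by push_cast; linarith
    exact Or.inr (Or.inr ⟨by exact_mod_cast h2, by linarith, by linarith⟩)

end Digits

section WordMap

variable {α E : Type*}

theorem wordMap_succ_last (f : α → E → E) : ∀ {n : ℕ} (v : Fin (n + 1) → α),
    wordMap f v = wordMap f (fun i : Fin n => v i.castSucc) ∘ f (v (Fin.last n))
  | 0, v => rfl
  | n + 1, v => by
    change f (v 0) ∘ wordMap f (fun i => v i.succ) = (f (v 0) ∘ wordMap f _) ∘ _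
    rw [wordMap_succ_last f (fun i => v i.succ)]
    rfl

end WordMap

/-! ### Limit sets of fractal rectangles -/

section Limit

variable {n₁ n₂ : ℕ}

theorem wordMap_rectMap (hn₁ : n₁ ≠ 0) (hn₂ : n₂ ≠ 0) : ∀ {ℓ : ℕ} (v : Fin ℓ → Fin n₁ × Fin n₂)
    (x : ℝ × ℝ), wordMap (rectMap n₁ n₂) v x =
      ((x.1 + gridPos n₁ (fun i => (v i).1)) / (n₁ : ℝ) ^ ℓ,
        (x.2 + gridPos n₂ (fun i => (v i).2)) / (n₂ : ℝ) ^ ℓ)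
  | 0, v, x => by simp [wordMap, gridPos]
  | ℓ + 1, v, x => by
    have h1 : (n₁ : ℝ) ≠ 0 := by exact_mod_cast hn₁
    have h2 : (n₂ : ℝ) ≠ 0 := by exact_mod_cast hn₂
    rw [wordMap_succ_last, Function.comp_apply, wordMap_rectMap hn₁ hn₂, gridPos_succ, gridPos_succ,
      rectMap]
    ext
    · simp only
      push_cast
      field_simp
      ring
    · simp only
      push_cast
      field_simp
      ring

/-- The limit set `J_{k+1}` of the levels from `k` on. -/
noncomputable abbrev tailSet (S : ℕ → Set (Fin n₁ × Fin n₂)) (k : ℕ) : Set (ℝ × ℝ) :=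
  limitSet (rectMap n₁ n₂) unitSquare S k

/-- The point with the given sequence of pairs of digits. -/
noncomputable def codePoint (w : ℕ → Fin n₁ × Fin n₂) : ℝ × ℝ :=
  (Real.ofDigits fun m => (w m).1, Real.ofDigits fun m => (w m).2)

theorem codePoint_mem_unitSquare (w : ℕ → Fin n₁ × Fin n₂) : codePoint w ∈ unitSquare :=
  ⟨⟨Real.ofDigits_nonneg _, Real.ofDigits_le_one _⟩,
    ⟨Real.ofDigits_nonneg _, Real.ofDigits_le_one _⟩⟩

theorem codePoint_eq_wordMap (hn₁ : n₁ ≠ 0) (hn₂ : n₂ ≠ 0) (w : ℕ → Fin n₁ × Fin n₂) (ℓ : ℕ) :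
    codePoint w = wordMap (rectMap n₁ n₂) (fun i : Fin ℓ => w i)
      (codePoint fun m => w (ℓ + m)) := by
  rw [wordMap_rectMap hn₁ hn₂]
  exact Prod.ext (ofDigits_eq_gridPos hn₁ _ ℓ) (ofDigits_eq_gridPos hn₂ _ ℓ)

theorem eq_of_abs_sub_le_pow {n : ℕ} (hn : 2 ≤ n) {x y : ℝ}
    (h : ∀ ℓ : ℕ, |x - y| ≤ 1 / (n : ℝ) ^ ℓ) : x = y := by
  have hn' : (1 : ℝ) < n := by exact_mod_cast hn
  have h1 : Tendsto (fun ℓ : ℕ => 1 / (n : ℝ) ^ ℓ) atTop (nhds 0) := by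
    simp only [one_div]
    exact tendsto_inv_atTop_zero.comp (tendsto_pow_atTop_atTop_of_one_lt hn')
  have h2 : |x - y| ≤ 0 := ge_of_tendsto' h1 h
  exact sub_eq_zero.1 (abs_nonpos_iff.1 h2)

theorem abs_sub_le_of_same_pos {n : ℕ} (hn : 2 ≤ n) {t s : ℝ} (ht : t ∈ Set.Icc (0 : ℝ) 1)
    (hs : s ∈ Set.Icc (0 : ℝ) 1) (p ℓ : ℕ) :
    |(t + p) / (n : ℝ) ^ ℓ - (s + p) / (n : ℝ) ^ ℓ| ≤ 1 / (n : ℝ) ^ ℓ := by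
  have hn' : 0 < (n : ℝ) ^ ℓ := by
    have : 0 < n := by omega
    positivity
  rw [← sub_div, abs_div, abs_of_pos hn', add_sub_add_right_eq_sub]
  gcongr
  rw [abs_le]
  constructor <;> linarith [ht.1, ht.2, hs.1, hs.2]

/-- The limit set consists of the points with an expansion whose digits at each level belong to the
index set of that level. -/
theorem mem_tailSet_iff (hn₁ : 2 ≤ n₁) (hn₂ : 2 ≤ n₂) {S : ℕ → Set (Fin n₁ × Fin n₂)} {k : ℕ}
    {x : ℝ × ℝ} : x ∈ tailSet S k ↔ ∃ w : ℕ → Fin n₁ × Fin n₂, (∀ m, w m ∈ S (k + m)) ∧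
      codePoint w = x := by
  constructor
  · rintro ⟨w, hw, hx⟩
    refine ⟨w, hw, ?_⟩
    refine Prod.ext (eq_of_abs_sub_le_pow hn₁ fun ℓ => ?_) (eq_of_abs_sub_le_pow hn₂ fun ℓ => ?_)
    all_goals
      obtain ⟨y, hy, hxy⟩ := hx ℓ
      rw [wordMap_rectMap (by omega) (by omega)] at hxy
      rw [codePoint_eq_wordMap (by omega) (by omega) w ℓ, wordMap_rectMap (by omega) (by omega),
        ← hxy]
    · exact abs_sub_le_of_same_pos hn₁ (codePoint_mem_unitSquare _).1 hy.1 _ _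
    · exact abs_sub_le_of_same_pos hn₂ (codePoint_mem_unitSquare _).2 hy.2 _ _
  · rintro ⟨w, hw, rfl⟩
    exact ⟨w, hw, fun ℓ => ⟨_, codePoint_mem_unitSquare _,
      (codePoint_eq_wordMap (by omega) (by omega) w ℓ).symm⟩⟩

theorem tailSet_subset_unitSquare {S : ℕ → Set (Fin n₁ × Fin n₂)} {k : ℕ} :
    tailSet S k ⊆ unitSquare := by
  rintro x ⟨w, -, hx⟩
  obtain ⟨y, hy, rfl⟩ := hx 0
  exact hy

theorem isCompact_tailSet (hn₁ : 2 ≤ n₁) (hn₂ : 2 ≤ n₂) (S : ℕ → Set (Fin n₁ × Fin n₂)) (k : ℕ) :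
    IsCompact (tailSet S k) := by
  have h1 : IsCompact (Set.univ.pi fun m => S (k + m)) :=
    isCompact_univ_pi fun m => (Set.toFinite (S (k + m))).isCompact
  have h2 : Continuous (codePoint (n₁ := n₁) (n₂ := n₂)) :=
    (Real.continuous_ofDigits.comp (by fun_prop)).prodMk
      (Real.continuous_ofDigits.comp (by fun_prop))
  convert h1.image h2 using 1
  ext x
  rw [mem_tailSet_iff hn₁ hn₂]
  simp

theorem tailSet_nonempty (hn₁ : 2 ≤ n₁) (hn₂ : 2 ≤ n₂) {S : ℕ → Set (Fin n₁ × Fin n₂)}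
    (hS : ∀ m, (S m).Nonempty) (k : ℕ) : (tailSet S k).Nonempty := by
  choose w hw using hS
  exact ⟨_, (mem_tailSet_iff hn₁ hn₂).2 ⟨fun m => w (k + m), fun m => hw _, rfl⟩⟩

/-- `f_v (J_{j+ℓ}) ⊆ J_j` for every word `v` of the levels `j, …, j + ℓ - 1`. -/
theorem image_tailSet_subset (hn₁ : 2 ≤ n₁) (hn₂ : 2 ≤ n₂) {S : ℕ → Set (Fin n₁ × Fin n₂)}
    {j ℓ : ℕ} (v : Word S j ℓ) :
    wordMap (rectMap n₁ n₂) v.1 '' tailSet S (j + ℓ) ⊆ tailSet S j := by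
  rintro _ ⟨x, hx, rfl⟩
  obtain ⟨w, hw, rfl⟩ := (mem_tailSet_iff hn₁ hn₂).1 hx
  let u : ℕ → Fin n₁ × Fin n₂ := fun m => if h : m < ℓ then v.1 ⟨m, h⟩ else w (m - ℓ)
  have h1 : (fun i : Fin ℓ => u i) = v.1 := by
    funext i
    simp [u]
  have h2 : (fun m => u (ℓ + m)) = w := by
    funext m
    simp [u]
  refine (mem_tailSet_iff hn₁ hn₂).2 ⟨u, fun m => ?_, ?_⟩
  · simp only [u]
    split_ifs with h
    · exact v.2 ⟨m, h⟩
    · have := hw (m - ℓ)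
      rwa [add_assoc, Nat.add_sub_cancel' (by omega)] at this
  · rw [codePoint_eq_wordMap (by omega) (by omega) u ℓ, h1, h2]

theorem exists_word_of_mem_tailSet (hn₁ : 2 ≤ n₁) (hn₂ : 2 ≤ n₂) {S : ℕ → Set (Fin n₁ × Fin n₂)}
    {j : ℕ} (ℓ : ℕ) {x : ℝ × ℝ} (hx : x ∈ tailSet S j) :
    ∃ v : Word S j ℓ, x ∈ wordMap (rectMap n₁ n₂) v.1 '' tailSet S (j + ℓ) := by
  obtain ⟨w, hw, rfl⟩ := (mem_tailSet_iff hn₁ hn₂).1 hx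
  exact ⟨⟨fun i => w i, fun i => hw i⟩, _,
    (mem_tailSet_iff hn₁ hn₂).2 ⟨fun m => w (ℓ + m), fun m => by
      rw [add_assoc]
      exact hw _, rfl⟩, (codePoint_eq_wordMap (by omega) (by omega) w ℓ).symm⟩

end Limit

/-! ### Adjacency of words -/

section Adjacency

variable {n₁ n₂ : ℕ} {S : ℕ → Set (Fin n₁ × Fin n₂)} {j ℓ : ℕ}

/-- The column of the grid of mesh `n₁⁻ˡ × n₂⁻ˡ` that contains the rectangle of the word. -/
def Word.px (v : Word S j ℓ) : ℕ := gridPos n₁ fun i => (v.1 i).1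

/-- The row of the grid of mesh `n₁⁻ˡ × n₂⁻ˡ` that contains the rectangle of the word. -/
def Word.py (v : Word S j ℓ) : ℕ := gridPos n₂ fun i => (v.1 i).2

theorem Word.ext_pos {v w : Word S j ℓ} (hx : v.px = w.px) (hy : v.py = w.py) : v = w := by
  have h1 := gridPos_injective n₁ hx
  have h2 := gridPos_injective n₂ hy
  exact Subtype.ext (funext fun i => Prod.ext (congrFun h1 i) (congrFun h2 i))

instance : Finite (Word S j ℓ) := inferInstanceAs (Finite (Subtype _))

/-- The rectangle of `w` is the right neighbour of the rectangle of `v`. -/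
def Word.HAdj (v w : Word S j ℓ) : Prop := w.px = v.px + 1 ∧ w.py = v.py

/-- The rectangle of `w` is the upper neighbour of the rectangle of `v`. -/
def Word.VAdj (v w : Word S j ℓ) : Prop := w.px = v.px ∧ w.py = v.py + 1

/-- The set `f_v (J_{j+ℓ})`. -/
noncomputable def Word.cell (v : Word S j ℓ) : Set (ℝ × ℝ) :=
  wordMap (rectMap n₁ n₂) v.1 '' tailSet S (j + ℓ)

theorem Word.mem_cell (hn₁ : 2 ≤ n₁) (hn₂ : 2 ≤ n₂) {v : Word S j ℓ} {z : ℝ × ℝ} :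
    z ∈ v.cell ↔ ∃ t ∈ tailSet S (j + ℓ),
      ((t.1 + v.px) / (n₁ : ℝ) ^ ℓ, (t.2 + v.py) / (n₂ : ℝ) ^ ℓ) = z := by
  simp only [Word.cell, Set.mem_image, wordMap_rectMap (show n₁ ≠ 0 by omega)
    (show n₂ ≠ 0 by omega)]
  rfl

/-- No limit set `J_k` contains a corner of the unit square. -/
def NoCorner (S : ℕ → Set (Fin n₁ × Fin n₂)) : Prop :=
  ∀ k, ∀ t ∈ tailSet S k, (t.1 = 0 ∨ t.1 = 1) → (t.2 = 0 ∨ t.2 = 1) → False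

/-- Distinct rectangles of the same level meet only along a common side, since corners are excluded. -/
theorem Word.adj_of_eq (hn₁ : 2 ≤ n₁) (hn₂ : 2 ≤ n₂) (hS : NoCorner S) {v w : Word S j ℓ}
    (hvw : v ≠ w) {t s : ℝ × ℝ} (ht : t ∈ tailSet S (j + ℓ)) (hs : s ∈ tailSet S (j + ℓ))
    (h : ((t.1 + v.px) / (n₁ : ℝ) ^ ℓ, (t.2 + v.py) / (n₂ : ℝ) ^ ℓ) =
      ((s.1 + w.px) / (n₁ : ℝ) ^ ℓ, (s.2 + w.py) / (n₂ : ℝ) ^ ℓ)) :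
    (v.HAdj w ∧ t.1 = 1 ∧ s.1 = 0) ∨ (w.HAdj v ∧ t.1 = 0 ∧ s.1 = 1) ∨
      (v.VAdj w ∧ t.2 = 1 ∧ s.2 = 0) ∨ (w.VAdj v ∧ t.2 = 0 ∧ s.2 = 1) := by
  have h1 : (n₁ : ℝ) ^ ℓ ≠ 0 := pow_ne_zero _ (by exact_mod_cast (by omega : n₁ ≠ 0))
  have h2 : (n₂ : ℝ) ^ ℓ ≠ 0 := pow_ne_zero _ (by exact_mod_cast (by omega : n₂ ≠ 0))
  have htu := tailSet_subset_unitSquare ht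
  have hsu := tailSet_subset_unitSquare hs
  have hc := hS _ t ht
  rw [Prod.mk.injEq] at h
  rcases eq_or_adjacent_of_div_eq h1 htu.1 hsu.1 h.1 with ⟨hp, hx⟩ | ⟨hp, hx, hx'⟩ | ⟨hp, hx, hx'⟩ <;>
  rcases eq_or_adjacent_of_div_eq h2 htu.2 hsu.2 h.2 with
    ⟨hq, hy⟩ | ⟨hq, hy, hy'⟩ | ⟨hq, hy, hy'⟩
  · exact absurd (Word.ext_pos hp hq) hvw
  · exact Or.inr (Or.inr (Or.inl ⟨⟨hp.symm, hq⟩, hy, hy'⟩))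
  · exact Or.inr (Or.inr (Or.inr ⟨⟨hp, hq⟩, hy, hy'⟩))
  · exact Or.inl ⟨⟨hp, hq.symm⟩, hx, hx'⟩
  · exact (hc (Or.inr hx) (Or.inr hy)).elim
  · exact (hc (Or.inr hx) (Or.inl hy)).elim
  · exact Or.inr (Or.inl ⟨⟨hp, hq⟩, hx, hx'⟩)
  · exact (hc (Or.inl hx) (Or.inr hy)).elim
  · exact (hc (Or.inl hx) (Or.inl hy)).elim

theorem rectNerve_faces {s : Finset (Word S j ℓ)} :
    s ∈ (rectNerve n₁ n₂ S j ℓ).faces ↔ s.Nonempty ∧ (⋂ v ∈ s, Word.cell v).Nonempty :=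
  Iff.rfl

/-- Without corners in the limit sets, at most two of the sets `f_v (J_k)` have a common point: a
common point lies on a unique side of the rectangle of `v`, which determines the neighbour. -/
theorem isGraph_rectNerve (hn₁ : 2 ≤ n₁) (hn₂ : 2 ≤ n₂) (hne : ∀ m, (S m).Nonempty)
    (hS : NoCorner S) (j ℓ : ℕ) : IsGraph (rectNerve n₁ n₂ S j ℓ) where
  vertex v := by
    refine rectNerve_faces.2 ⟨Finset.singleton_nonempty _, ?_⟩
    simpa [Word.cell] using tailSet_nonempty hn₁ hn₂ hne (j + ℓ)
  card_le s hs := by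
    obtain ⟨-, z, hz⟩ := rectNerve_faces.1 hs
    simp only [Set.mem_iInter] at hz
    by_contra! hcard
    obtain ⟨a, ha, b, hb, c, hc, hab, hac, hbc⟩ := Finset.two_lt_card.1 hcard
    obtain ⟨t, ht, htz⟩ := (Word.mem_cell hn₁ hn₂).1 (hz a ha)
    obtain ⟨u, hu, huz⟩ := (Word.mem_cell hn₁ hn₂).1 (hz b hb)
    obtain ⟨w, hw, hwz⟩ := (Word.mem_cell hn₁ hn₂).1 (hz c hc)
    have h1 := Word.adj_of_eq hn₁ hn₂ hS hab ht hu (htz.trans huz.symm)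
    have h2 := Word.adj_of_eq hn₁ hn₂ hS hac ht hw (htz.trans hwz.symm)
    have hcorner := hS _ t ht
    have h01 : ∀ x : ℝ, x = 1 → x = 0 → False := fun x h h' => by linarith
    have hbc' : b.px = c.px → b.py = c.py → False := fun h h' => hbc (Word.ext_pos h h')
    unfold Word.HAdj Word.VAdj at h1 h2
    rcases h1 with ⟨⟨h1, h1'⟩, h3, -⟩ | ⟨⟨h1, h1'⟩, h3, -⟩ | ⟨⟨h1, h1'⟩, h3, -⟩ | ⟨⟨h1, h1'⟩, h3, -⟩ <;>
    rcases h2 with ⟨⟨h2, h2'⟩, h4, -⟩ | ⟨⟨h2, h2'⟩, h4, -⟩ | ⟨⟨h2, h2'⟩, h4, -⟩ | ⟨⟨h2, h2'⟩, h4, -⟩ <;>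
    first
      | exact hbc' (by omega) (by omega)
      | exact h01 _ h3 h4
      | exact h01 _ h4 h3
      | exact hcorner (by simp [h3, h4]) (by simp [h3, h4])

end Adjacency
end NAFractal

namespace NAFractal

/-! ### Open thickenings of the cells -/

section Thickening

variable {Y ι : Type*} [MetricSpace Y]

/-- By compactness, finitely many closed sets without a common point have closed thickenings without a
common point. -/
theorem eventually_iInter_cthickening_eq_empty [CompactSpace Y] {F : ι → Set Y}
    (hF : ∀ i, IsClosed (F i)) (s : Finset ι) (hs : ⋂ i ∈ s, F i = ∅) :
    ∀ᶠ ε in nhdsWithin (0 : ℝ) (Set.Ioi 0), ⋂ i ∈ s, Metric.cthickening ε (F i) = ∅ := by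
  have h1 : ∃ n : ℕ, ⋂ i ∈ s, Metric.cthickening (1 / ((n : ℝ) + 1)) (F i) = ∅ := by
    by_contra! hcon
    have hne := IsCompact.nonempty_iInter_of_sequence_nonempty_isCompact_isClosed
      (fun n : ℕ => ⋂ i ∈ s, Metric.cthickening (1 / ((n : ℝ) + 1)) (F i))
      (fun n => Set.iInter₂_mono fun i _ => Metric.cthickening_mono (by
        push_cast
        gcongr
        linarith) _)
      hcon
      (isClosed_biInter fun i _ => Metric.isClosed_cthickening).isCompact
      (fun n => isClosed_biInter fun i _ => Metric.isClosed_cthickening)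
    obtain ⟨y, hy⟩ := hne
    simp only [Set.mem_iInter] at hy
    have hmem : y ∈ ⋂ i ∈ s, F i := by
      simp only [Set.mem_iInter]
      intro i hi
      rw [← (hF i).closure_eq, Metric.closure_eq_iInter_cthickening]
      simp only [Set.mem_iInter]
      intro δ hδ
      obtain ⟨n, hn⟩ := exists_nat_one_div_lt hδ
      exact Metric.cthickening_mono hn.le _ (hy n i hi)
    rw [hs] at hmem
    exact hmem
  obtain ⟨n, hn⟩ := h1
  have h2 : Set.Ioo (0 : ℝ) (1 / ((n : ℝ) + 1)) ∈ nhdsWithin (0 : ℝ) (Set.Ioi 0) :=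
    Ioo_mem_nhdsGT (by positivity)
  filter_upwards [h2] with ε hε
  rw [← Set.subset_empty_iff, ← hn]
  exact Set.iInter₂_mono fun i _ => Metric.cthickening_mono hε.2.le _

/-- Small open thickenings of finitely many closed sets have the same nerve. -/
theorem eventually_nerve_thickening_eq [CompactSpace Y] [Finite ι] {F : ι → Set Y}
    (hF : ∀ i, IsClosed (F i)) :
    ∀ᶠ ε in nhdsWithin (0 : ℝ) (Set.Ioi 0), nerve (fun i => Metric.thickening ε (F i)) = nerve F := by
  have h : ∀ᶠ ε in nhdsWithin (0 : ℝ) (Set.Ioi 0), ∀ s : Finset ι, ⋂ i ∈ s, F i = ∅ →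
      ⋂ i ∈ s, Metric.cthickening ε (F i) = ∅ := by
    rw [eventually_all]
    intro s
    by_cases hs : ⋂ i ∈ s, F i = ∅
    · filter_upwards [eventually_iInter_cthickening_eq_empty hF s hs] with ε hε _ using hε
    · exact Eventually.of_forall fun ε h => absurd h hs
  filter_upwards [h, self_mem_nhdsWithin] with ε hε hpos
  have h0 : (nerve (fun i => Metric.thickening ε (F i))).faces = (nerve F).faces := by
    ext s
    change (s.Nonempty ∧ _) ↔ (s.Nonempty ∧ _)
    refine and_congr_right fun _ => ⟨fun hs => ?_, fun hs => ?_⟩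
    · by_contra hne
      rw [Set.not_nonempty_iff_eq_empty] at hne
      have h1 := hε s hne
      have h2 := hs.mono (Set.iInter₂_mono fun i _ => Metric.thickening_subset_cthickening ε (F i))
      rw [h1] at h2
      exact Set.not_nonempty_empty h2
    · exact hs.mono (Set.iInter₂_mono fun i _ => Metric.self_subset_thickening hpos _)
  exact SetLike.coe_injective h0

end Thickening

/-! ### The tower of coverings by thickened cells -/

section RectTower

variable {n₁ n₂ : ℕ} {S : ℕ → Set (Fin n₁ × Fin n₂)} {j ℓ : ℕ}

theorem Word.isCompact_cell (hn₁ : 2 ≤ n₁) (hn₂ : 2 ≤ n₂) (v : Word S j ℓ) : IsCompact v.cell := by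
  refine (isCompact_tailSet hn₁ hn₂ S (j + ℓ)).image ?_
  have : wordMap (rectMap n₁ n₂) v.1 = fun x : ℝ × ℝ => _ :=
    funext (wordMap_rectMap (show n₁ ≠ 0 by omega) (show n₂ ≠ 0 by omega) v.1)
  rw [this]
  fun_prop

theorem Word.cell_subset (hn₁ : 2 ≤ n₁) (hn₂ : 2 ≤ n₂) (v : Word S j ℓ) :
    v.cell ⊆ tailSet S j :=
  image_tailSet_subset hn₁ hn₂ v

theorem Word.cell_nonempty (hn₁ : 2 ≤ n₁) (hn₂ : 2 ≤ n₂) (hne : ∀ m, (S m).Nonempty)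
    (v : Word S j ℓ) : v.cell.Nonempty :=
  (tailSet_nonempty hn₁ hn₂ hne _).image _

theorem Word.dist_le (hn₁ : 2 ≤ n₁) (hn₂ : 2 ≤ n₂) {v : Word S j ℓ} {x y : ℝ × ℝ}
    (hx : x ∈ v.cell) (hy : y ∈ v.cell) : dist x y ≤ (1 / 2 : ℝ) ^ ℓ := by
  obtain ⟨t, ht, rfl⟩ := (Word.mem_cell hn₁ hn₂).1 hx
  obtain ⟨s, hs, rfl⟩ := (Word.mem_cell hn₁ hn₂).1 hy
  have ht := tailSet_subset_unitSquare ht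
  have hs := tailSet_subset_unitSquare hs
  have aux : ∀ {n : ℕ} (_ : 2 ≤ n), 1 / (n : ℝ) ^ ℓ ≤ (1 / 2 : ℝ) ^ ℓ := by
    intro n hn
    have h2 : (2 : ℝ) ≤ n := by exact_mod_cast hn
    rw [one_div_pow]
    gcongr
  exact max_le ((abs_sub_le_of_same_pos hn₁ ht.1 hs.1 _ _).trans (aux hn₁))
    ((abs_sub_le_of_same_pos hn₂ ht.2 hs.2 _ _).trans (aux hn₂))

/-- Deleting the last letter of a word. -/
def Word.init (v : Word S j (ℓ + 1)) : Word S j ℓ := ⟨fun i => v.1 i.castSucc, fun i => v.2 i.castSucc⟩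

theorem Word.cell_subset_init (hn₁ : 2 ≤ n₁) (hn₂ : 2 ≤ n₂) (v : Word S j (ℓ + 1)) :
    v.cell ⊆ v.init.cell := by
  unfold Word.cell
  rw [wordMap_succ_last, Set.image_comp]
  refine Set.image_mono ?_
  have := image_tailSet_subset hn₁ hn₂ (j := j + ℓ) (ℓ := 1) (S := S)
    ⟨fun _ => v.1 (Fin.last ℓ), fun m => by
      rw [Fin.fin_one_eq_zero m]
      exact v.2 (Fin.last ℓ)⟩
  exact this

theorem isSimplicial_init (hn₁ : 2 ≤ n₁) (hn₂ : 2 ≤ n₂) (S : ℕ → Set (Fin n₁ × Fin n₂)) (j ℓ : ℕ) :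
    IsSimplicial (rectNerve n₁ n₂ S j (ℓ + 1)) (rectNerve n₁ n₂ S j ℓ) Word.init :=
  isSimplicial_of_subset (Word.cell_subset_init hn₁ hn₂)

/-- The cell of a word as a subset of the space `J`. -/
def Word.cellIn (v : Word S 0 ℓ) : Set (rectLimit n₁ n₂ S) := Subtype.val ⁻¹' v.cell

/-- The coverings of `J` by the open `ε ℓ`-neighbourhoods of the cells of level `ℓ`. -/
noncomputable def rectTower (hn₁ : 2 ≤ n₁) (hn₂ : 2 ≤ n₂) (hne : ∀ m, (S m).Nonempty) (ε : ℕ → ℝ)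
    (hpos : ∀ ℓ, 0 < ε ℓ) (hanti : ∀ ℓ, ε (ℓ + 1) ≤ ε ℓ) (hlim : Tendsto ε atTop (nhds 0)) :
    CofinalTower (rectLimit n₁ n₂ S) where
  V ℓ := Word S 0 ℓ
  finite ℓ := inferInstance
  U ℓ v := Metric.thickening (ε ℓ) v.cellIn
  isOpen ℓ v := Metric.isOpen_thickening
  covers ℓ := by
    refine Set.eq_univ_of_forall fun x => Set.mem_iUnion.2 ?_
    obtain ⟨v, hv⟩ := exists_word_of_mem_tailSet hn₁ hn₂ ℓ x.2
    exact ⟨v, Metric.self_subset_thickening (hpos ℓ) _ hv⟩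
  p ℓ := Word.init
  subset ℓ v := (Metric.thickening_mono (hanti ℓ) _).trans
    (Metric.thickening_subset_of_subset _ fun _ hx => Word.cell_subset_init hn₁ hn₂ v hx)
  cofinal 𝔘 := by
    have hc : CompactSpace (rectLimit n₁ n₂ S) :=
      isCompact_iff_compactSpace.1 (isCompact_tailSet hn₁ hn₂ S 0)
    -- A thickened cell of level `ℓ` lies in the ball of radius `ε ℓ + 2⁻ˡ` around any point of the cell,
    -- which is eventually below a Lebesgue number `δ` of the covering.
    obtain ⟨δ, hδ, h⟩ := lebesgue_number_lemma_of_metric_sUnion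
      (isCompact_univ (X := rectLimit n₁ n₂ S)) 𝔘.isOpen 𝔘.covers.superset
    have h2 : Tendsto (fun ℓ => ε ℓ + (1 / 2 : ℝ) ^ ℓ) atTop (nhds (0 + 0)) :=
      hlim.add (tendsto_pow_atTop_nhds_zero_of_lt_one (by norm_num) (by norm_num))
    rw [add_zero] at h2
    obtain ⟨ℓ, hℓ⟩ := (h2.eventually_lt_const hδ).exists
    refine ⟨ℓ, ?_⟩
    have h3 : ∀ v : Word S 0 ℓ, ∃ t : 𝔘.sets, Metric.thickening (ε ℓ) v.cellIn ⊆ (t : Set _) := by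
      intro v
      obtain ⟨x, hx⟩ := Word.cell_nonempty hn₁ hn₂ hne v
      obtain ⟨t, ht, hxt⟩ := h ⟨x, Word.cell_subset hn₁ hn₂ v hx⟩ trivial
      refine ⟨⟨t, ht⟩, fun y hy => hxt ?_⟩
      obtain ⟨z, hz, hyz⟩ := Metric.mem_thickening_iff.1 hy
      have h4 := Word.dist_le hn₁ hn₂ hz hx
      calc dist y ⟨x, _⟩ ≤ dist y z + dist z ⟨x, _⟩ := dist_triangle _ _ _
        _ < δ := by
          have : dist z ⟨x, Word.cell_subset hn₁ hn₂ v hx⟩ = dist (z : ℝ × ℝ) x := rfl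
          linarith
    exact Classical.axiomOfChoice h3

theorem nerve_cellIn (hn₁ : 2 ≤ n₁) (hn₂ : 2 ≤ n₂) (ℓ : ℕ) :
    nerve (fun v : Word S 0 ℓ => v.cellIn) = rectNerve n₁ n₂ S 0 ℓ := by
  apply SetLike.coe_injective
  ext s
  change (s.Nonempty ∧ _) ↔ (s.Nonempty ∧ _)
  refine and_congr_right fun hs => ?_
  obtain ⟨v, hv⟩ := hs
  constructor
  · rintro ⟨x, hx⟩
    refine ⟨x, ?_⟩
    simp only [Set.mem_iInter] at hx ⊢
    exact hx
  · rintro ⟨x, hx⟩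
    simp only [Set.mem_iInter] at hx
    refine ⟨⟨x, Word.cell_subset hn₁ hn₂ v (hx v hv)⟩, ?_⟩
    simp only [Set.mem_iInter]
    exact hx

/-- There are radii decreasing to zero for which the thickened cells of each level have the same nerve as
the cells. -/
theorem exists_radii (hn₁ : 2 ≤ n₁) (hn₂ : 2 ≤ n₂) (S : ℕ → Set (Fin n₁ × Fin n₂)) :
    ∃ ε : ℕ → ℝ, (∀ ℓ, 0 < ε ℓ) ∧ (∀ ℓ, ε (ℓ + 1) ≤ ε ℓ) ∧ Tendsto ε atTop (nhds 0) ∧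
      ∀ ℓ, nerve (fun v : Word S 0 ℓ => Metric.thickening (ε ℓ) v.cellIn) =
        rectNerve n₁ n₂ S 0 ℓ := by
  have hc : CompactSpace (rectLimit n₁ n₂ S) :=
    isCompact_iff_compactSpace.1 (isCompact_tailSet hn₁ hn₂ S 0)
  have h1 : ∀ ℓ, ∃ e : ℝ, 0 < e ∧ ∀ ε ∈ Set.Ioo 0 e,
      nerve (fun v : Word S 0 ℓ => Metric.thickening ε v.cellIn) = rectNerve n₁ n₂ S 0 ℓ := by
    intro ℓ
    have h := eventually_nerve_thickening_eq (F := fun v : Word S 0 ℓ => v.cellIn) fun v =>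
      (Word.isCompact_cell hn₁ hn₂ v).isClosed.preimage continuous_subtype_val
    rw [nerve_cellIn hn₁ hn₂] at h
    obtain ⟨e, he, hsub⟩ := mem_nhdsGT_iff_exists_Ioo_subset.1 h
    exact ⟨e, he, fun ε hε => hsub hε⟩
  choose e he hsub using h1
  let ε : ℕ → ℝ := fun ℓ => Nat.rec (min (e 0 / 2) 1)
    (fun k x => min x (min (e (k + 1) / 2) (1 / ((k : ℝ) + 1)))) ℓ
  have hpos : ∀ ℓ, 0 < ε ℓ := by
    intro ℓ
    induction ℓ with
    | zero => exact lt_min (half_pos (he 0)) one_pos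
    | succ k ih => exact lt_min ih (lt_min (half_pos (he _)) (by positivity))
  have hle : ∀ ℓ, ε ℓ < e ℓ := by
    intro ℓ
    cases ℓ with
    | zero => exact (min_le_left _ _).trans_lt (half_lt_self (he 0))
    | succ k => exact ((min_le_right _ _).trans (min_le_left _ _)).trans_lt (half_lt_self (he _))
  refine ⟨ε, hpos, fun ℓ => min_le_left _ _, ?_, fun ℓ => hsub ℓ _ ⟨hpos ℓ, hle ℓ⟩⟩
  rw [← tendsto_add_atTop_iff_nat 1]
  exact squeeze_zero (fun k => (hpos (k + 1)).le)
    (fun k => (min_le_right _ _).trans (min_le_right _ _)) tendsto_one_div_add_atTop_nhds_zero_nat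

/-! ### The Čech homology of `J` from the complexes `𝒩_{1,k}` -/

variable (hn₁ : 2 ≤ n₁) (hn₂ : 2 ≤ n₂) (hne : ∀ m, (S m).Nonempty) {q : ℕ}
include hn₁ hn₂ hne

theorem rect_cech_isTorsionFree
    (h : ∀ ℓ, Module.IsTorsionFree ℤ (Homology (rectNerve n₁ n₂ S 0 ℓ) q)) :
    Module.IsTorsionFree ℤ (CechHomology (rectLimit n₁ n₂ S) q) := by
  obtain ⟨ε, hpos, hanti, hlim, hK⟩ := exists_radii hn₁ hn₂ S
  exact (rectTower hn₁ hn₂ hne ε hpos hanti hlim).cech_isTorsionFree hK h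

theorem rect_cech_subsingleton
    (h : ∀ ℓ, Subsingleton (Homology (rectNerve n₁ n₂ S 0 ℓ) q)) :
    Subsingleton (CechHomology (rectLimit n₁ n₂ S) q) := by
  obtain ⟨ε, hpos, hanti, hlim, hK⟩ := exists_radii hn₁ hn₂ S
  exact (rectTower hn₁ hn₂ hne ε hpos hanti hlim).cech_subsingleton hK h

theorem rect_cech_equiv_of_bijective
    (h : ∀ ℓ, Function.Bijective (homologyMap (isSimplicial_init hn₁ hn₂ S 0 ℓ) q)) :
    Nonempty (CechHomology (rectLimit n₁ n₂ S) q ≃ₗ[ℤ] Homology (rectNerve n₁ n₂ S 0 0) q) := by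
  obtain ⟨ε, hpos, hanti, hlim, hK⟩ := exists_radii hn₁ hn₂ S
  exact (rectTower hn₁ hn₂ hne ε hpos hanti hlim).cech_equiv_of_bijective hK fun n _ => h n

theorem rect_aleph0_le_rank_cech
    (h : ∀ ℓ, Function.Surjective (homologyMap (isSimplicial_init hn₁ hn₂ S 0 ℓ) q))
    (hfree : ∀ ℓ, Module.Free ℤ (Homology (rectNerve n₁ n₂ S 0 ℓ) q))
    (hr : ∀ m, ∃ ℓ, m ≤ Module.finrank ℤ (Homology (rectNerve n₁ n₂ S 0 ℓ) q)) :
    Cardinal.aleph0 ≤ Module.rank ℤ (CechHomology (rectLimit n₁ n₂ S) q) := by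
  obtain ⟨ε, hpos, hanti, hlim, hK⟩ := exists_radii hn₁ hn₂ S
  exact (rectTower hn₁ hn₂ hne ε hpos hanti hlim).aleph0_le_rank_cech hK (fun n _ => h n)
    (fun n => inferInstanceAs (Module.Finite ℤ (Homology (rectNerve n₁ n₂ S 0 n) q))) hfree hr

end RectTower
end NAFractal

namespace NAFractal

/-! ### Generic sequences of index sets -/

section Generic

variable {n₁ n₂ r : ℕ}

/-- Every level misses exactly `r` cells, and every set missing `r` cells occurs infinitely often.
Almost every realisation of the random index sets has this property. -/
structure Generic (r : ℕ) (S : ℕ → Set (Fin n₁ × Fin n₂)) : Prop where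
  ncard_compl : ∀ j, (S j)ᶜ.ncard = r
  often : ∀ A : Set (Fin n₁ × Fin n₂), Aᶜ.ncard = r → ∀ j, ∃ m, j ≤ m ∧ S m = A

theorem exists_ncard_compl_eq {C : Set (Fin n₁ × Fin n₂)} (hC : C.ncard ≤ r) (hr : r ≤ n₁ * n₂) :
    ∃ A : Set (Fin n₁ × Fin n₂), Aᶜ.ncard = r ∧ ∀ c ∈ C, c ∉ A := by
  classical
  obtain ⟨B, hCB, -, hB⟩ := Finset.exists_subsuperset_card_eq (s := C.toFinset)
    (t := Finset.univ) (n := r) (Finset.subset_univ _)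
    (by rwa [← Set.ncard_eq_toFinset_card']) (by simpa using hr)
  refine ⟨(B : Set _)ᶜ, ?_, fun c hc h => h (hCB (by simpa using hc))⟩
  rw [compl_compl, Set.ncard_coe_finset, hB]

variable {S : ℕ → Set (Fin n₁ × Fin n₂)}

/-- Any prescribed set of at most `r` cells is missing infinitely often. -/
theorem Generic.exists_missing (hS : Generic r S) (hr : r ≤ n₁ * n₂) {C : Set (Fin n₁ × Fin n₂)}
    (hC : C.ncard ≤ r) (j : ℕ) : ∃ m, j ≤ m ∧ ∀ c ∈ C, c ∉ S m := by
  obtain ⟨A, hA, hCA⟩ := exists_ncard_compl_eq hC hr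
  obtain ⟨m, hm, rfl⟩ := hS.often A hA j
  exact ⟨m, hm, hCA⟩

theorem Generic.ncard (hS : Generic r S) (m : ℕ) : (S m).ncard + r = n₁ * n₂ := by
  have := Set.ncard_add_ncard_compl (S m)
  rw [hS.ncard_compl] at this
  simpa using this

theorem Generic.nonempty (hS : Generic r S) (hr : r < n₁ * n₂) (m : ℕ) : (S m).Nonempty := by
  have := hS.ncard m
  rw [← Set.ncard_pos]
  omega

/-- A sequence of digits all of whose entries lie in `C` is excluded if `C` is missing at some
later level. -/
theorem Generic.notMem_tailSet (hS : Generic r S) (hr : r ≤ n₁ * n₂) {C : Set (Fin n₁ × Fin n₂)}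
    (hC : C.ncard ≤ r) {k : ℕ} {w : ℕ → Fin n₁ × Fin n₂} (hw : ∀ m, w m ∈ S (k + m))
    (hwC : ∀ m, w m ∈ C) : False := by
  obtain ⟨m, hm, h⟩ := hS.exists_missing hr hC k
  have := hw (m - k)
  rw [Nat.add_sub_cancel' hm] at this
  exact h _ (hwC _) this

variable (hn₁ : 2 ≤ n₁) (hn₂ : 2 ≤ n₂)
include hn₁ hn₂

/-- A point whose digits are all equal in both coordinates uses one and the same cell at every level, but
every cell is missing at some later level. -/
theorem Generic.noCorner (hS : Generic r S) (hr : r ≤ n₁ * n₂) (hr₁ : 1 ≤ r) : NoCorner S := by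
  intro k t ht h1 h2
  obtain ⟨w, hw, rfl⟩ := (mem_tailSet_iff hn₁ hn₂).1 ht
  have h3 : ∃ a : ℕ, ∀ m, ((w m).1 : ℕ) = a := by
    rcases h1 with h1 | h1
    · exact ⟨_, (ofDigits_eq_zero_iff _).1 h1⟩
    · exact ⟨_, (ofDigits_eq_one_iff hn₁ _).1 h1⟩
  have h4 : ∃ b : ℕ, ∀ m, ((w m).2 : ℕ) = b := by
    rcases h2 with h2 | h2
    · exact ⟨_, (ofDigits_eq_zero_iff _).1 h2⟩
    · exact ⟨_, (ofDigits_eq_one_iff hn₂ _).1 h2⟩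
  obtain ⟨a, ha⟩ := h3
  obtain ⟨b, hb⟩ := h4
  refine hS.notMem_tailSet hr (C := {w 0}) (by simpa using hr₁) hw fun m => ?_
  exact Prod.ext (Fin.ext ((ha m).trans (ha 0).symm)) (Fin.ext ((hb m).trans (hb 0).symm))

/-- The points on the left side use cells of the left column only, which is missing altogether at some
later level. -/
theorem Generic.fst_ne_zero (hS : Generic r S) (hr : r ≤ n₁ * n₂) (h : n₂ ≤ r) {k : ℕ}
    {t : ℝ × ℝ} (ht : t ∈ tailSet S k) : t.1 ≠ 0 := by
  intro h1
  obtain ⟨w, hw, rfl⟩ := (mem_tailSet_iff hn₁ hn₂).1 ht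
  have h2 := (ofDigits_eq_zero_iff _).1 h1
  let z : Fin n₁ := ⟨0, by omega⟩
  refine hS.notMem_tailSet hr (C := Set.range fun y : Fin n₂ => (z, y)) ?_ hw fun m =>
    ⟨(w m).2, Prod.ext (Fin.ext (h2 m).symm) rfl⟩
  rw [← Set.image_univ]
  refine (Set.ncard_image_le Set.finite_univ).trans ?_
  simpa using h

/-- The points on the lower side use cells of the lowest row only, which is missing altogether at some
later level. -/
theorem Generic.snd_ne_zero (hS : Generic r S) (hr : r ≤ n₁ * n₂) (h : n₁ ≤ r) {k : ℕ}
    {t : ℝ × ℝ} (ht : t ∈ tailSet S k) : t.2 ≠ 0 := by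
  intro h1
  obtain ⟨w, hw, rfl⟩ := (mem_tailSet_iff hn₁ hn₂).1 ht
  have h2 := (ofDigits_eq_zero_iff _).1 h1
  let z : Fin n₂ := ⟨0, by omega⟩
  refine hS.notMem_tailSet hr (C := Set.range fun x : Fin n₁ => (x, z)) ?_ hw fun m =>
    ⟨(w m).1, Prod.ext rfl (Fin.ext (h2 m).symm)⟩
  rw [← Set.image_univ]
  refine (Set.ncard_image_le Set.finite_univ).trans ?_
  simpa using h

end Generic

/-! ### Full rows and columns -/

section Rows

variable {n₁ n₂ r : ℕ}

/-- The set contains a full row of cells. -/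
def HasRow (A : Set (Fin n₁ × Fin n₂)) : Prop := ∃ y, ∀ x, (x, y) ∈ A

/-- The set contains a full column of cells. -/
def HasCol (A : Set (Fin n₁ × Fin n₂)) : Prop := ∃ x, ∀ y, (x, y) ∈ A

theorem hasRow_of_lt {A : Set (Fin n₁ × Fin n₂)} (h : Aᶜ.ncard < n₂) : HasRow A := by
  by_contra hcon
  simp only [HasRow, not_exists, not_forall] at hcon
  choose x hx using hcon
  have h1 : (Set.range fun y => (x y, y)) ⊆ Aᶜ := by
    rintro _ ⟨y, rfl⟩
    exact hx y
  have h2 := Set.ncard_le_ncard h1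
  rw [← Set.image_univ, Set.ncard_image_of_injective _ fun a b hab => congrArg Prod.snd hab] at h2
  simp at h2
  omega

theorem hasCol_of_lt {A : Set (Fin n₁ × Fin n₂)} (h : Aᶜ.ncard < n₁) : HasCol A := by
  by_contra hcon
  simp only [HasCol, not_exists, not_forall] at hcon
  choose y hy using hcon
  have h1 : (Set.range fun x => (x, y x)) ⊆ Aᶜ := by
    rintro _ ⟨x, rfl⟩
    exact hy x
  have h2 := Set.ncard_le_ncard h1
  rw [← Set.image_univ, Set.ncard_image_of_injective _ fun a b hab => congrArg Prod.fst hab] at h2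
  simp at h2
  omega

variable {S : ℕ → Set (Fin n₁ × Fin n₂)} (hn₁ : 2 ≤ n₁) (hn₂ : 2 ≤ n₂)
include hn₁ hn₂

theorem exists_horizontal_segment (hS : ∀ m, HasRow (S m)) (k : ℕ) :
    ∃ y, ∀ x ∈ Set.Icc (0 : ℝ) 1, (x, y) ∈ tailSet S k := by
  choose b hb using hS
  refine ⟨Real.ofDigits fun m => b (k + m), fun x hx => ?_⟩
  obtain ⟨a, -, rfl⟩ := Real.ofDigits_SurjOn (show 1 < n₁ by omega) hx
  exact (mem_tailSet_iff hn₁ hn₂).2 ⟨fun m => (a m, b (k + m)), fun m => hb _ _, rfl⟩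

theorem exists_vertical_segment (hS : ∀ m, HasCol (S m)) (k : ℕ) :
    ∃ x, ∀ y ∈ Set.Icc (0 : ℝ) 1, (x, y) ∈ tailSet S k := by
  choose a ha using hS
  refine ⟨Real.ofDigits fun m => a (k + m), fun y hy => ?_⟩
  obtain ⟨b, -, rfl⟩ := Real.ofDigits_SurjOn (show 1 < n₂ by omega) hy
  exact (mem_tailSet_iff hn₁ hn₂).2 ⟨fun m => (a (k + m), b m), fun m => ha _ _, rfl⟩

variable {j ℓ : ℕ}

omit hn₁ hn₂ in
theorem pair_mem_faces (v w : Word S j ℓ) (h : (v.cell ∩ w.cell).Nonempty) :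
    ∃ s ∈ (rectNerve n₁ n₂ S j ℓ).faces, (s : Set (Word S j ℓ)) = {v, w} := by
  classical
  refine ⟨{v, w}, rectNerve_faces.2 ⟨Finset.insert_nonempty _ _, ?_⟩, by simp⟩
  obtain ⟨z, hz⟩ := h
  exact ⟨z, by simpa using hz⟩

/-- Neighbouring rectangles share a point of `J`, as the right end of a full horizontal segment in one of
them is the left end of the corresponding segment in the other. -/
theorem Word.HAdj.mem_faces (hS : ∀ m, HasRow (S m)) {v w : Word S j ℓ} (h : v.HAdj w) :
    ∃ s ∈ (rectNerve n₁ n₂ S j ℓ).faces, (s : Set (Word S j ℓ)) = {v, w} := by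
  obtain ⟨y, hy⟩ := exists_horizontal_segment hn₁ hn₂ hS (j + ℓ)
  refine pair_mem_faces v w ⟨_, (Word.mem_cell hn₁ hn₂).2 ⟨_, hy 1 (by simp), rfl⟩,
    (Word.mem_cell hn₁ hn₂).2 ⟨_, hy 0 (by simp), ?_⟩⟩
  simp only [h.1, h.2]
  push_cast
  rw [zero_add, add_comm (1 : ℝ)]

theorem Word.VAdj.mem_faces (hS : ∀ m, HasCol (S m)) {v w : Word S j ℓ} (h : v.VAdj w) :
    ∃ s ∈ (rectNerve n₁ n₂ S j ℓ).faces, (s : Set (Word S j ℓ)) = {v, w} := by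
  obtain ⟨x, hx⟩ := exists_vertical_segment hn₁ hn₂ hS (j + ℓ)
  refine pair_mem_faces v w ⟨_, (Word.mem_cell hn₁ hn₂).2 ⟨_, hx 1 (by simp), rfl⟩,
    (Word.mem_cell hn₁ hn₂).2 ⟨_, hx 0 (by simp), ?_⟩⟩
  simp only [h.1, h.2]
  push_cast
  rw [zero_add, add_comm (1 : ℝ)]

theorem adj_of_mem_faces (hS : NoCorner S) {v w : Word S j ℓ} (hvw : v ≠ w)
    (h : ∃ s ∈ (rectNerve n₁ n₂ S j ℓ).faces, (s : Set (Word S j ℓ)) = {v, w}) :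
    v.HAdj w ∨ w.HAdj v ∨ v.VAdj w ∨ w.VAdj v := by
  obtain ⟨s, hs, hsv⟩ := h
  obtain ⟨-, z, hz⟩ := rectNerve_faces.1 hs
  simp only [Set.mem_iInter, ← Finset.mem_coe, hsv] at hz
  obtain ⟨t, ht, htz⟩ := (Word.mem_cell hn₁ hn₂).1 (hz v (by simp))
  obtain ⟨u, hu, huz⟩ := (Word.mem_cell hn₁ hn₂).1 (hz w (by simp))
  rcases Word.adj_of_eq hn₁ hn₂ hS hvw ht hu (htz.trans huz.symm) with h | h | h | h
  exacts [Or.inl h.1, Or.inr (Or.inl h.1), Or.inr (Or.inr (Or.inl h.1)),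
    Or.inr (Or.inr (Or.inr h.1))]

/-- If every level contains a full row and a full column, the edges of `𝒩` are all pairs of
neighbouring rectangles, oriented to the right and upwards. -/
theorem isOrientation_rectNerve (hS : NoCorner S) (hrow : ∀ m, HasRow (S m))
    (hcol : ∀ m, HasCol (S m)) (j ℓ : ℕ) :
    IsOrientation (rectNerve n₁ n₂ S j ℓ) {e | e.1.HAdj e.2 ∨ e.1.VAdj e.2} where
  ne a b h hab := by
    subst hab
    rcases h with ⟨h, -⟩ | ⟨-, h⟩ <;> simp at h
  asymm a b h h' := by
    simp only [Set.mem_ofPred_eq, Word.HAdj, Word.VAdj] at h h'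
    omega
  edge_iff a b hab := by
    constructor
    · intro h
      rcases adj_of_mem_faces hn₁ hn₂ hS hab h with h | h | h | h
      exacts [Or.inl (Or.inl h), Or.inr (Or.inl h), Or.inl (Or.inr h), Or.inr (Or.inr h)]
    · rintro ((h | h) | (h | h))
      · exact h.mem_faces hn₁ hn₂ hrow
      · exact h.mem_faces hn₁ hn₂ hcol
      · rw [Set.pair_comm]
        exact h.mem_faces hn₁ hn₂ hrow
      · rw [Set.pair_comm]
        exact h.mem_faces hn₁ hn₂ hcol

end Rows
end NAFractal

namespace NAFractal

/-! ### Appending a letter to a word -/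

section Letters

variable {n₁ n₂ : ℕ} {S : ℕ → Set (Fin n₁ × Fin n₂)} {j ℓ : ℕ}

/-- The last letter of a word. -/
def Word.last (v : Word S j (ℓ + 1)) : S (j + ℓ) := ⟨v.1 (Fin.last ℓ), v.2 (Fin.last ℓ)⟩

/-- A word of length `ℓ + 1` is a word of length `ℓ` together with a last letter. -/
def Word.snocEquiv (S : ℕ → Set (Fin n₁ × Fin n₂)) (j ℓ : ℕ) :
    Word S j (ℓ + 1) ≃ Word S j ℓ × S (j + ℓ) where
  toFun v := (v.init, v.last)
  invFun x := ⟨Fin.snoc (α := fun _ => Fin n₁ × Fin n₂) x.1.1 x.2.1, fun m => by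
    refine Fin.lastCases ?_ (fun i => ?_) m
    · rw [Fin.snoc_last]
      exact x.2.2
    · rw [Fin.snoc_castSucc]
      exact x.1.2 i⟩
  left_inv v := Subtype.ext (Fin.snoc_init_self (α := fun _ => Fin n₁ × Fin n₂) v.1)
  right_inv x := by
    refine Prod.ext (Subtype.ext ?_) (Subtype.ext ?_)
    · exact Fin.init_snoc (α := fun _ => Fin n₁ × Fin n₂) _ _
    · exact Fin.snoc_last (α := fun _ => Fin n₁ × Fin n₂) _ _

/-- Appending a letter to a word. -/
def Word.snoc (v : Word S j ℓ) (a : S (j + ℓ)) : Word S j (ℓ + 1) :=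
  (Word.snocEquiv S j ℓ).symm (v, a)

theorem Word.init_snoc (v : Word S j ℓ) (a : S (j + ℓ)) : (v.snoc a).init = v :=
  congrArg Prod.fst ((Word.snocEquiv S j ℓ).apply_symm_apply (v, a))

theorem Word.last_snoc (v : Word S j ℓ) (a : S (j + ℓ)) : (v.snoc a).last = a :=
  congrArg Prod.snd ((Word.snocEquiv S j ℓ).apply_symm_apply (v, a))

theorem Word.snoc_init_last (v : Word S j (ℓ + 1)) : v.init.snoc v.last = v :=
  (Word.snocEquiv S j ℓ).symm_apply_apply v

theorem Word.px_succ (v : Word S j (ℓ + 1)) : v.px = n₁ * v.init.px + v.last.1.1 := rfl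

theorem Word.py_succ (v : Word S j (ℓ + 1)) : v.py = n₂ * v.init.py + v.last.1.2 := rfl

theorem card_word {N : ℕ} (hS : ∀ m, (S m).ncard = N) (j ℓ : ℕ) :
    Nat.card (Word S j ℓ) = N ^ ℓ := by
  induction ℓ with
  | zero =>
    rw [pow_zero, Nat.card_eq_one_iff_unique]
    exact ⟨⟨fun v w => Subtype.ext (Subsingleton.elim _ _)⟩, ⟨⟨Fin.elim0, fun m => m.elim0⟩⟩⟩
  | succ ℓ ih =>
    rw [Nat.card_congr (Word.snocEquiv S j ℓ), Nat.card_prod, ih, pow_succ, Nat.card_coe_set_eq, hS]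

/-- `b` is the right neighbour of `a`. -/
def HStep (a b : Fin n₁ × Fin n₂) : Prop := (b.1 : ℕ) = a.1 + 1 ∧ b.2 = a.2

/-- `b` is the upper neighbour of `a`. -/
def VStep (a b : Fin n₁ × Fin n₂) : Prop := b.1 = a.1 ∧ (b.2 : ℕ) = a.2 + 1

/-- `a` and `b` are the right and the left end of a row. -/
def HWrap (a b : Fin n₁ × Fin n₂) : Prop := (a.1 : ℕ) + 1 = n₁ ∧ (b.1 : ℕ) = 0 ∧ b.2 = a.2

/-- `a` and `b` are the upper and the lower end of a column. -/
def VWrap (a b : Fin n₁ × Fin n₂) : Prop := b.1 = a.1 ∧ (a.2 : ℕ) + 1 = n₂ ∧ (b.2 : ℕ) = 0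

theorem digit_unique {n p q x y : ℕ} (hx : x < n) (hy : y < n) (h : n * p + x = n * q + y) :
    p = q ∧ x = y := by
  have h1 : x = y := by
    have := congrArg (· % n) h
    simpa [Nat.mul_add_mod, Nat.mod_eq_of_lt hx, Nat.mod_eq_of_lt hy] using this
  subst h1
  exact ⟨Nat.eq_of_mul_eq_mul_left (by omega) (Nat.add_right_cancel h), rfl⟩

theorem digit_succ {n p q x y : ℕ} (hx : x < n) (hy : y < n) :
    n * q + y = n * p + x + 1 ↔ (p = q ∧ y = x + 1) ∨ (q = p + 1 ∧ x + 1 = n ∧ y = 0) := by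
  constructor
  · intro h
    by_cases hx' : x + 1 < n
    · obtain ⟨h1, h2⟩ := digit_unique hy hx' (by omega : n * q + y = n * p + (x + 1))
      exact Or.inl ⟨h1.symm, h2⟩
    · obtain ⟨h1, h2⟩ := digit_unique (q := p + 1) (y := 0) hy (by omega)
        (by rw [mul_add]; omega : n * q + y = n * (p + 1) + 0)
      exact Or.inr ⟨h1, by omega, h2⟩
  · rintro (⟨rfl, rfl⟩ | ⟨rfl, h, rfl⟩)
    · omega
    · rw [mul_add]
      omega

theorem Word.hAdj_succ_iff (v w : Word S j (ℓ + 1)) : v.HAdj w ↔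
    (v.init = w.init ∧ HStep v.last.1 w.last.1) ∨ (v.init.HAdj w.init ∧ HWrap v.last.1 w.last.1) := by
  have hx := digit_succ (p := v.init.px) (q := w.init.px) v.last.1.1.2 w.last.1.1.2
  unfold Word.HAdj HStep HWrap
  rw [Word.px_succ v, Word.px_succ w, Word.py_succ v, Word.py_succ w, hx]
  constructor
  · rintro ⟨h, h'⟩
    obtain ⟨h1, h2⟩ := digit_unique w.last.1.2.2 v.last.1.2.2 h'
    rcases h with ⟨h3, h4⟩ | ⟨h3, h4, h5⟩
    · exact Or.inl ⟨Word.ext_pos h3 h1.symm, h4, Fin.ext h2⟩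
    · exact Or.inr ⟨⟨h3, h1⟩, h4, h5, Fin.ext h2⟩
  · rintro (⟨h1, h2, h3⟩ | ⟨⟨h1, h2⟩, h3, h4, h5⟩)
    · exact ⟨Or.inl ⟨by rw [h1], h2⟩, by rw [h1, h3]⟩
    · exact ⟨Or.inr ⟨h1, h3, h4⟩, by rw [h2, h5]⟩

theorem Word.vAdj_succ_iff (v w : Word S j (ℓ + 1)) : v.VAdj w ↔
    (v.init = w.init ∧ VStep v.last.1 w.last.1) ∨ (v.init.VAdj w.init ∧ VWrap v.last.1 w.last.1) := by
  have hy := digit_succ (p := v.init.py) (q := w.init.py) v.last.1.2.2 w.last.1.2.2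
  unfold Word.VAdj VStep VWrap
  rw [Word.px_succ v, Word.px_succ w, Word.py_succ v, Word.py_succ w, hy]
  constructor
  · rintro ⟨h', h⟩
    obtain ⟨h1, h2⟩ := digit_unique w.last.1.1.2 v.last.1.1.2 h'
    rcases h with ⟨h3, h4⟩ | ⟨h3, h4, h5⟩
    · exact Or.inl ⟨Word.ext_pos h1.symm h3, Fin.ext h2, h4⟩
    · exact Or.inr ⟨⟨h1, h3⟩, Fin.ext h2, h4, h5⟩
  · rintro (⟨h1, h2, h3⟩ | ⟨⟨h1, h2⟩, h3, h4, h5⟩)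
    · exact ⟨by rw [h1, h2], Or.inl ⟨by rw [h1], h3⟩⟩
    · exact ⟨by rw [h1, h3], Or.inr ⟨h2, h4, h5⟩⟩

end Letters

/-! ### Counting edges -/

section Counting

/-- The number of pairs of elements of a type that are related. -/
noncomputable def relCount {A : Type*} (R : A → A → Prop) : ℕ := Nat.card {x : A × A // R x.1 x.2}

/-- The edges of level `ℓ + 1` are counted by pairs of a block of level `ℓ` and an edge within it, and by
pairs of an edge between two blocks and an edge that joins opposite sides of the blocks. -/
theorem relCount_of_prod {W A W' : Type*} [Finite W] [Finite A] (e : W' ≃ W × A)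
    {R : W → W → Prop} (hR : ∀ v, ¬ R v v) {s g : A → A → Prop} {R' : W' → W' → Prop}
    (h : ∀ v w, R' v w ↔ ((e v).1 = (e w).1 ∧ s (e v).2 (e w).2) ∨
      (R (e v).1 (e w).1 ∧ g (e v).2 (e w).2)) :
    relCount R' = Nat.card W * relCount s + relCount R * relCount g := by
  classical
  let p : (W × A) × (W × A) → Prop := fun x => x.1.1 = x.2.1 ∧ s x.1.2 x.2.2
  let q : (W × A) × (W × A) → Prop := fun x => R x.1.1 x.2.1 ∧ g x.1.2 x.2.2
  have hpq : Disjoint p q := by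
    rw [disjoint_iff_inf_le]
    rintro ⟨⟨v, a⟩, ⟨w, b⟩⟩ ⟨⟨h1, -⟩, ⟨h2, -⟩⟩
    simp only at h1 h2
    subst h1
    exact hR _ h2
  let e₁ : {x : W' × W' // R' x.1 x.2} ≃ {x // p x ∨ q x} :=
    (Equiv.prodCongr e e).subtypeEquiv fun x => h x.1 x.2
  let e₂ : {x // p x} ≃ W × {x : A × A // s x.1 x.2} :=
    { toFun := fun x => (x.1.1.1, ⟨(x.1.1.2, x.1.2.2), x.2.2⟩)
      invFun := fun y => ⟨((y.1, y.2.1.1), (y.1, y.2.1.2)), rfl, y.2.2⟩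
      left_inv := by
        rintro ⟨⟨⟨v, a⟩, ⟨w, b⟩⟩, h1, h2⟩
        simp only at h1
        subst h1
        rfl
      right_inv := fun y => rfl }
  let e₃ : {x // q x} ≃ {x : W × W // R x.1 x.2} × {x : A × A // g x.1 x.2} :=
    { toFun := fun x => (⟨(x.1.1.1, x.1.2.1), x.2.1⟩, ⟨(x.1.1.2, x.1.2.2), x.2.2⟩)
      invFun := fun y => ⟨((y.1.1.1, y.2.1.1), (y.1.1.2, y.2.1.2)), y.1.2, y.2.2⟩
      left_inv := fun x => rfl
      right_inv := fun y => rfl }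
  unfold relCount
  rw [Nat.card_congr (e₁.trans (subtypeOrEquiv p q hpq)), Nat.card_sum, Nat.card_congr e₂,
    Nat.card_congr e₃, Nat.card_prod, Nat.card_prod]

theorem relCount_or {A : Type*} [Finite A] {R T : A → A → Prop}
    (h : ∀ a b, R a b → T a b → False) :
    Nat.card {x : A × A // R x.1 x.2 ∨ T x.1 x.2} = relCount R + relCount T := by
  classical
  have hpq : Disjoint (fun x : A × A => R x.1 x.2) (fun x => T x.1 x.2) := by
    rw [disjoint_iff_inf_le]
    rintro x ⟨h1, h2⟩
    exact h _ _ h1 h2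
  rw [Nat.card_congr (subtypeOrEquiv _ _ hpq), Nat.card_sum]
  rfl

theorem relCount_le_card {A : Type*} [Finite A] {R : A → A → Prop}
    (h : ∀ a b b', R a b → R a b' → b = b') : relCount R ≤ Nat.card A :=
  Nat.card_le_card_of_injective (fun x => x.1.1) (by
    rintro ⟨⟨a, b⟩, hx⟩ ⟨⟨a', b'⟩, hx'⟩ (rfl : a = a')
    have := h _ _ _ hx hx'
    simp only at this
    subst this
    rfl)

theorem one_le_relCount {A : Type*} [Finite A] {R : A → A → Prop} {a b : A} (h : R a b) :
    1 ≤ relCount R :=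
  Nat.card_pos_iff.2 ⟨⟨⟨(a, b), h⟩⟩, inferInstance⟩

variable {n₁ n₂ : ℕ} {S : ℕ → Set (Fin n₁ × Fin n₂)}

/-- The number of pairs of horizontally neighbouring rectangles of level `ℓ`. -/
noncomputable def hCount (S : ℕ → Set (Fin n₁ × Fin n₂)) (ℓ : ℕ) : ℕ :=
  relCount fun v w : Word S 0 ℓ => v.HAdj w

/-- The number of pairs of vertically neighbouring rectangles of level `ℓ`. -/
noncomputable def vCount (S : ℕ → Set (Fin n₁ × Fin n₂)) (ℓ : ℕ) : ℕ :=
  relCount fun v w : Word S 0 ℓ => v.VAdj w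

theorem card_orientation (S : ℕ → Set (Fin n₁ × Fin n₂)) (ℓ : ℕ) :
    Nat.card {e : Word S 0 ℓ × Word S 0 ℓ | e.1.HAdj e.2 ∨ e.1.VAdj e.2} =
      hCount S ℓ + vCount S ℓ :=
  relCount_or fun a b h h' => by
    simp only [Word.HAdj, Word.VAdj] at h h'
    omega

theorem hCount_succ (S : ℕ → Set (Fin n₁ × Fin n₂)) (ℓ : ℕ) :
    hCount S (ℓ + 1) = Nat.card (Word S 0 ℓ) * relCount (fun a b : S (0 + ℓ) => HStep a.1 b.1) +
      hCount S ℓ * relCount (fun a b : S (0 + ℓ) => HWrap a.1 b.1) :=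
  relCount_of_prod (Word.snocEquiv S 0 ℓ) (fun v h => by simp [Word.HAdj] at h) Word.hAdj_succ_iff

theorem vCount_succ (S : ℕ → Set (Fin n₁ × Fin n₂)) (ℓ : ℕ) :
    vCount S (ℓ + 1) = Nat.card (Word S 0 ℓ) * relCount (fun a b : S (0 + ℓ) => VStep a.1 b.1) +
      vCount S ℓ * relCount (fun a b : S (0 + ℓ) => VWrap a.1 b.1) :=
  relCount_of_prod (Word.snocEquiv S 0 ℓ) (fun v h => by simp [Word.VAdj] at h) Word.vAdj_succ_iff

theorem hCount_le (S : ℕ → Set (Fin n₁ × Fin n₂)) (ℓ : ℕ) : hCount S ℓ ≤ Nat.card (Word S 0 ℓ) :=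
  relCount_le_card fun _ _ _ h h' => Word.ext_pos (h.1.trans h'.1.symm) (h.2.trans h'.2.symm)

theorem vCount_le (S : ℕ → Set (Fin n₁ × Fin n₂)) (ℓ : ℕ) : vCount S ℓ ≤ Nat.card (Word S 0 ℓ) :=
  relCount_le_card fun _ _ _ h h' => Word.ext_pos (h.1.trans h'.1.symm) (h.2.trans h'.2.symm)

/-- Every cell outside `Aᶜ ∪ B` is the first member of a related pair. -/
theorem card_le_relCount_add {A B : Set (Fin n₁ × Fin n₂)}
    {R : Fin n₁ × Fin n₂ → Fin n₁ × Fin n₂ → Prop}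
    (h : ∀ a ∈ A, a ∉ B → ∃ b ∈ A, R a b) :
    n₁ * n₂ ≤ relCount (fun a b : A => R a.1 b.1) + (Aᶜ.ncard + B.ncard) := by
  classical
  let G : Set (Fin n₁ × Fin n₂) := {a | a ∈ A ∧ ∃ b ∈ A, R a b}
  have h1 : Gᶜ ⊆ Aᶜ ∪ B := by
    intro a ha
    by_contra hcon
    simp only [Set.mem_union, Set.mem_compl_iff, not_or, not_not] at hcon
    exact ha ⟨hcon.1, h a hcon.1 hcon.2⟩
  have h2 := (Set.ncard_le_ncard h1).trans (Set.ncard_union_le _ _)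
  have h3 := Set.ncard_add_ncard_compl G
  have h4 : G.ncard ≤ relCount (fun a b : A => R a.1 b.1) := by
    rw [← Nat.card_coe_set_eq]
    refine Nat.card_le_card_of_surjective (α := {x : A × A // R x.1.1 x.2.1})
      (fun x => ⟨x.1.1.1, x.1.1.2, x.1.2.1, x.1.2.2, x.2⟩) ?_
    rintro ⟨a, ha, b, hb, hab⟩
    exact ⟨⟨(⟨a, ha⟩, ⟨b, hb⟩), hab⟩, rfl⟩
  simp only [Nat.card_eq_fintype_card, Fintype.card_prod, Fintype.card_fin] at h3
  omega

/-- Removing `r < n₁` consecutive cells of the lowest row, starting in the corner, destroys only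
two edges per cell. -/
theorem exists_many_steps {r : ℕ} (hr : r < n₁) (hn₂ : 1 ≤ n₂) :
    ∃ A : Set (Fin n₁ × Fin n₂), Aᶜ.ncard = r ∧
      n₁ * n₂ ≤ relCount (fun a b : A => HStep a.1 b.1) + (r + n₂) ∧
      n₁ * n₂ ≤ relCount (fun a b : A => VStep a.1 b.1) + (r + n₁) := by
  let C : Set (Fin n₁ × Fin n₂) := {a | (a.2 : ℕ) = 0 ∧ (a.1 : ℕ) < r}
  have hC : C.ncard = r := by
    have h1 : C = (fun i : Fin r => ((⟨i, by omega⟩, ⟨0, by omega⟩) : Fin n₁ × Fin n₂)) ''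
        Set.univ := by
      ext ⟨a, b⟩
      simp only [C, Set.mem_ofPred_eq, Set.image_univ, Set.mem_range, Prod.mk.injEq, Fin.ext_iff]
      constructor
      · rintro ⟨h1, h2⟩
        exact ⟨⟨a, h2⟩, rfl, h1.symm⟩
      · rintro ⟨i, h1, h2⟩
        exact ⟨h2.symm, h1 ▸ i.2⟩
    rw [h1, Set.ncard_image_of_injective]
    · simp
    · intro i i' h
      simpa [Fin.ext_iff] using h
  have hcol : {a : Fin n₁ × Fin n₂ | (a.1 : ℕ) + 1 = n₁}.ncard ≤ n₂ := by
    have : {a : Fin n₁ × Fin n₂ | (a.1 : ℕ) + 1 = n₁} ⊆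
        (fun y => (⟨n₁ - 1, by omega⟩, y)) '' (Set.univ : Set (Fin n₂)) := by
      rintro ⟨a, b⟩ h
      simp only [Set.mem_ofPred_eq] at h
      exact ⟨b, trivial, Prod.ext (Fin.ext (by simp only; omega)) rfl⟩
    refine (Set.ncard_le_ncard this).trans ((Set.ncard_image_le Set.finite_univ).trans ?_)
    simp
  have hrow : {a : Fin n₁ × Fin n₂ | (a.2 : ℕ) + 1 = n₂}.ncard ≤ n₁ := by
    have : {a : Fin n₁ × Fin n₂ | (a.2 : ℕ) + 1 = n₂} ⊆
        (fun x => (x, ⟨n₂ - 1, by omega⟩)) '' (Set.univ : Set (Fin n₁)) := by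
      rintro ⟨a, b⟩ h
      simp only [Set.mem_ofPred_eq] at h
      exact ⟨a, trivial, Prod.ext rfl (Fin.ext (by simp only; omega))⟩
    refine (Set.ncard_le_ncard this).trans ((Set.ncard_image_le Set.finite_univ).trans ?_)
    simp
  refine ⟨Cᶜ, by rw [compl_compl, hC], ?_, ?_⟩
  · have := card_le_relCount_add (A := Cᶜ) (B := {a | (a.1 : ℕ) + 1 = n₁}) (R := HStep) ?_
    · rw [compl_compl, hC] at this
      omega
    · rintro ⟨a, b⟩ ha hb
      simp only [C, Set.mem_compl_iff, Set.mem_ofPred_eq, not_and, not_lt] at ha hb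
      refine ⟨(⟨a + 1, by omega⟩, b), ?_, rfl, rfl⟩
      simp only [C, Set.mem_compl_iff, Set.mem_ofPred_eq, not_and, not_lt]
      intro h
      exact (ha h).trans (Nat.le_succ _)
  · have := card_le_relCount_add (A := Cᶜ) (B := {a | (a.2 : ℕ) + 1 = n₂}) (R := VStep) ?_
    · rw [compl_compl, hC] at this
      omega
    · rintro ⟨a, b⟩ ha hb
      simp only [Set.mem_ofPred_eq] at hb
      refine ⟨(a, ⟨b + 1, by omega⟩), ?_, rfl, rfl⟩
      simp [C]

theorem HasRow.one_le_relCount (hn₁ : 2 ≤ n₁) {A : Set (Fin n₁ × Fin n₂)} (h : HasRow A) :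
    1 ≤ relCount (fun a b : A => HStep a.1 b.1) ∧ 1 ≤ relCount (fun a b : A => HWrap a.1 b.1) := by
  obtain ⟨y, hy⟩ := h
  constructor
  · exact NAFractal.one_le_relCount (a := ⟨(⟨0, by omega⟩, y), hy _⟩)
      (b := ⟨(⟨1, by omega⟩, y), hy _⟩) ⟨rfl, rfl⟩
  · exact NAFractal.one_le_relCount (a := ⟨(⟨n₁ - 1, by omega⟩, y), hy _⟩)
      (b := ⟨(⟨0, by omega⟩, y), hy _⟩) ⟨by simp only; omega, rfl, rfl⟩

theorem HasCol.one_le_relCount (hn₂ : 2 ≤ n₂) {A : Set (Fin n₁ × Fin n₂)} (h : HasCol A) :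
    1 ≤ relCount (fun a b : A => VStep a.1 b.1) ∧ 1 ≤ relCount (fun a b : A => VWrap a.1 b.1) := by
  obtain ⟨x, hx⟩ := h
  constructor
  · exact NAFractal.one_le_relCount (a := ⟨(x, ⟨0, by omega⟩), hx _⟩)
      (b := ⟨(x, ⟨1, by omega⟩), hx _⟩) ⟨rfl, rfl⟩
  · exact NAFractal.one_le_relCount (a := ⟨(x, ⟨n₂ - 1, by omega⟩), hx _⟩)
      (b := ⟨(x, ⟨0, by omega⟩), hx _⟩) ⟨rfl, by simp only; omega, rfl⟩

/-- Infinitely often, the edges of level `ℓ + 2` outnumber the vertices by at least `N ^ ℓ`, where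
`N = n₁ n₂ - r`. If the last index set is the one of `exists_many_steps`, a block of level `ℓ + 1`
contains at least `2 n₁ n₂ - n₁ - n₂ - 2 r ≥ N` edges, so that the edges inside the blocks already
match the vertices. There is at least one edge across each common side of two blocks, and at least
`N ^ ℓ` pairs of blocks have a common side. -/
theorem Generic.exists_many_edges (hn₁ : 2 ≤ n₁) (hn₂ : 2 ≤ n₂) {r : ℕ}
    {S : ℕ → Set (Fin n₁ × Fin n₂)} (hS : Generic r S) (hr₁ : r < n₁) (hr₂ : r < n₂) (hr : n₁ + n₂ + r ≤ n₁ * n₂) (m : ℕ) :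
    ∃ ℓ, m ≤ ℓ ∧ Nat.card (Word S 0 (ℓ + 2)) + (n₁ * n₂ - r) ^ ℓ ≤
      hCount S (ℓ + 2) + vCount S (ℓ + 2) := by
  obtain ⟨A, hA, hA1, hA2⟩ := exists_many_steps (n₂ := n₂) hr₁ (by omega)
  obtain ⟨k, hk, hkA⟩ := hS.often A hA (m + 1)
  obtain ⟨ℓ, rfl⟩ : ∃ ℓ, k = ℓ + 1 := ⟨k - 1, by omega⟩
  refine ⟨ℓ, by omega, ?_⟩
  have hN : ∀ i, (S i).ncard = n₁ * n₂ - r := fun i => by have := hS.ncard i; omega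
  have hrow : ∀ i, HasRow (S i) := fun i => hasRow_of_lt (by rw [hS.ncard_compl]; exact hr₂)
  have hcol : ∀ i, HasCol (S i) := fun i => hasCol_of_lt (by rw [hS.ncard_compl]; exact hr₁)
  have h1 := hCount_succ S (ℓ + 1)
  have h2 := vCount_succ S (ℓ + 1)
  have h3 := hCount_succ S ℓ
  obtain ⟨r1, -⟩ := (hrow (0 + ℓ)).one_le_relCount hn₁
  obtain ⟨-, r2⟩ := (hrow (0 + (ℓ + 1))).one_le_relCount hn₁
  obtain ⟨-, c2⟩ := (hcol (0 + (ℓ + 1))).one_le_relCount hn₂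
  have hA' : S (0 + (ℓ + 1)) = A := by rw [zero_add, hkA]
  rw [hA'] at h1 h2 r2 c2
  rw [card_word hN] at h1 h2 h3 ⊢
  generalize relCount (fun a b : A => HStep a.1 b.1) = hs at *
  generalize relCount (fun a b : A => VStep a.1 b.1) = vs at *
  generalize relCount (fun a b : A => HWrap a.1 b.1) = hw at *
  generalize relCount (fun a b : A => VWrap a.1 b.1) = vw at *
  generalize relCount (fun a b : S (0 + ℓ) => HStep a.1 b.1) = hs' at *
  have h4 : (n₁ * n₂ - r) ^ ℓ ≤ hCount S ℓ.succ := by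
    rw [Nat.succ_eq_add_one, h3]
    exact (Nat.le_mul_of_pos_right _ r1).trans (Nat.le_add_right _ _)
  have h5 : (n₁ * n₂ - r) ^ (ℓ + 2) ≤
      (n₁ * n₂ - r) ^ (ℓ + 1) * hs + (n₁ * n₂ - r) ^ (ℓ + 1) * vs := by
    rw [pow_succ, ← mul_add]
    exact Nat.mul_le_mul_left _ (by omega)
  have h6 : hCount S (ℓ + 1) ≤ hCount S (ℓ + 1) * hw := Nat.le_mul_of_pos_right _ r2
  rw [h1, h2]
  simp only [Nat.succ_eq_add_one] at h4
  omega

end Counting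

section TwoByTwo

/-- In a `2 × 2` grid with one missing cell there are fewer edges than vertices: a block contains at most
one horizontal and one vertical edge, and at most one edge crosses a common side of two blocks. -/
theorem card_edges_two_by_two {S : ℕ → Set (Fin 2 × Fin 2)} (hS : Generic 1 S) (ℓ : ℕ) :
    hCount S ℓ + vCount S ℓ + 1 ≤ Nat.card (Word S 0 ℓ) := by
  have hN : ∀ i, (S i).ncard = 3 := fun i => by have := hS.ncard i; omega
  have hmiss : ∀ i, ∃ c, c ∉ S i := by
    intro i
    by_contra! h
    have h1 := hS.ncard_compl i
    rw [(S i).eq_univ_of_forall h] at h1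
    simp at h1
  -- A relation that holds for at most one pair of cells distinct from the missing cell `c`.
  have key : ∀ (R : Fin 2 × Fin 2 → Fin 2 × Fin 2 → Prop),
      (∀ c a b a' b', R a b → R a' b' → a ≠ c → b ≠ c → a' ≠ c → b' ≠ c → a = a' ∧ b = b') →
      ∀ i, relCount (fun a b : S i => R a.1 b.1) ≤ 1 := by
    intro R hR i
    obtain ⟨c, hc⟩ := hmiss i
    have hne : ∀ a : S i, a.1 ≠ c := fun a h => hc (h ▸ a.2)
    refine Finite.card_le_one_iff_subsingleton.2 ⟨?_⟩
    rintro ⟨⟨a, b⟩, h⟩ ⟨⟨a', b'⟩, h'⟩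
    obtain ⟨h1, h2⟩ := hR c _ _ _ _ h h' (hne _) (hne _) (hne _) (hne _)
    exact Subtype.ext (Prod.ext (Subtype.ext h1) (Subtype.ext h2))
  induction ℓ with
  | zero =>
    have h0 : Subsingleton (Word S 0 0) := ⟨fun v w => Subtype.ext (Subsingleton.elim _ _)⟩
    have h1 : hCount S 0 = 0 := by
      refine Nat.card_eq_zero.2 (Or.inl ⟨?_⟩)
      rintro ⟨⟨v, w⟩, h⟩
      rw [Subsingleton.elim v w] at h
      simp [Word.HAdj] at h
    have h2 : vCount S 0 = 0 := by
      refine Nat.card_eq_zero.2 (Or.inl ⟨?_⟩)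
      rintro ⟨⟨v, w⟩, h⟩
      rw [Subsingleton.elim v w] at h
      simp [Word.VAdj] at h
    rw [h1, h2, card_word hN]
    simp
  | succ ℓ ih =>
    have k1 := key HStep (by
      rintro ⟨c, d⟩ ⟨a, b⟩ ⟨a', b'⟩ ⟨p, q⟩ ⟨p', q'⟩ ⟨h1, h2⟩ ⟨h3, h4⟩
      simp only [ne_eq, Prod.mk.injEq, Fin.ext_iff] at *
      omega) (0 + ℓ)
    have k2 := key VStep (by
      rintro ⟨c, d⟩ ⟨a, b⟩ ⟨a', b'⟩ ⟨p, q⟩ ⟨p', q'⟩ ⟨h1, h2⟩ ⟨h3, h4⟩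
      simp only [ne_eq, Prod.mk.injEq, Fin.ext_iff] at *
      omega) (0 + ℓ)
    have k3 := key HWrap (by
      rintro ⟨c, d⟩ ⟨a, b⟩ ⟨a', b'⟩ ⟨p, q⟩ ⟨p', q'⟩ ⟨h1, h2, h5⟩ ⟨h3, h4, h6⟩
      simp only [ne_eq, Prod.mk.injEq, Fin.ext_iff] at *
      omega) (0 + ℓ)
    have k4 := key VWrap (by
      rintro ⟨c, d⟩ ⟨a, b⟩ ⟨a', b'⟩ ⟨p, q⟩ ⟨p', q'⟩ ⟨h1, h2, h5⟩ ⟨h3, h4, h6⟩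
      simp only [ne_eq, Prod.mk.injEq, Fin.ext_iff] at *
      omega) (0 + ℓ)
    have h1 := hCount_succ S ℓ
    have h2 := vCount_succ S ℓ
    have m1 := Nat.mul_le_mul_left (Nat.card (Word S 0 ℓ)) k1
    have m2 := Nat.mul_le_mul_left (Nat.card (Word S 0 ℓ)) k2
    have m3 := Nat.mul_le_mul_left (hCount S ℓ) k3
    have m4 := Nat.mul_le_mul_left (vCount S ℓ) k4
    have h3 : Nat.card (Word S 0 (ℓ + 1)) = Nat.card (Word S 0 ℓ) * 3 := by
      rw [card_word hN, card_word hN, pow_succ]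
    omega

end TwoByTwo
end NAFractal

namespace NAFractal

/-! ### Collapsing maps of graphs -/

section Collapse

variable {V' V : Type*} {K' : PreAbstractSimplicialComplex V'} {K : PreAbstractSimplicialComplex V}
  {p : V' → V}

theorem chainMap_point (hK' : IsGraph K') (hK : IsGraph K) (hp : IsSimplicial K' K p) (v : V') :
    chainMap hp 0 (hK'.point v) = hK.point (p v) := by
  apply Subtype.ext
  rw [chainMap_coe]
  simp only [IsGraph.point, tupleMap, Finsupp.lmapDomain_apply, Finsupp.mapDomain_single]
  rfl

theorem coe_chainMap_orientedEdge (hp : IsSimplicial K' K p) {a b : V'}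
    (h : ∃ s ∈ K'.faces, (s : Set V') = {a, b}) :
    (chainMap hp 1 (orientedEdge h) : (Fin 2 → V) →₀ ℤ) = altSum ![p a, p b] := by
  rw [chainMap_coe]
  refine (tupleMap_altSum p ![a, b]).trans (congrArg altSum ?_)
  funext i
  fin_cases i <;> rfl

theorem chainMap_orientedEdge (hp : IsSimplicial K' K p) {a b : V'}
    (h : ∃ s ∈ K'.faces, (s : Set V') = {a, b}) {x y : V} (hx : p a = x) (hy : p b = y)
    (h' : ∃ s ∈ K.faces, (s : Set V) = {x, y}) :
    chainMap hp 1 (orientedEdge h) = orientedEdge h' := by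
  subst hx hy
  exact Subtype.ext (coe_chainMap_orientedEdge hp h)

theorem chainMap_orientedEdge_eq_zero (hp : IsSimplicial K' K p) {a b : V'}
    (h : ∃ s ∈ K'.faces, (s : Set V') = {a, b}) (hab : p a = p b) :
    chainMap hp 1 (orientedEdge h) = 0 := by
  apply Subtype.ext
  rw [coe_chainMap_orientedEdge, altSum_eq_zero]
  · rfl
  · intro hinj
    exact absurd (hinj (a₁ := 0) (a₂ := 1) hab) (by decide)

/-- A map between the vertex sets of graphs, simplicial or not, extends to `0`-chains. -/
theorem exists_pointMap (hK' : IsGraph K') (hK : IsGraph K) (c : V → V') :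
    ∃ s : chains K 0 →ₗ[ℤ] chains K' 0, ∀ v, s (hK.point v) = hK'.point (c v) := by
  refine ⟨LinearMap.codRestrict (chains K' 0) (tupleMap c 1 ∘ₗ (chains K 0).subtype) fun x => by
    rw [hK'.chains_zero]; trivial, fun v => Subtype.ext ?_⟩
  simp only [LinearMap.codRestrict_apply, LinearMap.comp_apply, Submodule.subtype_apply,
    IsGraph.point, tupleMap, Finsupp.lmapDomain_apply, Finsupp.mapDomain_single]
  rfl

/-- If every edge `(a, b)` of `K` lifts to a chain of `K'` from `c a` to `c b`, for a section `c` of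
the vertex map, then every `1`-chain lifts compatibly with the boundary. -/
theorem exists_lift_chain (hK' : IsGraph K') (hK : IsGraph K) (hp : IsSimplicial K' K p)
    {c : V → V'} (hedge : ∀ a b (h : ∃ s ∈ K.faces, (s : Set V) = {a, b}),
      ∃ β, chainMap hp 1 β = orientedEdge h ∧
        boundary K' 0 β = hK'.point (c b) - hK'.point (c a))
    {s : chains K 0 →ₗ[ℤ] chains K' 0} (hs : ∀ v, s (hK.point v) = hK'.point (c v))
    (z : chains K 1) : ∃ b, chainMap hp 1 b = z ∧ boundary K' 0 b = s (boundary K 0 z) := by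
  have hz : z ∈ Submodule.span ℤ {c | ∃ (a b : V) (h : ∃ s ∈ K.faces, (s : Set V) = {a, b}),
      c = orientedEdge h} := span_orientedEdge K ▸ trivial
  induction hz using Submodule.span_induction with
  | mem x hx =>
    obtain ⟨a, b, h, rfl⟩ := hx
    obtain ⟨β, h1, h2⟩ := hedge a b h
    exact ⟨β, h1, by rw [h2, hK.boundary_orientedEdge, map_sub, hs, hs]⟩
  | zero => exact ⟨0, map_zero _, by simp⟩
  | add x y _ _ hx hy =>
    obtain ⟨b, h1, h2⟩ := hx
    obtain ⟨b', h1', h2'⟩ := hy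
    exact ⟨b + b', by rw [map_add, h1, h1'], by simp only [map_add, h2, h2']⟩
  | smul m x _ hx =>
    obtain ⟨b, h1, h2⟩ := hx
    exact ⟨m • b, by rw [map_smul, h1], by simp only [map_smul, h2]⟩

theorem homologyMap_one_surjective_of_lift (hK' : IsGraph K') (hK : IsGraph K)
    (hp : IsSimplicial K' K p) {c : V → V'}
    (hedge : ∀ a b (h : ∃ s ∈ K.faces, (s : Set V) = {a, b}),
      ∃ β, chainMap hp 1 β = orientedEdge h ∧
        boundary K' 0 β = hK'.point (c b) - hK'.point (c a)) :
    Function.Surjective (homologyMap hp 1) := by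
  intro x
  obtain ⟨⟨z, hz⟩, rfl⟩ := homologyClass_surjective K 1 x
  obtain ⟨s, hs⟩ := exists_pointMap hK' hK c
  obtain ⟨b, h1, h2⟩ := exists_lift_chain hK' hK hp hedge hs z
  have hz' : boundary K 0 z = 0 := hz
  have hb : boundary K' 0 b = 0 := by rw [h2, hz', map_zero]
  refine ⟨homologyClass K' 1 ⟨b, hb⟩, ?_⟩
  rw [homologyMap_homologyClass]
  congr 1
  exact Subtype.ext h1

theorem homologyMap_zero_surjective (hK' : IsGraph K') (hK : IsGraph K)
    (hp : IsSimplicial K' K p) {c : V → V'} (hc : ∀ v, p (c v) = v) :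
    Function.Surjective (homologyMap hp 0) := by
  intro x
  obtain ⟨⟨z, hz⟩, rfl⟩ := homologyClass_surjective K 0 x
  obtain ⟨s, hs⟩ := exists_pointMap hK' hK c
  have h1 : chainMap hp 0 ∘ₗ s = LinearMap.id := by
    refine LinearMap.ext_on hK.span_point ?_
    rintro _ ⟨v, rfl⟩
    simp only [LinearMap.comp_apply, hs, chainMap_point hK' hK, hc, LinearMap.id_apply]
  refine ⟨homologyClass K' 0 ⟨s z, trivial⟩, ?_⟩
  rw [homologyMap_homologyClass]
  congr 1
  exact Subtype.ext (LinearMap.congr_fun h1 z)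

/-- If moreover every vertex of `K'` is connected with the distinguished vertex of its fibre, the
map is injective on `H₀`. -/
theorem homologyMap_zero_injective_of_lift (hK' : IsGraph K') (hK : IsGraph K)
    (hp : IsSimplicial K' K p) {c : V → V'}
    (hedge : ∀ a b (h : ∃ s ∈ K.faces, (s : Set V) = {a, b}),
      ∃ β, chainMap hp 1 β = orientedEdge h ∧
        boundary K' 0 β = hK'.point (c b) - hK'.point (c a))
    (hfib : ∀ u, ∃ β, boundary K' 0 β = hK'.point (c (p u)) - hK'.point u) :
    Function.Injective (homologyMap hp 0) := by
  rw [injective_iff_map_eq_zero]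
  intro x hx
  obtain ⟨⟨z, hz⟩, rfl⟩ := homologyClass_surjective K' 0 x
  rw [homologyMap_homologyClass, homologyClass_eq_zero_iff] at hx
  obtain ⟨y, hy⟩ := hx
  obtain ⟨s, hs⟩ := exists_pointMap hK' hK c
  obtain ⟨b, h1, h2⟩ := exists_lift_chain hK' hK hp hedge hs y
  rw [homologyClass_eq_zero_iff]
  have h3 : ∀ z : chains K' 0, s (chainMap hp 0 z) - z ∈ boundaries K' 0 := by
    intro z
    have hz : z ∈ Submodule.span ℤ (Set.range hK'.point) := hK'.span_point ▸ trivial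
    induction hz using Submodule.span_induction with
    | mem x hx =>
      obtain ⟨v, rfl⟩ := hx
      obtain ⟨β, hβ⟩ := hfib v
      rw [chainMap_point hK' hK, hs]
      exact ⟨β, hβ⟩
    | zero => simp
    | add x y _ _ hx hy =>
      rw [map_add, map_add, add_sub_add_comm]
      exact add_mem hx hy
    | smul m x _ hx =>
      rw [map_smul, map_smul, ← smul_sub]
      exact Submodule.smul_mem _ _ hx
  have h4 : s (chainMap hp 0 z) ∈ boundaries K' 0 := ⟨b, by rw [h2, hy]⟩
  have h5 := sub_mem h4 (h3 z)
  rwa [sub_sub_cancel] at h5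

theorem finrank_lt_of_surjective {R M N : Type*} [CommRing R] [IsDomain R] [IsPrincipalIdealRing R]
    [AddCommGroup M] [AddCommGroup N] [Module R M] [Module R N] [Module.Free R M] [Module.Finite R M] (f : M →ₗ[R] N)
    (hf : Function.Surjective f) {x : M} (hx : x ≠ 0) (hfx : f x = 0) :
    Module.finrank R N < Module.finrank R M := by
  have h1 := Submodule.finrank_quotient_add_finrank (LinearMap.ker f)
  rw [(f.quotKerEquivOfSurjective hf).finrank_eq] at h1
  have h2 : Nontrivial (LinearMap.ker f) :=
    ⟨⟨x, hfx⟩, 0, fun h => hx (congrArg Subtype.val h)⟩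
  have h3 : 0 < Module.finrank R (LinearMap.ker f) := Module.finrank_pos
  omega

/-- An isolated vertex of `K'` that shares its fibre with another vertex makes the rank of `H₀`
strictly larger than that of `K`. -/
theorem finrank_homology_zero_lt [Finite V'] (hK' : IsGraph K') (hK : IsGraph K)
    (hp : IsSimplicial K' K p) {c : V → V'} (hc : ∀ v, p (c v) = v) {u u' : V'} (hne : u ≠ u')
    (huu' : p u = p u') (hiso : ∀ w, w ≠ u → ¬ ∃ s ∈ K'.faces, (s : Set V') = {u, w}) :
    Module.finrank ℤ (Homology K 0) < Module.finrank ℤ (Homology K' 0) := by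
  have := hK'.free_homology 0
  refine finrank_lt_of_surjective _ (homologyMap_zero_surjective hK' hK hp hc)
    (x := homologyClass K' 0 ⟨hK'.point u - hK'.point u', trivial⟩) ?_ ?_
  · rw [ne_eq, homologyClass_eq_zero_iff]
    -- The coefficient of an isolated vertex vanishes on boundaries.
    let φ : chains K' 0 →ₗ[ℤ] ℤ := Finsupp.lapply (fun _ => u) ∘ₗ (chains K' 0).subtype
    have hφ : φ (hK'.point u) = 1 := by simp [φ, IsGraph.point]
    have hφ' : ∀ w, w ≠ u → φ (hK'.point w) = 0 := by
      intro w hw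
      simp [φ, IsGraph.point, funext_iff, hw]
    have h1 : boundaries K' 0 ≤ LinearMap.ker φ := by
      rw [boundaries, LinearMap.range_eq_map, ← span_orientedEdge, Submodule.map_span_le]
      rintro _ ⟨a, b, h, rfl⟩
      rw [LinearMap.mem_ker, hK'.boundary_orientedEdge, map_sub]
      by_cases ha : a = u
      · by_cases hb : b = u
        · rw [ha, hb, sub_self]
        · subst ha
          exact absurd h (hiso b hb)
      · by_cases hb : b = u
        · subst hb
          rw [Set.pair_comm] at h
          exact absurd h (hiso a ha)
        · rw [hφ' a ha, hφ' b hb, sub_self]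
    intro h2
    have h3 : φ (hK'.point u - hK'.point u') = 0 := h1 h2
    rw [map_sub, hφ, hφ' u' hne.symm] at h3
    norm_num at h3
  · rw [homologyMap_homologyClass, homologyClass_eq_zero_iff]
    simp only [map_sub, chainMap_point hK' hK, huu', sub_self]
    exact zero_mem _

end Collapse

/-! ### Lifting chains along full rows and columns -/

section Lifting

variable {n₁ n₂ : ℕ} {S : ℕ → Set (Fin n₁ × Fin n₂)} {j ℓ : ℕ}
  (hn₁ : 2 ≤ n₁) (hn₂ : 2 ≤ n₂) (hK : ∀ ℓ, IsGraph (rectNerve n₁ n₂ S j ℓ))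

/-- Two words are linked if they are connected by a chain that collapses to zero in the previous
level. -/
def Linked (u u' : Word S j (ℓ + 1)) : Prop :=
  ∃ β, chainMap (isSimplicial_init hn₁ hn₂ S j ℓ) 1 β = 0 ∧
    boundary (rectNerve n₁ n₂ S j (ℓ + 1)) 0 β = (hK (ℓ + 1)).point u' - (hK (ℓ + 1)).point u

variable {hn₁ hn₂ hK}

theorem Linked.refl (u : Word S j (ℓ + 1)) : Linked hn₁ hn₂ hK u u := ⟨0, by simp, by simp⟩

theorem Linked.symm {u u' : Word S j (ℓ + 1)} (h : Linked hn₁ hn₂ hK u u') :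
    Linked hn₁ hn₂ hK u' u := by
  obtain ⟨β, h1, h2⟩ := h
  exact ⟨-β, by rw [map_neg, h1, neg_zero], by rw [map_neg, h2, neg_sub]⟩

theorem Linked.trans {u u' u'' : Word S j (ℓ + 1)} (h : Linked hn₁ hn₂ hK u u')
    (h' : Linked hn₁ hn₂ hK u' u'') : Linked hn₁ hn₂ hK u u'' := by
  obtain ⟨β, h1, h2⟩ := h
  obtain ⟨β', h1', h2'⟩ := h'
  exact ⟨β + β', by rw [map_add, h1, h1', add_zero], by rw [map_add, h2, h2']; abel⟩

theorem linked_of_mem_faces {u u' : Word S j (ℓ + 1)} (hu : u.init = u'.init)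
    (h : ∃ s ∈ (rectNerve n₁ n₂ S j (ℓ + 1)).faces, (s : Set (Word S j (ℓ + 1))) = {u, u'}) :
    Linked hn₁ hn₂ hK u u' :=
  ⟨orientedEdge h, chainMap_orientedEdge_eq_zero _ h hu, (hK (ℓ + 1)).boundary_orientedEdge h⟩

/-- A reflexive, symmetric and transitive relation on `Fin n` that relates consecutive elements
relates all elements. -/
theorem rel_of_succ {n : ℕ} {R : Fin n → Fin n → Prop} (hrefl : ∀ i, R i i)
    (hsymm : ∀ i k, R i k → R k i) (htrans : ∀ i k m, R i k → R k m → R i m)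
    (hsucc : ∀ i k : Fin n, (k : ℕ) = i + 1 → R i k) (i k : Fin n) : R i k := by
  have key : ∀ (d : ℕ) (i k : Fin n), (k : ℕ) = i + d → R i k := by
    intro d
    induction d with
    | zero =>
      intro i k h
      rw [Fin.ext (by simpa using h) (a := k) (b := i)]
      exact hrefl i
    | succ d ih =>
      intro i k h
      exact htrans _ _ _ (ih i ⟨i + d, by omega⟩ rfl) (hsucc _ _ (by simp only; omega))
  rcases le_total (i : ℕ) k with h | h
  · exact key (k - i) i k (by omega)
  · exact hsymm _ _ (key (i - k) k i (by omega))

variable (hn₁ hn₂)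

theorem linked_row (hrow : ∀ m, HasRow (S m)) (v : Word S j ℓ) {y : Fin n₂}
    (hy : ∀ x, (x, y) ∈ S (j + ℓ)) (x x' : Fin n₁) :
    Linked hn₁ hn₂ hK (v.snoc ⟨(x, y), hy x⟩) (v.snoc ⟨(x', y), hy x'⟩) := by
  refine rel_of_succ (R := fun x x' => Linked hn₁ hn₂ hK (v.snoc ⟨(x, y), hy x⟩)
    (v.snoc ⟨(x', y), hy x'⟩)) (fun _ => .refl _) (fun _ _ => .symm) (fun _ _ _ => .trans) ?_ x x'
  intro x x' h
  refine linked_of_mem_faces (by rw [Word.init_snoc, Word.init_snoc])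
    (Word.HAdj.mem_faces hn₁ hn₂ hrow ((Word.hAdj_succ_iff _ _).2 (Or.inl ?_)))
  simp only [Word.init_snoc, Word.last_snoc]
  exact ⟨trivial, h, rfl⟩

theorem linked_col (hcol : ∀ m, HasCol (S m)) (v : Word S j ℓ) {x : Fin n₁}
    (hx : ∀ y, (x, y) ∈ S (j + ℓ)) (y y' : Fin n₂) :
    Linked hn₁ hn₂ hK (v.snoc ⟨(x, y), hx y⟩) (v.snoc ⟨(x, y'), hx y'⟩) := by
  refine rel_of_succ (R := fun y y' => Linked hn₁ hn₂ hK (v.snoc ⟨(x, y), hx y⟩)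
    (v.snoc ⟨(x, y'), hx y'⟩)) (fun _ => .refl _) (fun _ _ => .symm) (fun _ _ _ => .trans) ?_ y y'
  intro y y' h
  refine linked_of_mem_faces (by rw [Word.init_snoc, Word.init_snoc])
    (Word.VAdj.mem_faces hn₁ hn₂ hcol ((Word.vAdj_succ_iff _ _).2 (Or.inl ?_)))
  simp only [Word.init_snoc, Word.last_snoc]
  exact ⟨trivial, rfl, h⟩

theorem exists_lift_of_linked {v w : Word S j ℓ}
    (h : ∃ s ∈ (rectNerve n₁ n₂ S j ℓ).faces, (s : Set (Word S j ℓ)) = {v, w})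
    {u u' x x' : Word S j (ℓ + 1)} (hu : u.init = v) (hu' : u'.init = w)
    (hf : ∃ s ∈ (rectNerve n₁ n₂ S j (ℓ + 1)).faces, (s : Set (Word S j (ℓ + 1))) = {u, u'})
    (h1 : Linked hn₁ hn₂ hK x u) (h2 : Linked hn₁ hn₂ hK u' x') :
    ∃ β, chainMap (isSimplicial_init hn₁ hn₂ S j ℓ) 1 β = orientedEdge h ∧
      boundary (rectNerve n₁ n₂ S j (ℓ + 1)) 0 β =
        (hK (ℓ + 1)).point x' - (hK (ℓ + 1)).point x := by
  obtain ⟨β, hβ, hβ'⟩ := h1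
  obtain ⟨γ, hγ, hγ'⟩ := h2
  refine ⟨β + orientedEdge hf + γ, ?_, ?_⟩
  · rw [map_add, map_add, hβ, hγ, chainMap_orientedEdge _ hf hu hu' h, zero_add, add_zero]
  · rw [map_add, map_add, hβ', hγ', (hK (ℓ + 1)).boundary_orientedEdge]
    abel

theorem orientedEdge_swap {V : Type*} {K : PreAbstractSimplicialComplex V} {a b : V}
    (h : ∃ s ∈ K.faces, (s : Set V) = {a, b}) (h' : ∃ s ∈ K.faces, (s : Set V) = {b, a}) :
    orientedEdge h = - orientedEdge h' := by
  apply Subtype.ext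
  simp [orientedEdge, altSum_fin_two]

/-- A full row `y` and a full column `x` meet in the cell `(x, y)`. An edge between two rectangles
lifts to a path between their central cells, along the rows or along the columns. -/
theorem exists_lift_edge (hS : NoCorner S) (hrow : ∀ m, HasRow (S m)) (hcol : ∀ m, HasCol (S m))
    {x : Fin n₁} {y : Fin n₂} (hy : ∀ x, (x, y) ∈ S (j + ℓ)) (hx : ∀ y, (x, y) ∈ S (j + ℓ))
    (v w : Word S j ℓ)
    (h : ∃ s ∈ (rectNerve n₁ n₂ S j ℓ).faces, (s : Set (Word S j ℓ)) = {v, w}) :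
    ∃ β, chainMap (isSimplicial_init hn₁ hn₂ S j ℓ) 1 β = orientedEdge h ∧
      boundary (rectNerve n₁ n₂ S j (ℓ + 1)) 0 β =
        (hK (ℓ + 1)).point (w.snoc ⟨(x, y), hx y⟩) - (hK (ℓ + 1)).point (v.snoc ⟨(x, y), hx y⟩) := by
  have hH : ∀ (v w : Word S j ℓ)
      (h : ∃ s ∈ (rectNerve n₁ n₂ S j ℓ).faces, (s : Set (Word S j ℓ)) = {v, w}), v.HAdj w →
      ∃ β, chainMap (isSimplicial_init hn₁ hn₂ S j ℓ) 1 β = orientedEdge h ∧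
        boundary (rectNerve n₁ n₂ S j (ℓ + 1)) 0 β = (hK (ℓ + 1)).point (w.snoc ⟨(x, y), hx y⟩) -
          (hK (ℓ + 1)).point (v.snoc ⟨(x, y), hx y⟩) := by
    intro v w h hvw
    refine exists_lift_of_linked hn₁ hn₂ h (Word.init_snoc v ⟨(⟨n₁ - 1, by omega⟩, y), hy _⟩)
      (Word.init_snoc w ⟨(⟨0, by omega⟩, y), hy _⟩)
      (Word.HAdj.mem_faces hn₁ hn₂ hrow ((Word.hAdj_succ_iff _ _).2 (Or.inr ?_)))
      (linked_row hn₁ hn₂ hrow v hy _ _) (linked_row hn₁ hn₂ hrow w hy _ _)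
    simp only [Word.init_snoc, Word.last_snoc]
    exact ⟨hvw, by simp only; omega, rfl, rfl⟩
  have hV : ∀ (v w : Word S j ℓ)
      (h : ∃ s ∈ (rectNerve n₁ n₂ S j ℓ).faces, (s : Set (Word S j ℓ)) = {v, w}), v.VAdj w →
      ∃ β, chainMap (isSimplicial_init hn₁ hn₂ S j ℓ) 1 β = orientedEdge h ∧
        boundary (rectNerve n₁ n₂ S j (ℓ + 1)) 0 β = (hK (ℓ + 1)).point (w.snoc ⟨(x, y), hx y⟩) -
          (hK (ℓ + 1)).point (v.snoc ⟨(x, y), hx y⟩) := by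
    intro v w h hvw
    refine exists_lift_of_linked hn₁ hn₂ h (Word.init_snoc v ⟨(x, ⟨n₂ - 1, by omega⟩), hx _⟩)
      (Word.init_snoc w ⟨(x, ⟨0, by omega⟩), hx _⟩)
      (Word.VAdj.mem_faces hn₁ hn₂ hcol ((Word.vAdj_succ_iff _ _).2 (Or.inr ?_)))
      (linked_col hn₁ hn₂ hcol v hx _ _) (linked_col hn₁ hn₂ hcol w hx _ _)
    simp only [Word.init_snoc, Word.last_snoc]
    exact ⟨hvw, rfl, by simp only; omega, rfl⟩
  by_cases hvw : v = w
  · -- A degenerate edge is zero as a chain.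
    subst hvw
    refine ⟨0, ?_, by simp⟩
    rw [map_zero]
    apply Subtype.ext
    simp [orientedEdge, altSum_fin_two]
  · have h' := h
    rw [Set.pair_comm] at h'
    rcases adj_of_mem_faces hn₁ hn₂ hS hvw h with ha | ha | ha | ha
    · exact hH v w h ha
    · obtain ⟨β, h1, h2⟩ := hH w v h' ha
      exact ⟨-β, by rw [map_neg, h1, orientedEdge_swap h h'], by rw [map_neg, h2, neg_sub]⟩
    · exact hV v w h ha
    · obtain ⟨β, h1, h2⟩ := hV w v h' ha
      exact ⟨-β, by rw [map_neg, h1, orientedEdge_swap h h'], by rw [map_neg, h2, neg_sub]⟩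

theorem homologyMap_init_one_surjective (hn₁ : 2 ≤ n₁) (hn₂ : 2 ≤ n₂)
    (hK : ∀ ℓ, IsGraph (rectNerve n₁ n₂ S j ℓ)) (hS : NoCorner S) (hrow : ∀ m, HasRow (S m))
    (hcol : ∀ m, HasCol (S m)) (ℓ : ℕ) :
    Function.Surjective (homologyMap (isSimplicial_init hn₁ hn₂ S j ℓ) 1) := by
  obtain ⟨y, hy⟩ := hrow (j + ℓ)
  obtain ⟨x, hx⟩ := hcol (j + ℓ)
  exact homologyMap_one_surjective_of_lift (hK _) (hK _) _ (c := fun v => v.snoc ⟨(x, y), hx y⟩)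
    (exists_lift_edge hn₁ hn₂ hS hrow hcol hy hx)

theorem homologyMap_init_zero_surjective (hn₁ : 2 ≤ n₁) (hn₂ : 2 ≤ n₂)
    (hK : ∀ ℓ, IsGraph (rectNerve n₁ n₂ S j ℓ)) (hne : ∀ m, (S m).Nonempty) (ℓ : ℕ) :
    Function.Surjective (homologyMap (isSimplicial_init hn₁ hn₂ S j ℓ) 0) := by
  obtain ⟨a, ha⟩ := hne (j + ℓ)
  exact homologyMap_zero_surjective (hK _) (hK _) _ (c := fun v => v.snoc ⟨a, ha⟩)
    fun v => Word.init_snoc v _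

/-- If one cell is missing in each level, the blocks are connected: every cell lies in a full row or
in a full column. -/
theorem homologyMap_init_zero_bijective (hn₁ : 2 ≤ n₁) (hn₂ : 2 ≤ n₂)
    (hK : ∀ ℓ, IsGraph (rectNerve n₁ n₂ S j ℓ)) (hS : NoCorner S)
    (h1 : ∀ m, (S m)ᶜ.ncard = 1) (ℓ : ℕ) :
    Function.Bijective (homologyMap (isSimplicial_init hn₁ hn₂ S j ℓ) 0) := by
  have hrow : ∀ m, HasRow (S m) := fun m => hasRow_of_lt (by rw [h1]; omega)
  have hcol : ∀ m, HasCol (S m) := fun m => hasCol_of_lt (by rw [h1]; omega)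
  obtain ⟨y, hy⟩ := hrow (j + ℓ)
  obtain ⟨x, hx⟩ := hcol (j + ℓ)
  refine ⟨homologyMap_zero_injective_of_lift (hK _) (hK _) _
    (c := fun v => v.snoc ⟨(x, y), hx y⟩) (exists_lift_edge hn₁ hn₂ hS hrow hcol hy hx) fun u => ?_,
    homologyMap_init_zero_surjective hn₁ hn₂ hK (fun m => ⟨_, (hrow m).choose_spec ⟨0, by omega⟩⟩) ℓ⟩
  suffices h : Linked hn₁ hn₂ hK u (u.init.snoc ⟨(x, y), hx y⟩) by
    obtain ⟨β, -, hβ⟩ := h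
    exact ⟨β, hβ⟩
  rw [← Word.snoc_init_last u, Word.init_snoc]
  generalize u.init = v
  obtain ⟨⟨a, b⟩, hab⟩ := u.last
  obtain ⟨⟨c, d⟩, hcd⟩ := Set.ncard_eq_one.1 (h1 (j + ℓ))
  have hmem : ∀ z, z ≠ (c, d) → z ∈ S (j + ℓ) := by
    intro z hz
    by_contra hcon
    have : z ∈ ({(c, d)} : Set _) := hcd ▸ hcon
    exact hz this
  have hab' : (a, b) ≠ (c, d) := by
    rintro h
    have : (c, d) ∈ (S (j + ℓ))ᶜ := hcd ▸ rfl
    exact this (h ▸ hab)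
  by_cases hb : b = d
  · have ha : a ≠ c := fun h => hab' (Prod.ext h hb)
    have hcol' : ∀ y, (a, y) ∈ S (j + ℓ) := fun y => hmem _ fun h => ha (congrArg Prod.fst h)
    exact (linked_col hn₁ hn₂ hcol v hcol' b y).trans (linked_row hn₁ hn₂ hrow v hy a x)
  · have hrow' : ∀ x, (x, b) ∈ S (j + ℓ) := fun y => hmem _ fun h => hb (congrArg Prod.snd h)
    exact (linked_row hn₁ hn₂ hrow v hrow' a x).trans (linked_col hn₁ hn₂ hcol v hx b y)

end Lifting
end NAFractal

namespace NAFractal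

/-! ### Exponential growth rates -/

section Growth

/-- The upper limit is determined by an upper bound for all `k` and a lower bound for infinitely many `k`,
and is insensitive to constant factors and to a shift of the index. -/
theorem growthRate_eq_log {a : ℕ → ℝ} {N : ℝ} (hN : 1 ≤ N) (hup : ∀ k, a k ≤ 2 * N ^ k)
    (hlow : ∀ m, ∃ k, m ≤ k ∧ N ^ k ≤ a (k + 3)) :
    growthRate a = ((Real.log N : ℝ) : EReal) := by
  have hN0 : 0 < N := by linarith
  have h0 : Tendsto (fun k : ℕ => 1 / (k : ℝ)) atTop (nhds 0) := tendsto_one_div_atTop_nhds_zero_nat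
  have hlog : ∀ x : ℝ, 0 < x → ENNReal.log (ENNReal.ofReal x) = ((Real.log x : ℝ) : EReal) := by
    intro x hx
    rw [ENNReal.log_ofReal, if_neg (not_le.2 hx)]
  have hnn : ∀ k : ℕ, (0 : EReal) ≤ ((1 / (k : ℝ) : ℝ) : EReal) := by
    intro k
    exact_mod_cast (by positivity : (0 : ℝ) ≤ 1 / (k : ℝ))
  apply le_antisymm
  · have h1 : Tendsto (fun k : ℕ => 1 / (k : ℝ) * Real.log 2 + Real.log N) atTop
        (nhds (Real.log N)) := by
      simpa using (h0.mul_const (Real.log 2)).add_const (Real.log N)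
    have h2 := (continuous_coe_real_ereal.tendsto (Real.log N)).comp h1
    rw [← h2.limsup_eq]
    refine limsup_le_limsup ?_
    filter_upwards [eventually_gt_atTop 0] with k hk
    have hk' : (k : ℝ) ≠ 0 := by positivity
    have h3 : ENNReal.log (ENNReal.ofReal (a k)) ≤ ((Real.log (2 * N ^ k) : ℝ) : EReal) := by
      rw [← hlog _ (by positivity)]
      exact ENNReal.log_monotone (ENNReal.ofReal_le_ofReal (hup k))
    refine (mul_le_mul_of_nonneg_left h3 (hnn k)).trans (le_of_eq ?_)
    rw [← EReal.coe_mul, Real.log_mul (by norm_num) (by positivity), Real.log_pow]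
    simp only [Function.comp_apply]
    congr 1
    field_simp
  · have h1 : Tendsto (fun k : ℕ => Real.log N - 1 / (k : ℝ) * (3 * Real.log N)) atTop
        (nhds (Real.log N)) := by
      simpa using (h0.mul_const (3 * Real.log N)).const_sub (Real.log N)
    have h2 := (continuous_coe_real_ereal.tendsto (Real.log N)).comp h1
    refine le_of_forall_lt fun c hc => ?_
    obtain ⟨c', hcc', hc'⟩ := exists_between hc
    refine hcc'.trans_le (le_limsup_of_frequently_le ?_)
    have h3 := h2.eventually_const_lt hc'
    obtain ⟨M, hM⟩ := eventually_atTop.1 h3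
    rw [frequently_atTop]
    intro m
    obtain ⟨k, hk, hak⟩ := hlow (max m M)
    have hpos : 0 < N ^ k := by positivity
    refine ⟨k + 3, by have := le_max_left m M; omega, ?_⟩
    refine (hM (k + 3) (by have := le_max_right m M; omega)).le.trans ?_
    have h4 : ((Real.log (N ^ k) : ℝ) : EReal) ≤ ENNReal.log (ENNReal.ofReal (a (k + 3))) := by
      rw [← hlog _ hpos]
      exact ENNReal.log_monotone (ENNReal.ofReal_le_ofReal hak)
    refine le_trans (le_of_eq ?_) (mul_le_mul_of_nonneg_left h4 (hnn (k + 3)))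
    rw [← EReal.coe_mul, Real.log_pow]
    simp only [Function.comp_apply]
    congr 1
    have hk' : ((k : ℝ) + 3) ≠ 0 := by positivity
    push_cast
    field_simp
    ring

end Growth

/-! ### Few missing cells -/

section Few

variable {n₁ n₂ r : ℕ} {S : ℕ → Set (Fin n₁ × Fin n₂)}

/-- A vertex that is isolated in `𝒩_{1,ℓ+2}` and shares its prefix with another vertex exists for
infinitely many `ℓ`: remove the right and the upper neighbour of the lower left cell, and take a
rectangle without left and lower neighbours. -/
theorem Generic.exists_isolated (hn₁ : 2 ≤ n₁) (hn₂ : 2 ≤ n₂) (hS : Generic r S) (hr : 2 ≤ r)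
    (hrN : r + 2 ≤ n₁ * n₂) (m : ℕ) :
    ∃ ℓ, m ≤ ℓ ∧ ∃ u u' : Word S 0 (ℓ + 1), u ≠ u' ∧ u.init = u'.init ∧
      ∀ w, w ≠ u → ¬ ∃ s ∈ (rectNerve n₁ n₂ S 0 (ℓ + 1)).faces,
        (s : Set (Word S 0 (ℓ + 1))) = {u, w} := by
  classical
  let o : Fin n₁ × Fin n₂ := (⟨0, by omega⟩, ⟨0, by omega⟩)
  let a : Fin n₁ × Fin n₂ := (⟨1, by omega⟩, ⟨0, by omega⟩)
  let b : Fin n₁ × Fin n₂ := (⟨0, by omega⟩, ⟨1, by omega⟩)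
  have hao : a ≠ o := by simp [a, o]
  have hbo : b ≠ o := by simp [b, o]
  obtain ⟨B, hB, hBo, hBr⟩ := Finset.exists_subsuperset_card_eq (s := {a, b})
    (t := Finset.univ.erase o) (n := r) (by
      intro x hx
      simp only [Finset.mem_insert, Finset.mem_singleton] at hx
      rcases hx with rfl | rfl <;> simp [hao, hbo])
    (Finset.card_le_two.trans hr)
    (by
      rw [Finset.card_erase_of_mem (Finset.mem_univ _)]
      simp
      omega)
  obtain ⟨ℓ, hℓ, hSℓ⟩ := hS.often (B : Set _)ᶜ (by
    rw [compl_compl, Set.ncard_coe_finset, hBr]) m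
  refine ⟨ℓ, hℓ, ?_⟩
  rw [← zero_add ℓ] at hSℓ
  have hoS : o ∈ S (0 + ℓ) := by
    rw [hSℓ]
    intro h
    simpa using hBo h
  have haS : a ∉ S (0 + ℓ) := by
    rw [hSℓ]
    simpa using hB (by simp : a ∈ ({a, b} : Finset _))
  have hbS : b ∉ S (0 + ℓ) := by
    rw [hSℓ]
    simpa using hB (by simp : b ∈ ({a, b} : Finset _))
  have hcard : 1 < (S (0 + ℓ)).ncard := by
    have := hS.ncard (0 + ℓ)
    omega
  obtain ⟨c, hcS, hco⟩ := Set.exists_ne_of_one_lt_ncard hcard o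
  have hne : Nonempty (Word S 0 ℓ) := by
    have h : ∀ i, (S i).Nonempty := hS.nonempty (by omega)
    choose w hw using h
    exact ⟨⟨fun i => w (0 + i), fun i => hw _⟩⟩
  -- A rectangle `v` that minimises the sum of the coordinates has no left and no lower neighbour.
  obtain ⟨v, hv⟩ := Finite.exists_min fun v : Word S 0 ℓ => v.px + v.py
  refine ⟨v.snoc ⟨o, hoS⟩, v.snoc ⟨c, hcS⟩, ?_, by rw [Word.init_snoc, Word.init_snoc], ?_⟩
  · intro h
    have := congrArg Word.last h
    rw [Word.last_snoc, Word.last_snoc, Subtype.mk.injEq] at this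
    exact hco this.symm
  · intro w hw hf
    have hstep : ∀ (x : S (0 + ℓ)), x.1 ≠ a ∧ x.1 ≠ b := fun x =>
      ⟨fun h => haS (h ▸ x.2), fun h => hbS (h ▸ x.2)⟩
    obtain ⟨h1, h2⟩ := hstep w.last
    have h3 := hv w.init
    rcases adj_of_mem_faces hn₁ hn₂ (hS.noCorner hn₁ hn₂ (by omega) (by omega)) hw.symm hf with
      h | h | h | h
    · rw [Word.hAdj_succ_iff] at h
      simp only [Word.init_snoc, Word.last_snoc, HStep, HWrap, o] at h
      rcases h with ⟨-, h4, h5⟩ | ⟨-, h4, -⟩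
      · exact h1 (Prod.ext (Fin.ext h4) h5)
      · omega
    · rw [Word.hAdj_succ_iff] at h
      simp only [Word.init_snoc, Word.last_snoc, HStep, HWrap, o, Word.HAdj] at h
      omega
    · rw [Word.vAdj_succ_iff] at h
      simp only [Word.init_snoc, Word.last_snoc, VStep, VWrap, o] at h
      rcases h with ⟨-, h4, h5⟩ | ⟨-, -, h4, -⟩
      · exact h2 (Prod.ext h4 (Fin.ext h5))
      · omega
    · rw [Word.vAdj_succ_iff] at h
      simp only [Word.init_snoc, Word.last_snoc, VStep, VWrap, o, Word.VAdj] at h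
      omega

variable (hn₁ : 2 ≤ n₁) (hn₂ : 2 ≤ n₂) (hS : Generic r S)
include hn₁ hn₂ hS

theorem Generic.isGraph (hr₁ : 1 ≤ r) (hr : r < n₁ * n₂) (j ℓ : ℕ) :
    IsGraph (rectNerve n₁ n₂ S j ℓ) :=
  isGraph_rectNerve hn₁ hn₂ (hS.nonempty hr) (hS.noCorner hn₁ hn₂ hr.le hr₁) j ℓ

omit hn₁ hn₂ in
theorem Generic.hasRow (hr : r < n₂) (m : ℕ) : HasRow (S m) :=
  hasRow_of_lt (by rwa [hS.ncard_compl])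

omit hn₁ hn₂ in
theorem Generic.hasCol (hr : r < n₁) (m : ℕ) : HasCol (S m) :=
  hasCol_of_lt (by rwa [hS.ncard_compl])

theorem Generic.isOrientation (hr₁ : 1 ≤ r) (h₁ : r < n₁) (h₂ : r < n₂) (ℓ : ℕ) :
    IsOrientation (rectNerve n₁ n₂ S 0 ℓ) {e | e.1.HAdj e.2 ∨ e.1.VAdj e.2} :=
  isOrientation_rectNerve hn₁ hn₂ (hS.noCorner hn₁ hn₂ (by nlinarith) hr₁) (hS.hasRow h₂)
    (hS.hasCol h₁) 0 ℓ

/-- The Euler characteristic of the graph `𝒩_{1,ℓ+1}`. -/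
theorem Generic.finrank_homology (hr₁ : 1 ≤ r) (h₁ : r < n₁) (h₂ : r < n₂) (ℓ : ℕ) :
    Module.finrank ℤ (Homology (rectNerve n₁ n₂ S 0 ℓ) 1) + Nat.card (Word S 0 ℓ) =
      Module.finrank ℤ (Homology (rectNerve n₁ n₂ S 0 ℓ) 0) + (hCount S ℓ + vCount S ℓ) := by
  rw [← card_orientation]
  exact (hS.isGraph hn₁ hn₂ hr₁ (by nlinarith) 0 ℓ).finrank_homology
    (hS.isOrientation hn₁ hn₂ hr₁ h₁ h₂ ℓ)

theorem Generic.finrank_homology_one_le (hr₁ : 1 ≤ r) (h₁ : r < n₁) (h₂ : r < n₂) (ℓ : ℕ) :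
    Module.finrank ℤ (Homology (rectNerve n₁ n₂ S 0 ℓ) 1) ≤ 2 * (n₁ * n₂ - r) ^ ℓ := by
  have h := (hS.isGraph hn₁ hn₂ hr₁ (by nlinarith) 0 ℓ).finrank_homology_one_le
    (hS.isOrientation hn₁ hn₂ hr₁ h₁ h₂ ℓ)
  rw [card_orientation] at h
  have h3 := hCount_le S ℓ
  have h4 := vCount_le S ℓ
  rw [card_word (N := n₁ * n₂ - r) (fun m => by have := hS.ncard m; omega)] at h3 h4
  omega

/-- Both growth rates are governed by the inequalities `H₀ + N^ℓ ≤ H₁` on infinitely many levels and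
`H₁ ≤ 2 N^ℓ` on all levels, where `N = n₁n₂ - r`. -/
theorem Generic.growthRate_eq (hr₁ : 1 ≤ r) (h₁ : r < n₁) (h₂ : r < n₂)
    (h : n₁ + n₂ + r ≤ n₁ * n₂) {b : ℕ → ℝ} (hb : ∀ ℓ, 0 ≤ b ℓ)
    (hb' : ∀ ℓ, b ℓ ≤ Module.finrank ℤ (Homology (rectNerve n₁ n₂ S 0 ℓ) 0)) :
    growthRate (fun k => (Module.finrank ℤ (Homology (rectNerve n₁ n₂ S 0 (k - 1)) 1) : ℝ) -
      b (k - 1)) = ((Real.log ((n₁ : ℝ) * n₂ - r) : ℝ) : EReal) := by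
  have hcast : ((n₁ * n₂ - r : ℕ) : ℝ) = (n₁ : ℝ) * n₂ - r := by
    rw [Nat.cast_sub (by omega), Nat.cast_mul]
  rw [← hcast]
  have hN : (1 : ℝ) ≤ ((n₁ * n₂ - r : ℕ) : ℝ) := by
    exact_mod_cast (by omega : 1 ≤ n₁ * n₂ - r)
  refine growthRate_eq_log hN (fun k => ?_) fun m => ?_
  · have h3 : (Module.finrank ℤ (Homology (rectNerve n₁ n₂ S 0 (k - 1)) 1) : ℝ) ≤
        2 * ((n₁ * n₂ - r : ℕ) : ℝ) ^ (k - 1) := by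
      exact_mod_cast hS.finrank_homology_one_le hn₁ hn₂ hr₁ h₁ h₂ (k - 1)
    have h4 := pow_le_pow_right₀ hN (Nat.sub_le k 1)
    linarith [hb (k - 1)]
  · obtain ⟨ℓ, hℓ, hE⟩ := hS.exists_many_edges hn₁ hn₂ h₁ h₂ h m
    refine ⟨ℓ, hℓ, ?_⟩
    have h3 := hS.finrank_homology hn₁ hn₂ hr₁ h₁ h₂ (ℓ + 2)
    have h4 : ((n₁ * n₂ - r : ℕ) : ℝ) ^ ℓ +
        Module.finrank ℤ (Homology (rectNerve n₁ n₂ S 0 (ℓ + 2)) 0) ≤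
        Module.finrank ℤ (Homology (rectNerve n₁ n₂ S 0 (ℓ + 2)) 1) := by
      exact_mod_cast (by omega : (n₁ * n₂ - r) ^ ℓ +
        Module.finrank ℤ (Homology (rectNerve n₁ n₂ S 0 (ℓ + 2)) 0) ≤
        Module.finrank ℤ (Homology (rectNerve n₁ n₂ S 0 (ℓ + 2)) 1))
    have h5 := hb' (ℓ + 2)
    change _ ≤ (Module.finrank ℤ (Homology (rectNerve n₁ n₂ S 0 (ℓ + 2)) 1) : ℝ) - b (ℓ + 2)
    linarith

theorem Generic.aleph0_le_rank_cech_one (hr₁ : 1 ≤ r) (h₁ : r < n₁) (h₂ : r < n₂)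
    (h : n₁ + n₂ + r ≤ n₁ * n₂) :
    Cardinal.aleph0 ≤ Module.rank ℤ (CechHomology (rectLimit n₁ n₂ S) 1) := by
  have hG := hS.isGraph hn₁ hn₂ hr₁ (by omega) 0
  refine rect_aleph0_le_rank_cech hn₁ hn₂ (hS.nonempty (by omega))
    (homologyMap_init_one_surjective hn₁ hn₂ hG (hS.noCorner hn₁ hn₂ (by omega) hr₁)
      (hS.hasRow h₂) (hS.hasCol h₁)) (fun ℓ => (hG ℓ).free_homology 1) fun m => ?_
  obtain ⟨ℓ, hℓ, hE⟩ := hS.exists_many_edges hn₁ hn₂ h₁ h₂ h m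
  have h3 := hS.finrank_homology hn₁ hn₂ hr₁ h₁ h₂ (ℓ + 2)
  have h4 : ℓ < (n₁ * n₂ - r) ^ ℓ := Nat.lt_pow_self (by omega)
  exact ⟨ℓ + 2, by omega⟩

/-- New components appear on infinitely many levels. -/
theorem Generic.aleph0_le_rank_cech_zero (hr : 2 ≤ r) (hrN : r + 2 ≤ n₁ * n₂) :
    Cardinal.aleph0 ≤ Module.rank ℤ (CechHomology (rectLimit n₁ n₂ S) 0) := by
  have hG := hS.isGraph hn₁ hn₂ (by omega) (by omega) 0
  have hne := hS.nonempty (by omega)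
  have hsurj := homologyMap_init_zero_surjective hn₁ hn₂ hG hne
  refine rect_aleph0_le_rank_cech hn₁ hn₂ hne hsurj (fun ℓ => (hG ℓ).free_homology 0) ?_
  have hmono : Monotone fun ℓ => Module.finrank ℤ (Homology (rectNerve n₁ n₂ S 0 ℓ) 0) :=
    monotone_nat_of_le_succ fun ℓ => LinearMap.finrank_le_finrank_of_surjective (hsurj ℓ)
  intro m
  induction m with
  | zero => exact ⟨0, Nat.zero_le _⟩
  | succ m ih =>
    obtain ⟨k, hk⟩ := ih
    obtain ⟨ℓ, hℓ, u, u', huu', hinit, hiso⟩ := hS.exists_isolated hn₁ hn₂ hr hrN k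
    obtain ⟨a, ha⟩ := hne (0 + ℓ)
    have h1 := finrank_homology_zero_lt (hG (ℓ + 1)) (hG ℓ) (isSimplicial_init hn₁ hn₂ S 0 ℓ)
      (c := fun v => v.snoc ⟨a, ha⟩) (fun v => Word.init_snoc v _) huu' hinit hiso
    exact ⟨ℓ + 1, (hk.trans (hmono hℓ)).trans_lt h1⟩

end Few

section One

variable {n₁ n₂ : ℕ} {S : ℕ → Set (Fin n₁ × Fin n₂)} (hn₁ : 2 ≤ n₁) (hn₂ : 2 ≤ n₂)
  (hS : Generic 1 S)
include hn₁ hn₂ hS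

/-- The complex of level zero is a single vertex without edges. -/
theorem finrank_homology_zero_root :
    Module.finrank ℤ (Homology (rectNerve n₁ n₂ S 0 0) 0) = 1 := by
  have hE := hS.finrank_homology hn₁ hn₂ le_rfl (by omega) (by omega) 0
  have hV : Nat.card (Word S 0 0) = 1 := by
    rw [card_word (N := n₁ * n₂ - 1) (fun m => by have := hS.ncard m; omega), pow_zero]
  have hs : Subsingleton (Word S 0 0) := (Nat.card_eq_one_iff_unique.1 hV).1
  have hD : hCount S 0 + vCount S 0 = 0 := by
    rw [← card_orientation, Nat.card_eq_zero]
    left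
    rw [Set.isEmpty_coe_sort, Set.eq_empty_iff_forall_notMem]
    rintro ⟨v, w⟩ h
    rw [Subsingleton.elim w v] at h
    simp [Word.HAdj, Word.VAdj] at h
  have h1 := hS.isGraph hn₁ hn₂ le_rfl (by nlinarith) 0 0 |>.finrank_homology_one_le
    (hS.isOrientation hn₁ hn₂ le_rfl (by omega) (by omega) 0)
  rw [card_orientation] at h1
  omega

theorem nonempty_cech_zero_equiv_int :
    Nonempty (CechHomology (rectLimit n₁ n₂ S) 0 ≃ₗ[ℤ] ℤ) := by
  have hG := hS.isGraph hn₁ hn₂ le_rfl (by nlinarith) 0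
  obtain ⟨e⟩ := rect_cech_equiv_of_bijective hn₁ hn₂ (hS.nonempty (by nlinarith))
    (homologyMap_init_zero_bijective hn₁ hn₂ hG (hS.noCorner hn₁ hn₂ (by nlinarith) le_rfl)
      hS.ncard_compl)
  have := (hG 0).free_homology 0
  exact ⟨e.trans (LinearEquiv.ofFinrankEq _ _ (by
    rw [finrank_homology_zero_root hn₁ hn₂ hS, Module.finrank_self]))⟩

/-- All complexes are connected. -/
theorem finrank_homology_zero_eq_one (ℓ : ℕ) :
    Module.finrank ℤ (Homology (rectNerve n₁ n₂ S 0 ℓ) 0) = 1 := by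
  have hG := hS.isGraph hn₁ hn₂ le_rfl (by nlinarith) 0
  induction ℓ with
  | zero => exact finrank_homology_zero_root hn₁ hn₂ hS
  | succ ℓ ih =>
    exact (LinearEquiv.ofBijective _ (homologyMap_init_zero_bijective hn₁ hn₂ hG
      (hS.noCorner hn₁ hn₂ (by nlinarith) le_rfl) hS.ncard_compl ℓ)).finrank_eq.trans ih

end One

/-- For `n₁ = n₂ = 2` the connected graphs `𝒩_{1,k}` have fewer edges than vertices, so that they are
trees. -/
theorem subsingleton_cech_one {S : ℕ → Set (Fin 2 × Fin 2)} (hS : Generic 1 S) :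
    Subsingleton (CechHomology (rectLimit 2 2 S) 1) := by
  refine rect_cech_subsingleton le_rfl le_rfl (hS.nonempty (by omega)) fun ℓ => ?_
  have h1 := hS.finrank_homology le_rfl le_rfl le_rfl (by omega) (by omega) ℓ
  have h2 := card_edges_two_by_two hS ℓ
  rw [finrank_homology_zero_eq_one le_rfl le_rfl hS] at h1
  have := (hS.isGraph le_rfl le_rfl le_rfl (by omega) 0 ℓ).free_homology 1
  exact Module.finrank_eq_zero_iff_of_free ℤ _ |>.1 (by omega)

end NAFractal

namespace NAFractal

/-! ### Connected components when a full row or column is removed -/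

section Components

variable {n₁ n₂ : ℕ} {S : ℕ → Set (Fin n₁ × Fin n₂)}

/-- If finitely many closed sets cover a preconnected set and are labelled such that sets with a common
point have the same label, then all those that meet the preconnected set have the same label. -/
theorem IsPreconnected.eq_of_finite_closed_cover {X ι : Type*} [TopologicalSpace X] [Finite ι]
    {C : Set X} (hC : IsPreconnected C) {F : ι → Set X} (hF : ∀ i, IsClosed (F i))
    (hcov : C ⊆ ⋃ i, F i) {g : ι → ℕ} (hg : ∀ i i', (F i ∩ F i').Nonempty → g i = g i')
    {x y : X} (hx : x ∈ C) (hy : y ∈ C) {i i' : ι} (hxi : x ∈ F i) (hyi : y ∈ F i') :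
    g i = g i' := by
  by_contra hne
  have h1 : IsClosed (⋃ k ∈ {k | g k = g i}, F k) :=
    (Set.toFinite _).isClosed_biUnion fun k _ => hF k
  have h2 : IsClosed (⋃ k ∈ {k | g k ≠ g i}, F k) :=
    (Set.toFinite _).isClosed_biUnion fun k _ => hF k
  obtain ⟨z, -, hz, hz'⟩ := isPreconnected_closed_iff.1 hC _ _ h1 h2 (fun z hz => by
    obtain ⟨k, hk⟩ := Set.mem_iUnion.1 (hcov hz)
    by_cases h : g k = g i
    · exact Or.inl (Set.mem_biUnion h hk)
    · exact Or.inr (Set.mem_biUnion h hk))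
    ⟨x, hx, Set.mem_biUnion (show g i = g i from rfl) hxi⟩
    ⟨y, hy, Set.mem_biUnion (show g i' ≠ g i from fun h => hne h.symm) hyi⟩
  simp only [Set.mem_iUnion, Set.mem_ofPred_eq, exists_prop] at hz hz'
  obtain ⟨k, hk, hzk⟩ := hz
  obtain ⟨k', hk', hzk'⟩ := hz'
  exact hk' ((hg k' k ⟨z, hzk', hzk⟩).trans hk)

variable (hn₁ : 2 ≤ n₁) (hn₂ : 2 ≤ n₂)
include hn₁ hn₂

/-- If no limit set meets the lower side of the unit square, then rectangles in different rows of the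
grid contain disjoint parts of `J`, so that connected subsets of `J` are horizontal. -/
theorem snd_eq_of_isPreconnected (h0 : ∀ k, ∀ t ∈ tailSet S k, t.2 ≠ 0) {C : Set (ℝ × ℝ)}
    (hC : IsPreconnected C) (hCJ : C ⊆ tailSet S 0) {x y : ℝ × ℝ} (hx : x ∈ C) (hy : y ∈ C) :
    x.2 = y.2 := by
  have hn : (n₂ : ℝ) ≠ 0 := by exact_mod_cast (by omega : n₂ ≠ 0)
  refine eq_of_abs_sub_le_pow hn₂ fun ℓ => ?_
  obtain ⟨v, hv⟩ := exists_word_of_mem_tailSet hn₁ hn₂ ℓ (hCJ hx)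
  obtain ⟨w, hw⟩ := exists_word_of_mem_tailSet hn₁ hn₂ ℓ (hCJ hy)
  have hvw : v.py = w.py := by
    refine IsPreconnected.eq_of_finite_closed_cover hC (F := fun v : Word S 0 ℓ => v.cell)
      (fun v => (Word.isCompact_cell hn₁ hn₂ v).isClosed) (fun z hz => Set.mem_iUnion.2
        (exists_word_of_mem_tailSet hn₁ hn₂ ℓ (hCJ hz))) (g := Word.py) ?_ hx hy hv hw
    rintro v w ⟨z, hz, hz'⟩
    obtain ⟨t, ht, rfl⟩ := (Word.mem_cell hn₁ hn₂).1 hz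
    obtain ⟨s, hs, hst⟩ := (Word.mem_cell hn₁ hn₂).1 hz'
    rcases eq_or_adjacent_of_div_eq (pow_ne_zero ℓ hn) (tailSet_subset_unitSquare ht).2
      (tailSet_subset_unitSquare hs).2 (congrArg Prod.snd hst).symm with h | h | h
    · exact h.1
    · exact absurd h.2.2 (h0 _ s hs)
    · exact absurd h.2.1 (h0 _ t ht)
  obtain ⟨t, ht, rfl⟩ := (Word.mem_cell hn₁ hn₂).1 hv
  obtain ⟨s, hs, rfl⟩ := (Word.mem_cell hn₁ hn₂).1 hw
  simp only [hvw]
  exact abs_sub_le_of_same_pos hn₂ (tailSet_subset_unitSquare ht).2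
    (tailSet_subset_unitSquare hs).2 _ _

theorem fst_eq_of_isPreconnected (h0 : ∀ k, ∀ t ∈ tailSet S k, t.1 ≠ 0) {C : Set (ℝ × ℝ)}
    (hC : IsPreconnected C) (hCJ : C ⊆ tailSet S 0) {x y : ℝ × ℝ} (hx : x ∈ C) (hy : y ∈ C) :
    x.1 = y.1 := by
  have hn : (n₁ : ℝ) ≠ 0 := by exact_mod_cast (by omega : n₁ ≠ 0)
  refine eq_of_abs_sub_le_pow hn₁ fun ℓ => ?_
  obtain ⟨v, hv⟩ := exists_word_of_mem_tailSet hn₁ hn₂ ℓ (hCJ hx)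
  obtain ⟨w, hw⟩ := exists_word_of_mem_tailSet hn₁ hn₂ ℓ (hCJ hy)
  have hvw : v.px = w.px := by
    refine IsPreconnected.eq_of_finite_closed_cover hC (F := fun v : Word S 0 ℓ => v.cell)
      (fun v => (Word.isCompact_cell hn₁ hn₂ v).isClosed) (fun z hz => Set.mem_iUnion.2
        (exists_word_of_mem_tailSet hn₁ hn₂ ℓ (hCJ hz))) (g := Word.px) ?_ hx hy hv hw
    rintro v w ⟨z, hz, hz'⟩
    obtain ⟨t, ht, rfl⟩ := (Word.mem_cell hn₁ hn₂).1 hz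
    obtain ⟨s, hs, hst⟩ := (Word.mem_cell hn₁ hn₂).1 hz'
    rcases eq_or_adjacent_of_div_eq (pow_ne_zero ℓ hn) (tailSet_subset_unitSquare ht).1
      (tailSet_subset_unitSquare hs).1 (congrArg Prod.fst hst).symm with h | h | h
    · exact h.1
    · exact absurd h.2.2 (h0 _ s hs)
    · exact absurd h.2.1 (h0 _ t ht)
  obtain ⟨t, ht, rfl⟩ := (Word.mem_cell hn₁ hn₂).1 hv
  obtain ⟨s, hs, rfl⟩ := (Word.mem_cell hn₁ hn₂).1 hw
  simp only [hvw]
  exact abs_sub_le_of_same_pos hn₁ (tailSet_subset_unitSquare ht).1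
    (tailSet_subset_unitSquare hs).1 _ _

omit hn₁ hn₂ in
theorem isCompact_connectedComponentIn {X : Type*} [TopologicalSpace X] [T2Space X] {F : Set X}
    (hF : IsCompact F) {x : X} (hx : x ∈ F) : IsCompact (connectedComponentIn F x) :=
  hF.of_isClosed_subset (isClosed_of_closure_subset (isPreconnected_connectedComponentIn.closure
    |>.subset_connectedComponentIn (subset_closure (mem_connectedComponentIn hx))
      (closure_minimal (connectedComponentIn_subset F x) hF.isClosed)))
    (connectedComponentIn_subset F x)

theorem connectedComponentIn_eq_horizontal (h0 : ∀ k, ∀ t ∈ tailSet S k, t.2 ≠ 0) {x : ℝ × ℝ}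
    (hx : x ∈ tailSet S 0) : ∃ a b y : ℝ, a ≤ b ∧
      connectedComponentIn (tailSet S 0) x = Set.Icc a b ×ˢ {y} := by
  let C := connectedComponentIn (tailSet S 0) x
  have hxC : x ∈ C := mem_connectedComponentIn hx
  have hconn : IsConnected C := isConnected_connectedComponentIn_iff.2 hx
  have hcomp : IsCompact C := isCompact_connectedComponentIn (isCompact_tailSet hn₁ hn₂ S 0) hx
  have hsnd : ∀ z ∈ C, z.2 = x.2 := fun z hz =>
    snd_eq_of_isPreconnected hn₁ hn₂ h0 hconn.isPreconnected (connectedComponentIn_subset _ _) hz hxC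
  have himg := eq_Icc_of_connected_compact (hconn.image Prod.fst continuous_fst.continuousOn)
    (hcomp.image continuous_fst)
  refine ⟨sInf (Prod.fst '' C), sSup (Prod.fst '' C), x.2, ?_, ?_⟩
  · have : x.1 ∈ Prod.fst '' C := ⟨x, hxC, rfl⟩
    rw [himg] at this
    exact this.1.trans this.2
  · rw [← himg]
    ext z
    constructor
    · intro hz
      exact ⟨⟨z, hz, rfl⟩, hsnd z hz⟩
    · rintro ⟨⟨z', hz', h1⟩, h2⟩
      rwa [← Prod.ext h1 ((hsnd z' hz').trans h2.symm)]

theorem connectedComponentIn_eq_vertical (h0 : ∀ k, ∀ t ∈ tailSet S k, t.1 ≠ 0) {x : ℝ × ℝ}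
    (hx : x ∈ tailSet S 0) : ∃ a b y : ℝ, a ≤ b ∧
      connectedComponentIn (tailSet S 0) x = {y} ×ˢ Set.Icc a b := by
  let C := connectedComponentIn (tailSet S 0) x
  have hxC : x ∈ C := mem_connectedComponentIn hx
  have hconn : IsConnected C := isConnected_connectedComponentIn_iff.2 hx
  have hcomp : IsCompact C := isCompact_connectedComponentIn (isCompact_tailSet hn₁ hn₂ S 0) hx
  have hfst : ∀ z ∈ C, z.1 = x.1 := fun z hz =>
    fst_eq_of_isPreconnected hn₁ hn₂ h0 hconn.isPreconnected (connectedComponentIn_subset _ _) hz hxC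
  have himg := eq_Icc_of_connected_compact (hconn.image Prod.snd continuous_snd.continuousOn)
    (hcomp.image continuous_snd)
  refine ⟨sInf (Prod.snd '' C), sSup (Prod.snd '' C), x.1, ?_, ?_⟩
  · have : x.2 ∈ Prod.snd '' C := ⟨x, hxC, rfl⟩
    rw [himg] at this
    exact this.1.trans this.2
  · rw [← himg]
    ext z
    constructor
    · intro hz
      exact ⟨hfst z hz, ⟨z, hz, rfl⟩⟩
    · rintro ⟨h1, ⟨z', hz', h2⟩⟩
      rwa [← Prod.ext ((hfst z' hz').trans h1.symm) h2]

theorem exists_connectedComponentIn_eq_horizontal (h0 : ∀ k, ∀ t ∈ tailSet S k, t.2 ≠ 0)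
    (hrow : ∀ m, HasRow (S m)) : ∃ x ∈ tailSet S 0, ∃ y : ℝ,
      connectedComponentIn (tailSet S 0) x = Set.Icc 0 1 ×ˢ {y} := by
  obtain ⟨y, hy⟩ := exists_horizontal_segment hn₁ hn₂ hrow 0
  have hx : ((0 : ℝ), y) ∈ tailSet S 0 := hy 0 (by simp)
  refine ⟨(0, y), hx, y, Set.Subset.antisymm (fun z hz => ?_) ?_⟩
  · exact ⟨(tailSet_subset_unitSquare (connectedComponentIn_subset _ _ hz)).1,
      snd_eq_of_isPreconnected hn₁ hn₂ h0 isPreconnected_connectedComponentIn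
        (connectedComponentIn_subset _ _) hz (mem_connectedComponentIn hx)⟩
  · refine (isPreconnected_Icc.prod isPreconnected_singleton).subset_connectedComponentIn
      (by simp) ?_
    rintro ⟨z, z'⟩ ⟨hz, rfl⟩
    exact hy z hz

theorem exists_connectedComponentIn_eq_vertical (h0 : ∀ k, ∀ t ∈ tailSet S k, t.1 ≠ 0)
    (hcol : ∀ m, HasCol (S m)) : ∃ x ∈ tailSet S 0, ∃ y : ℝ,
      connectedComponentIn (tailSet S 0) x = {y} ×ˢ Set.Icc 0 1 := by
  obtain ⟨y, hy⟩ := exists_vertical_segment hn₁ hn₂ hcol 0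
  have hx : (y, (0 : ℝ)) ∈ tailSet S 0 := hy 0 (by simp)
  refine ⟨(y, 0), hx, y, Set.Subset.antisymm (fun z hz => ?_) ?_⟩
  · exact ⟨fst_eq_of_isPreconnected hn₁ hn₂ h0 isPreconnected_connectedComponentIn
        (connectedComponentIn_subset _ _) hz (mem_connectedComponentIn hx),
      (tailSet_subset_unitSquare (connectedComponentIn_subset _ _ hz)).2⟩
  · refine (isPreconnected_singleton.prod isPreconnected_Icc).subset_connectedComponentIn
      (by simp) ?_
    rintro ⟨z, z'⟩ ⟨rfl, hz⟩
    exact hy z' hz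

theorem isTotallyDisconnected_tailSet (h1 : ∀ k, ∀ t ∈ tailSet S k, t.1 ≠ 0)
    (h2 : ∀ k, ∀ t ∈ tailSet S k, t.2 ≠ 0) : IsTotallyDisconnected (tailSet S 0) :=
  fun _ hC hconn _ hx _ hy => Prod.ext (fst_eq_of_isPreconnected hn₁ hn₂ h1 hconn hC hx hy)
    (snd_eq_of_isPreconnected hn₁ hn₂ h2 hconn hC hx hy)

end Components
end NAFractal

namespace NAFractal

/-! ### Random index sets are generic -/

section Random

variable {Ω : Type*} [MeasurableSpace Ω] {P : Measure Ω}

theorem iIndepFun.iIndepSet_preimage {ι β : Type*} [MeasurableSpace β] {X : ι → Ω → β}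
    (hX : ∀ i, Measurable (X i)) (h : iIndepFun X P) {B : Set β} (hB : MeasurableSet B) :
    iIndepSet (fun i => X i ⁻¹' B) P := by
  rw [iIndepSet_iff_meas_biInter fun i => hX i hB]
  intro s
  exact h.measure_inter_preimage_eq_mul s fun _ _ => hB

/-- By the second Borel–Cantelli lemma, independent identically distributed random variables hit a
point of positive probability infinitely often. -/
theorem ae_frequently_eq {β : Type*} [MeasurableSpace β] [MeasurableSingletonClass β]
    [IsProbabilityMeasure P] {X : ℕ → Ω → β} (hX : ∀ i, Measurable (X i)) (h : iIndepFun X P)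
    {μ : Measure β} (hμ : ∀ i, P.map (X i) = μ) {b : β} (hb : μ {b} ≠ 0) :
    ∀ᵐ ω ∂P, ∀ j, ∃ m, j ≤ m ∧ X m ω = b := by
  have hmeas : ∀ i, P (X i ⁻¹' {b}) = μ {b} := fun i => by
    rw [← hμ i, Measure.map_apply (hX i) (measurableSet_singleton b)]
  have h1 := measure_limsup_eq_one (fun i => hX i (measurableSet_singleton b))
    (iIndepFun.iIndepSet_preimage hX h (measurableSet_singleton b)) (by
      simp only [hmeas]
      exact ENNReal.tsum_const_eq_top_of_ne_zero hb)
  have h2 : MeasurableSet (limsup (fun i => X i ⁻¹' {b}) atTop) :=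
    MeasurableSet.measurableSet_limsup fun i => hX i (measurableSet_singleton b)
  filter_upwards [(mem_ae_iff_prob_eq_one h2).2 h1] with ω hω j
  rw [mem_limsup_iff_frequently_mem, frequently_atTop] at hω
  obtain ⟨m, hm, hmb⟩ := hω j
  exact ⟨m, hm, hmb⟩

theorem ae_generic [IsProbabilityMeasure P] {n₁ n₂ r : ℕ} (hr : r ≤ n₁ * n₂)
    {I : ℕ → Ω → Set (Fin n₁ × Fin n₂)} (hmeas : ∀ j, Measurable (I j)) (hindep : iIndepFun I P)
    (hunif : ∀ j, P.map (I j) = uniformOn (subsetsMissing n₁ n₂ r)) :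
    ∀ᵐ ω ∂P, Generic r fun j => I j ω := by
  have hfin : (subsetsMissing n₁ n₂ r).Finite := Set.toFinite _
  have hM : MeasurableSet (subsetsMissing n₁ n₂ r) := hfin.measurableSet
  have hne : (subsetsMissing n₁ n₂ r).Nonempty := by
    obtain ⟨A, hA, -⟩ := exists_ncard_compl_eq (C := (∅ : Set (Fin n₁ × Fin n₂))) (r := r)
      (by simp) hr
    exact ⟨A, hA⟩
  have h1 : ∀ᵐ ω ∂P, ∀ j, I j ω ∈ subsetsMissing n₁ n₂ r := by
    refine ae_all_iff.2 fun j => ?_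
    have : P (I j ⁻¹' subsetsMissing n₁ n₂ r) = 1 := by
      rw [← Measure.map_apply (hmeas j) hM, hunif, uniformOn_self hfin hne]
    exact (mem_ae_iff_prob_eq_one (hmeas j hM)).2 this
  have h2 : ∀ᵐ ω ∂P, ∀ A : subsetsMissing n₁ n₂ r, ∀ j, ∃ m, j ≤ m ∧ I m ω = A.1 := by
    refine ae_all_iff.2 fun A => ae_frequently_eq hmeas hindep hunif ?_
    rw [Ne, uniformOn_eq_zero_iff hfin]
    exact (Set.nonempty_iff_ne_empty.1 ⟨A.1, A.2, rfl⟩)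
  filter_upwards [h1, h2] with ω hω hω'
  exact ⟨hω, fun A hA => hω' ⟨A, hA⟩⟩

end Random
end NAFractal

/-! ### Homology and components of random fractal rectangles -/

theorem mainTheorem1 {Ω : Type*} [MeasurableSpace Ω] (P : Measure Ω) [IsProbabilityMeasure P]
    (n₁ n₂ r : ℕ) (hn₁ : 2 ≤ n₁) (hn₂ : 2 ≤ n₂) (hr₁ : 1 ≤ r) (hr₂ : r ≤ n₁ * n₂ - 1)
    -- `I j` is the random index set of level `j + 1`
    (I : ℕ → Ω → Set (Fin n₁ × Fin n₂))
    (hmeas : ∀ j, Measurable (I j))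
    (hindep : iIndepFun I P)
    (hunif : ∀ j, P.map (I j) = uniformOn (subsetsMissing n₁ n₂ r)) :
    -- vanishing in degrees at least two
    (∀ᵐ ω ∂P, ∀ q, 2 ≤ q →
      Subsingleton (CechHomology (rectLimit n₁ n₂ fun j => I j ω) q)) ∧
    -- one square removed at each level
    (r = 1 →
      (∀ᵐ ω ∂P, Nonempty (CechHomology (rectLimit n₁ n₂ fun j => I j ω) 0 ≃ₗ[ℤ] ℤ)) ∧
      (n₁ = 2 ∧ n₂ = 2 →
        ∀ᵐ ω ∂P, Subsingleton (CechHomology (rectLimit n₁ n₂ fun j => I j ω) 1)) ∧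
      (¬ (n₁ = 2 ∧ n₂ = 2) →
        ∀ᵐ ω ∂P,
          growthRate (fun k =>
            (Module.finrank ℤ (Homology (rectNerve n₁ n₂ (fun j => I j ω) 0 (k - 1)) 1) : ℝ)) =
              ((Real.log ((n₁ : ℝ) * n₂ - r) : ℝ) : EReal) ∧
          Cardinal.aleph0 ≤
            Module.rank ℤ (CechHomology (rectLimit n₁ n₂ fun j => I j ω) 1))) ∧
    -- at least two, but fewer than `min n₁ n₂` squares removed
    (2 ≤ r ∧ r < min n₁ n₂ →
      ∀ᵐ ω ∂P,
        Cardinal.aleph0 ≤ Module.rank ℤ (CechHomology (rectLimit n₁ n₂ fun j => I j ω) 0) ∧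
        Cardinal.aleph0 ≤ Module.rank ℤ (CechHomology (rectLimit n₁ n₂ fun j => I j ω) 1) ∧
        growthRate (fun k =>
          (Module.finrank ℤ (Homology (rectNerve n₁ n₂ (fun j => I j ω) 0 (k - 1)) 1) : ℝ) -
          (Module.finrank ℤ (Homology (rectNerve n₁ n₂ (fun j => I j ω) 0 (k - 1)) 0) : ℝ)) =
            ((Real.log ((n₁ : ℝ) * n₂ - r) : ℝ) : EReal)) ∧
    -- all components are horizontal segments, and one of them has length one
    (n₁ ≤ r ∧ r < n₂ →
      ∀ᵐ ω ∂P,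
        (∀ x ∈ rectLimit n₁ n₂ (fun j => I j ω), ∃ a b y : ℝ, a ≤ b ∧
          connectedComponentIn (rectLimit n₁ n₂ fun j => I j ω) x = Set.Icc a b ×ˢ {y}) ∧
        (∃ x ∈ rectLimit n₁ n₂ (fun j => I j ω), ∃ y : ℝ,
          connectedComponentIn (rectLimit n₁ n₂ fun j => I j ω) x = Set.Icc 0 1 ×ˢ {y})) ∧
    -- all components are vertical segments, and one of them has length one
    (n₂ ≤ r ∧ r < n₁ →
      ∀ᵐ ω ∂P,
        (∀ x ∈ rectLimit n₁ n₂ (fun j => I j ω), ∃ a b y : ℝ, a ≤ b ∧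
          connectedComponentIn (rectLimit n₁ n₂ fun j => I j ω) x = {y} ×ˢ Set.Icc a b) ∧
        (∃ x ∈ rectLimit n₁ n₂ (fun j => I j ω), ∃ y : ℝ,
          connectedComponentIn (rectLimit n₁ n₂ fun j => I j ω) x = {y} ×ˢ Set.Icc 0 1)) ∧
    -- total disconnectedness
    (max n₁ n₂ ≤ r →
      ∀ᵐ ω ∂P, IsTotallyDisconnected (rectLimit n₁ n₂ fun j => I j ω)) ∧
    -- absence of torsion, and comparison with cohomology
    (∀ᵐ ω ∂P,
      (∀ j ℓ q, 1 ≤ ℓ →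
        Module.Free ℤ (Homology (rectNerve n₁ n₂ (fun j => I j ω) j ℓ) q) ∧
        Nonempty (Homology (rectNerve n₁ n₂ (fun j => I j ω) j ℓ) q ≃ₗ[ℤ]
          Cohomology (rectNerve n₁ n₂ (fun j => I j ω) j ℓ) q)) ∧
      (∀ q, Module.IsTorsionFree ℤ (CechHomology (rectLimit n₁ n₂ fun j => I j ω) q))) := by
  have hr : r < n₁ * n₂ := by
    have : 2 * 2 ≤ n₁ * n₂ := Nat.mul_le_mul hn₁ hn₂
    omega
  have hgen := ae_generic hr.le hmeas hindep hunif
  refine ⟨?_, fun h1 => ⟨?_, ?_, ?_⟩, ?_, ?_, ?_, ?_, ?_⟩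
  · filter_upwards [hgen] with ω hω q hq
    exact rect_cech_subsingleton hn₁ hn₂ (hω.nonempty hr) fun ℓ =>
      (hω.isGraph hn₁ hn₂ hr₁ hr 0 ℓ).subsingleton_homology hq
  · subst h1
    filter_upwards [hgen] with ω hω
    exact nonempty_cech_zero_equiv_int hn₁ hn₂ hω
  · rintro ⟨rfl, rfl⟩
    subst h1
    filter_upwards [hgen] with ω hω
    exact subsingleton_cech_one hω
  · intro h2
    subst h1
    have h3 : n₁ + n₂ + 1 ≤ n₁ * n₂ := by
      by_cases h : n₁ = 2
      · have : 3 ≤ n₂ := by omega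
        subst h
        omega
      · have : 3 ≤ n₁ := by omega
        nlinarith
    filter_upwards [hgen] with ω hω
    refine ⟨?_, hω.aleph0_le_rank_cech_one hn₁ hn₂ le_rfl (by omega) (by omega) h3⟩
    have h4 := hω.growthRate_eq hn₁ hn₂ le_rfl (by omega) (by omega) h3 (b := fun _ => 0)
      (fun _ => le_rfl) fun _ => Nat.cast_nonneg _
    simpa only [sub_zero] using h4
  · rintro ⟨h1, h2⟩
    rw [lt_min_iff] at h2
    have h3 : n₁ + n₂ + r ≤ n₁ * n₂ := by
      obtain ⟨a, rfl⟩ : ∃ a, n₁ = r + 1 + a := ⟨n₁ - (r + 1), by omega⟩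
      obtain ⟨b, rfl⟩ : ∃ b, n₂ = r + 1 + b := ⟨n₂ - (r + 1), by omega⟩
      nlinarith [Nat.zero_le (a * b), Nat.zero_le (a * r), Nat.zero_le (b * r)]
    filter_upwards [hgen] with ω hω
    exact ⟨hω.aleph0_le_rank_cech_zero hn₁ hn₂ h1 (by omega),
      hω.aleph0_le_rank_cech_one hn₁ hn₂ hr₁ h2.1 h2.2 h3,
      hω.growthRate_eq hn₁ hn₂ hr₁ h2.1 h2.2 h3
        (b := fun ℓ => Module.finrank ℤ (Homology (rectNerve n₁ n₂ (fun j => I j ω) 0 ℓ) 0))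
        (fun _ => Nat.cast_nonneg _) fun _ => le_rfl⟩
  · rintro ⟨h1, h2⟩
    filter_upwards [hgen] with ω hω
    have h0 := fun k t (ht : t ∈ tailSet (fun j => I j ω) k) =>
      hω.snd_ne_zero hn₁ hn₂ hr.le h1 ht
    exact ⟨fun x hx => connectedComponentIn_eq_horizontal hn₁ hn₂ h0 hx,
      exists_connectedComponentIn_eq_horizontal hn₁ hn₂ h0 (hω.hasRow h2)⟩
  · rintro ⟨h1, h2⟩
    filter_upwards [hgen] with ω hω
    have h0 := fun k t (ht : t ∈ tailSet (fun j => I j ω) k) =>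
      hω.fst_ne_zero hn₁ hn₂ hr.le h1 ht
    exact ⟨fun x hx => connectedComponentIn_eq_vertical hn₁ hn₂ h0 hx,
      exists_connectedComponentIn_eq_vertical hn₁ hn₂ h0 (hω.hasCol h2)⟩
  · intro h
    filter_upwards [hgen] with ω hω
    exact isTotallyDisconnected_tailSet hn₁ hn₂
      (fun k t ht => hω.fst_ne_zero hn₁ hn₂ hr.le ((le_max_right _ _).trans h) ht)
      (fun k t ht => hω.snd_ne_zero hn₁ hn₂ hr.le ((le_max_left _ _).trans h) ht)
  · filter_upwards [hgen] with ω hω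
    have hG := hω.isGraph hn₁ hn₂ hr₁ hr
    refine ⟨fun j ℓ q _ => ⟨(hG j ℓ).free_homology q, (hG j ℓ).homology_equiv_cohomology q⟩,
      fun q => rect_cech_isTorsionFree hn₁ hn₂ (hω.nonempty hr) fun ℓ => ?_⟩
    have := (hG 0 ℓ).free_homology q
    infer_instance
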